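/- **Conventions.** For a finite sequence $S$ let $|S|$ be its length and $\|S\|$ the number of distinct letters in it. A sequence $S$ is free of a set $P$ of sequences if no subsequence of $S$ is equal, up to an injective renaming of letters, to a member of $P$. A block is a sequence of distinct letters. $\mathrm{Ex}(P,n,m)$ is the maximum of $|S|$ over the $P$-free sequences $S$ with $\|S\|=n$ that can be partitioned into at most $m$ blocks. $\mathrm{Perm}_{r,k}$ is the set of concatenations of $k$ permutations of an $r$-letter alphabet; $\mathrm{dblPerm}_{r,k}$ is the set of concatenations $\sigma_1\cdots\sigma_k$ over an $r$-letter alphabet in which $\sigma_1,\sigma_k$ contain each letter exactly once and $\sigma_2,\dots,\sigma_{k-1}$ contain each letter exactly twice. Put $\mathrm{PERM}_{r,s}(n,m)=\mathrm{Ex}(\mathrm{Perm}_{r,s+1},n,m)$ and $\mathrm{dblPERM}_{r,s}(n,m)=\mathrm{Ex}(\mathrm{dblPerm}_{r,s+1},n,m)$. Let $a_{1,j}=2^j$ $(j\ge1)$, $a_{i,1}=2$ $(i\ge2)$ and $a_{i,j}=w\,a_{i-1,w}$ with $w=a_{i,j-1}$ $(i,j\ge2)$. For $i\ge1$ define $$K_{1,i}=1,\quad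 K_{2,i}=2,\quad K_{s,1}=2K_{s-1,1}\ (s\ge3),\quad K_{s,i}=2K_{s-1,i}+K_{s-2,i}(K_{s,i-1}-2)\ (s\ge3,\,i\ge2),$$ and, for $r\ge2$, the coefficients $K^{\mathrm{dbl}}_{s,i}$ (which also depend on $r$) by $$K^{\mathrm{dbl}}_{1,i}=1,\quad K^{\mathrm{dbl}}_{2,i}=2\cdot6^{r-1},\quad K^{\mathrm{dbl}}_{s,1}=2K^{\mathrm{dbl}}_{s-1,1}+1\ (s\ge3),$$ $$K^{\mathrm{dbl}}_{s,i}=K^{\mathrm{dbl}}_{s,i-1}+2K^{\mathrm{dbl}}_{s-1,i}+(K^{\mathrm{dbl}}_{s-2,i}+2)K_{s,i-1}\ (s\ge3,\,i\ge2).$$ **Upper bounds.** For every $r\ge2$ there is a constant $C$, depending only on $r$, such that for all integers $i\ge1$, $s\ge3$, $c\ge s-2$, $n,m\ge0$, if $j\ge1$ is minimal with $m\le(a_{i,j})^c$, then $$\mathrm{PERM}_{r,s}(n,m)\le K_{s,i}\bigl(n+C(cj)^{s-2}m\bigr),\qquad \mathrm{dblPERM}_{r,s}(n,m)\le K^{\mathrm{dbl}}_{s,i}\bigl(n+C(cj)^{s-2}m\bigr).$$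 Moreover $K_{s,1}=2^{s-1}$ and $K^{\mathrm{dbl}}_{s,1}<(6^{r-1}+1)2^s$ for $s\ge3$. **Closed forms.** Let $t=\lfloor (s-2)/2\rfloor$. For all $i\ge1$ (with implied constants depending only on $s$ for $K$ and only on $r,s$ for $K^{\mathrm{dbl}}$): - $K_{3,i}=2i+2$ and $K^{\mathrm{dbl}}_{3,i}=\Theta(i^2)$; - $K_{4,i}=\Theta(2^i)$ and $K^{\mathrm{dbl}}_{4,i}=\Theta(2^i)$; - $K_{5,i}\le 2^i(i+O(1))!$ and $K^{\mathrm{dbl}}_{5,i}\le 2^i(i+O(1))!$; - $K_{s,i}\le 2^{\binom{i+O(1)}{t}}$ and $K^{\mathrm{dbl}}_{s,i}\le 2^{\binom{i+O(1)}{t}}$ for even $s>4$; - $K_{s,i}\le 2^{\binom{i+O(1)}{t}\log_2(2(i+1)/e)}$ and $K^{\mathrm{dbl}}_{s,i}\le 2^{\binom{i+O(1)}{t}\log_2(2(i+1)/e)}$ for odd $s>5$. -/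

import Mathlib

open scoped Nat

/-! Sequences are lists.  Since only the pattern of equal letters matters, the sequences `S` whose
length is maximised are taken over the alphabet `ℕ`. -/

/-- `PatternIn σ S`: the sequence `σ` is isomorphic (equal up to an injective renaming of its
letters) to a subsequence of `S`. -/
def PatternIn {A B : Type*} (σ : List A) (S : List B) : Prop :=
  ∃ f : A → B, Set.InjOn f {x | x ∈ σ} ∧ (σ.map f).Sublist S

/-- `S` contains no member of the set `P` of forbidden sequences. -/
def AvoidsAll {A B : Type*} (P : Set (List A)) (S : List B) : Prop :=
  ∀ σ ∈ P, ¬ PatternIn σ S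

/-- `S` can be partitioned into at most `m` blocks, a block being a sequence of distinct letters. -/
def HasBlocks {B : Type*} (S : List B) (m : ℕ) : Prop :=
  ∃ L : List (List B), L.length ≤ m ∧ (∀ b ∈ L, b.Nodup) ∧ L.flatten = S

/-- The lengths of the `P`-free sequences with exactly `n` distinct letters and at most `m`
blocks. -/
def blockedLengths {A : Type*} (P : Set (List A)) (n m : ℕ) : Set ℕ :=
  {l | ∃ S : List ℕ, S.length = l ∧ AvoidsAll P S ∧ S.toFinset.card = n ∧ HasBlocks S m}

/-- The maximum defining the extremal function is over a bounded set. -/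
theorem blockedLengths_bddAbove {A : Type*} (P : Set (List A)) (n m : ℕ) :
    BddAbove (blockedLengths P n m) := by
  refine ⟨m * n, ?_⟩
  rintro l ⟨S, rfl, -, hn, L, hL, hnd, rfl⟩
  rw [List.length_flatten]
  calc (L.map List.length).sum ≤ (L.map List.length).length • n := by
        apply List.sum_le_card_nsmul
        intro x hx
        obtain ⟨b, hb, rfl⟩ := List.mem_map.1 hx
        rw [← List.toFinset_card_of_nodup (hnd b hb), ← hn]
        apply Finset.card_le_card
        intro y hy
        rw [List.mem_toFinset] at hy ⊢
        exact List.mem_flatten.2 ⟨b, hb, hy⟩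
    _ ≤ m * n := by
        rw [List.length_map, smul_eq_mul]
        exact Nat.mul_le_mul_right n hL

/-- The extremal function `Ex(P, n, m)`: the maximum length of a `P`-free sequence over an
`n`-letter alphabet that can be partitioned into at most `m` blocks. -/
noncomputable def exBlocked {A : Type*} (P : Set (List A)) (n m : ℕ) : ℕ :=
  sSup (blockedLengths P n m)

/-- All concatenations of `k` permutations of an `r`-letter alphabet. -/
def permSet (r k : ℕ) : Set (List (Fin r)) :=
  {σ | ∃ p : Fin k → List (Fin r),
    (∀ q x, (p q).count x = 1) ∧ σ = (List.ofFn p).flatten}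

/-- All concatenations `σ₁ ⋯ σₖ` of sequences over an `r`-letter alphabet where `σ₁` and `σₖ`
contain each letter exactly once and `σ₂, …, σₖ₋₁` contain each letter exactly twice. -/
def dblPermSet (r k : ℕ) : Set (List (Fin r)) :=
  {σ | ∃ p : Fin k → List (Fin r),
    (∀ q x, (p q).count x = if (q : ℕ) = 0 ∨ (q : ℕ) + 1 = k then 1 else 2) ∧
    σ = (List.ofFn p).flatten}

/-- The blocked extremal function of sequences avoiding `s + 1` concatenated permutations. -/
noncomputable def PERM (r s n m : ℕ) : ℕ := exBlocked (permSet r (s + 1)) n m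

/-- The blocked extremal function of sequences avoiding the doubled version. -/
noncomputable def dblPERM (r s n m : ℕ) : ℕ := exBlocked (dblPermSet r (s + 1)) n m

/-- Ackermann's function `a_{i,j}`, for `i, j ≥ 1` (values at index `0` are not used). -/
def ackA : ℕ → ℕ → ℕ
  | 0, _ => 0
  | 1, j => 2 ^ j
  | _ + 2, 0 => 0
  | _ + 2, 1 => 2
  | i + 2, j + 2 => ackA (i + 2) (j + 1) * ackA (i + 1) (ackA (i + 2) (j + 1))
termination_by i j => (i, j)

/-- The coefficients `K_{s,i}`, for `s, i ≥ 1` (values at index `0` are not used). -/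
def coeffK : ℕ → ℕ → ℤ
  | 0, _ => 0
  | 1, _ => 1
  | 2, _ => 2
  | _ + 3, 0 => 0
  | s + 3, 1 => 2 * coeffK (s + 2) 1
  | s + 3, i + 2 =>
      2 * coeffK (s + 2) (i + 2) + coeffK (s + 1) (i + 2) * (coeffK (s + 3) (i + 1) - 2)
termination_by s i => (s, i)

/-- The coefficients `K^dbl_{s,i}` (they also depend on `r`), for `s, i ≥ 1` (values at index `0`
are not used). -/
def coeffKdbl (r : ℕ) : ℕ → ℕ → ℤ
  | 0, _ => 0
  | 1, _ => 1
  | 2, _ => 2 * 6 ^ (r - 1)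
  | _ + 3, 0 => 0
  | s + 3, 1 => 2 * coeffKdbl r (s + 2) 1 + 1
  | s + 3, i + 2 =>
      coeffKdbl r (s + 3) (i + 1) + 2 * coeffKdbl r (s + 2) (i + 2)
        + (coeffKdbl r (s + 1) (i + 2) + 2) * coeffK (s + 3) (i + 1)
termination_by s i => (s, i)

/-!
# Upper bounds for sequences avoiding concatenated permutations

A sequence partitioned into blocks is encoded by the family of sets `X a`, where `X a` consists of
the indices of the blocks containing the letter `a`; its length is `∑ a, |X a|`.  A forbidden
pattern with `k` windows becomes a monotone map to `ℕ` whose first `k` fibres contain prescribed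
numbers of elements of `X d` for every `d` in some set of `r` letters (`Hits`, `Avoids`).  This
formulation is stable under contraction: grouping consecutive blocks into superblocks creates no
new pattern (`Avoids.image`).

**The recursion.**  The blocks are grouped into superblocks.  The letters occurring in a single
superblock avoid the same pattern.  For the other letters, the first and the last superblock
contribute families that avoid the pattern with one window less, since the letters recur later,
respectively earlier, and the superblocks between them avoid the pattern with two windows less.
The number of such middle occurrences is bounded by applying the theorem, one row earlier, to the
contracted family (`sum_card_le_of_superblocks`).  In the doubled case one occurrence of every
letter is removed at each end at which a window has to become doubled; the removed occurrences are
again counted by contracted families, and those superblocks in which two have to be removed from a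
letter form a family avoiding the undoubled pattern (`sum_card_le_of_superblocks_dbl`,
`Avoids.doublePoints`).  All bounds have the form `K * (n + E * (M - 1))`, where `M - 1` is the
number of boundaries between blocks (`BoundOn`); these add up exactly over superblocks, so that no
rounding is needed.  With two superblocks of `2 ^ J` blocks this gives the row `i = 1`, and with
superblocks of `w ^ c` blocks, `w = a_{i,j-1}`, the later rows (`boundOn_perm`, `boundOn_dbl`).
The number of superblocks is then at most `(a_{i-1,w}) ^ c`, and the factor `w ^ (s - 2)` in the
error term of the contracted family is absorbed by the size `w ^ c` of the superblocks because
`s - 2 ≤ c`.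

**The base cases.**  The patterns with two windows, and the undoubled one with three, are handled
by counting, for each block, the letters that have an element in it and others around it.  The
doubled pattern with three windows needs a linear bound (`exists_linearCount`): if no window
contains two elements of each of `r` letters that also occur before and after it, the number of
letters having at least `4 * 3 ^ (r - 1)` elements is linear in the number of blocks.  This is an
induction on `r`.  The letters that start inside an interval and leave it provide cuts; a letter
that meets many cells of the resulting partition is replaced by every second cell it meets, and
the family so obtained satisfies the hypothesis for `r - 1`, because a letter providing a cut
would be one more full letter.

**The closed forms.**  The orders three and four are solved explicitly or by a direct induction,
order five by comparison with factorials.  As `K ≤ K^dbl`, the doubled coefficients satisfy a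
recursion of their own, `K_{s,i+1} ≤ K_{s,i} (K_{s-2,i+1} + 3) + 2 K_{s-1,i+1}`, and Pascal's rule
turns a bound with exponent `binom(i + C, t)` for `K_{s-2,i}` into one with exponent
`binom(i + C', t + 1)` for `K_{s,i}` (`exists_le_pow_choose`).
-/

/-! ### Families of block sets and the patterns they contain -/

/-- The letters of `D` follow the pattern with multiplicities `μ 0, …, μ (k - 1)`: the positions can
be cut into consecutive windows (the fibres of the monotone map `w`) such that every letter of `D`
has at least `μ i` elements in the `i`-th window.  Here `X d` is the set of blocks that contain
the letter `d`. -/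
def Hits {ι : Type} (X : ι → Finset ℤ) (D : Finset ι) (k : ℕ) (μ : ℕ → ℕ) : Prop :=
  ∃ w : ℤ → ℕ, Monotone w ∧ ∀ d ∈ D, ∀ i < k, μ i ≤ ((X d).filter (fun x => w x = i)).card

/-- No `r` letters of `A` follow the pattern with multiplicities `μ 0, …, μ (k - 1)`. -/
def Avoids {ι : Type} (r k : ℕ) (μ : ℕ → ℕ) (A : Finset ι) (X : ι → Finset ℤ) : Prop :=
  ∀ D ⊆ A, D.card = r → ¬ Hits X D k μ

/-- The multiplicities of the members of `permSet r k`. -/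
def permMult : ℕ → ℕ := fun _ => 1

/-- The multiplicities of the members of `dblPermSet r k`. -/
def dblMult (k : ℕ) : ℕ → ℕ := fun i => if i = 0 ∨ i + 1 = k then 1 else 2

section Avoidance

variable {ι : Type} {r k : ℕ} {μ : ℕ → ℕ} {A A' : Finset ι} {X V : ι → Finset ℤ}

theorem Avoids.mono (h : Avoids r k μ A X) (hA : A' ⊆ A) (hV : ∀ a ∈ A', V a ⊆ X a) :
    Avoids r k μ A' V := by
  rintro D hD hc ⟨w, hw, hh⟩
  refine h D (hD.trans hA) hc ⟨w, hw, fun d hd i hi => (hh d hd i hi).trans ?_⟩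
  exact Finset.card_le_card (Finset.filter_subset_filter _ (hV d (hD hd)))

theorem permMult_le_card_iff (S : Finset ℤ) (w : ℤ → ℕ) (i : ℕ) :
    permMult i ≤ (S.filter (fun x => w x = i)).card ↔ ∃ x ∈ S, w x = i := by
  rw [permMult, Nat.one_le_iff_ne_zero, Finset.card_ne_zero]
  simp [Finset.Nonempty]

/-- A final window can be added when every letter occurs again later. -/
theorem Avoids.perm_of_later (h : Avoids r (k + 1) permMult A X) (v : ℤ) (hA : A' ⊆ A)
    (hV : ∀ a ∈ A', V a ⊆ X a) (hv : ∀ a ∈ A', ∀ x ∈ V a, x < v)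
    (hl : ∀ a ∈ A', ∃ y ∈ X a, v ≤ y) : Avoids r k permMult A' V := by
  rintro D hD hc ⟨w, hw, hh⟩
  refine h D (hD.trans hA) hc ⟨fun x => if x < v then min (w x) (k - 1) else k, ?_, ?_⟩
  · intro x y hxy
    have := hw hxy
    dsimp only
    split_ifs <;> omega
  · intro d hd i hi
    rw [permMult_le_card_iff]
    rcases Nat.lt_succ_iff_lt_or_eq.1 hi with hi | rfl
    · obtain ⟨x, hx, hxi⟩ := (permMult_le_card_iff _ _ _).1 (hh d hd i hi)
      refine ⟨x, hV d (hD hd) hx, ?_⟩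
      rw [if_pos (hv d (hD hd) x hx)]
      omega
    · obtain ⟨y, hy, hvy⟩ := hl d (hD hd)
      exact ⟨y, hy, if_neg (not_lt.2 hvy)⟩

/-- An initial window can be added when every letter has occurred before. -/
theorem Avoids.perm_of_earlier (h : Avoids r (k + 1) permMult A X) (v : ℤ) (hA : A' ⊆ A)
    (hV : ∀ a ∈ A', V a ⊆ X a) (hv : ∀ a ∈ A', ∀ x ∈ V a, v ≤ x)
    (hl : ∀ a ∈ A', ∃ y ∈ X a, y < v) : Avoids r k permMult A' V := by
  rintro D hD hc ⟨w, hw, hh⟩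
  refine h D (hD.trans hA) hc ⟨fun x => if x < v then 0 else w x + 1, ?_, ?_⟩
  · intro x y hxy
    have := hw hxy
    dsimp only
    split_ifs <;> omega
  · intro d hd i hi
    rw [permMult_le_card_iff]
    rcases i with _ | i
    · obtain ⟨y, hy, hvy⟩ := hl d (hD hd)
      exact ⟨y, hy, if_pos hvy⟩
    · obtain ⟨x, hx, hxi⟩ := (permMult_le_card_iff _ _ _).1 (hh d hd i (by omega))
      refine ⟨x, hV d (hD hd) hx, ?_⟩
      rw [if_neg (not_lt.2 (hv d (hD hd) x hx)), hxi]

/-- The doubled analogue of `Avoids.perm_of_later`: the element `y` after those of `V a` makes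
the multiplicity of the former last window two. -/
theorem Avoids.dbl_of_later (h : Avoids r (k + 1) (dblMult (k + 1)) A X) (v : ℤ) (hA : A' ⊆ A)
    (hV : ∀ a ∈ A', V a ⊆ X a)
    (hv : ∀ a ∈ A', (V a).Nonempty → ∃ y ∈ X a, y < v ∧ ∀ x ∈ V a, x < y)
    (hl : ∀ a ∈ A', ∃ y ∈ X a, v ≤ y) : Avoids r k (dblMult k) A' V := by
  rintro D hD hc ⟨w, hw, hh⟩
  refine h D (hD.trans hA) hc ⟨fun x => if x < v then min (w x) (k - 1) else k, ?_, ?_⟩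
  · intro x y hxy
    have := hw hxy
    dsimp only
    split_ifs <;> omega
  · intro d hd i hi
    rcases Nat.lt_succ_iff_lt_or_eq.1 hi with hi | rfl
    · have h1 := hh d hd i hi
      have hpos : 0 < ((V d).filter (fun x => w x = i)).card :=
        lt_of_lt_of_le (by unfold dblMult; split_ifs <;> omega) h1
      obtain ⟨x, hx⟩ := Finset.card_pos.1 hpos
      rw [Finset.mem_filter] at hx
      obtain ⟨y, hy, hyv, hVy⟩ := hv d (hD hd) ⟨x, hx.1⟩
      have hsub : (V d).filter (fun x => w x = i) ⊆
          (X d).filter (fun x => (if x < v then min (w x) (k - 1) else k) = i) := by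
        intro z hz
        rw [Finset.mem_filter] at hz ⊢
        refine ⟨hV d (hD hd) hz.1, ?_⟩
        rw [if_pos ((hVy z hz.1).trans hyv)]
        omega
      by_cases hik : i + 1 = k
      · have hsub2 : insert y ((V d).filter (fun x => w x = i)) ⊆
            (X d).filter (fun x => (if x < v then min (w x) (k - 1) else k) = i) := by
          refine Finset.insert_subset ?_ hsub
          rw [Finset.mem_filter, if_pos hyv]
          have := hw (hVy x hx.1).le
          exact ⟨hy, by omega⟩
        have hny : y ∉ (V d).filter (fun x => w x = i) := fun hm =>
          lt_irrefl _ (hVy y (Finset.mem_filter.1 hm).1)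
        refine le_trans ?_ (Finset.card_le_card hsub2)
        rw [Finset.card_insert_of_notMem hny]
        unfold dblMult
        split_ifs <;> omega
      · refine le_trans ?_ (Finset.card_le_card hsub)
        refine le_trans ?_ h1
        unfold dblMult
        split_ifs <;> omega
    · obtain ⟨y, hy, hvy⟩ := hl d (hD hd)
      have : dblMult (i + 1) i = 1 := by simp [dblMult]
      rw [this, Nat.one_le_iff_ne_zero, Finset.card_ne_zero]
      exact ⟨y, Finset.mem_filter.2 ⟨hy, if_neg (not_lt.2 hvy)⟩⟩

/-- The doubled analogue of `Avoids.perm_of_earlier`. -/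
theorem Avoids.dbl_of_earlier (h : Avoids r (k + 1) (dblMult (k + 1)) A X) (v : ℤ) (hA : A' ⊆ A)
    (hV : ∀ a ∈ A', V a ⊆ X a)
    (hv : ∀ a ∈ A', (V a).Nonempty → ∃ y ∈ X a, v ≤ y ∧ ∀ x ∈ V a, y < x)
    (hl : ∀ a ∈ A', ∃ y ∈ X a, y < v) : Avoids r k (dblMult k) A' V := by
  rintro D hD hc ⟨w, hw, hh⟩
  refine h D (hD.trans hA) hc ⟨fun x => if x < v then 0 else w x + 1, ?_, ?_⟩
  · intro x y hxy
    have := hw hxy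
    dsimp only
    split_ifs <;> omega
  · intro d hd i hi
    rcases i with _ | i
    · obtain ⟨y, hy, hvy⟩ := hl d (hD hd)
      have : dblMult (k + 1) 0 = 1 := by simp [dblMult]
      rw [this, Nat.one_le_iff_ne_zero, Finset.card_ne_zero]
      exact ⟨y, Finset.mem_filter.2 ⟨hy, if_pos hvy⟩⟩
    · have hi : i < k := by omega
      have h1 := hh d hd i hi
      have hpos : 0 < ((V d).filter (fun x => w x = i)).card :=
        lt_of_lt_of_le (by unfold dblMult; split_ifs <;> omega) h1
      obtain ⟨x, hx⟩ := Finset.card_pos.1 hpos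
      rw [Finset.mem_filter] at hx
      obtain ⟨y, hy, hyv, hVy⟩ := hv d (hD hd) ⟨x, hx.1⟩
      have hsub : (V d).filter (fun x => w x = i) ⊆
          (X d).filter (fun x => (if x < v then 0 else w x + 1) = i + 1) := by
        intro z hz
        rw [Finset.mem_filter] at hz ⊢
        refine ⟨hV d (hD hd) hz.1, ?_⟩
        rw [if_neg (not_lt.2 (hyv.trans (hVy z hz.1).le))]
        omega
      by_cases hi0 : i = 0
      · have hsub2 : insert y ((V d).filter (fun x => w x = i)) ⊆
            (X d).filter (fun x => (if x < v then 0 else w x + 1) = i + 1) := by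
          refine Finset.insert_subset ?_ hsub
          rw [Finset.mem_filter, if_neg (not_lt.2 hyv)]
          have := hw (hVy x hx.1).le
          exact ⟨hy, by omega⟩
        have hny : y ∉ (V d).filter (fun x => w x = i) := fun hm =>
          lt_irrefl _ (hVy y (Finset.mem_filter.1 hm).1)
        refine le_trans ?_ (Finset.card_le_card hsub2)
        rw [Finset.card_insert_of_notMem hny]
        unfold dblMult
        split_ifs <;> omega
      · refine le_trans ?_ (Finset.card_le_card hsub)
        refine le_trans ?_ h1
        unfold dblMult
        split_ifs <;> omega

/-- Contracting positions along a monotone map creates no new pattern. -/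
theorem Avoids.image (h : Avoids r k μ A X) {g : ℤ → ℤ} (hg : Monotone g) :
    Avoids r k μ A (fun a => (X a).image g) := by
  rintro D hD hc ⟨w, hw, hh⟩
  refine h D hD hc ⟨w ∘ g, hw.comp hg, fun d hd i hi => (hh d hd i hi).trans ?_⟩
  have : ((X d).image g).filter (fun x => w x = i) ⊆
      ((X d).filter (fun x => (w ∘ g) x = i)).image g := by
    intro q hq
    simp only [Finset.mem_filter, Finset.mem_image] at hq ⊢
    obtain ⟨⟨x, hx, rfl⟩, hwx⟩ := hq
    exact ⟨x, ⟨hx, hwx⟩, rfl⟩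
  exact (Finset.card_le_card this).trans Finset.card_image_le

/-- The points over which `g` has at least two elements of `S`. -/
noncomputable def doublePoints (g : ℤ → ℤ) (S : Finset ℤ) : Finset ℤ :=
  (S.image g).filter (fun q => 2 ≤ (S.filter (fun x => g x = q)).card)

/-- Keeping only the doubled points of a contraction turns the avoidance of a pattern with
multiplicities at most two into the avoidance of the pattern with multiplicities one. -/
theorem Avoids.doublePoints (h : Avoids r k μ A X) (hμ : ∀ i, μ i ≤ 2) {g : ℤ → ℤ}
    (hg : Monotone g) : Avoids r k permMult A (fun a => doublePoints g (X a)) := by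
  rintro D hD hc ⟨w, hw, hh⟩
  refine h D hD hc ⟨w ∘ g, hw.comp hg, fun d hd i hi => (hμ i).trans ?_⟩
  obtain ⟨q, hq, hwq⟩ := (permMult_le_card_iff _ _ _).1 (hh d hd i hi)
  simp only [_root_.doublePoints, Finset.mem_filter] at hq
  refine hq.2.trans (Finset.card_le_card ?_)
  intro x hx
  rw [Finset.mem_filter] at hx ⊢
  exact ⟨hx.1, by rw [Function.comp, hx.2, hwq]⟩

theorem dblMult_le_two (k i : ℕ) : dblMult k i ≤ 2 := by
  unfold dblMult; split_ifs <;> omega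

end Avoidance

/-! ### Sums over the cells of a partition into superblocks -/

/-- The cell of the monotone map `g` over `q` in the interval of `M` blocks starting at `u`. -/
noncomputable def cell (g : ℤ → ℤ) (u : ℤ) (M : ℕ) (q : ℤ) : Finset ℤ :=
  (Finset.Ico u (u + M)).filter (fun x => g x = q)

theorem mem_cell {g : ℤ → ℤ} {u : ℤ} {M : ℕ} {q x : ℤ} :
    x ∈ cell g u M q ↔ (u ≤ x ∧ x < u + M) ∧ g x = q := by
  rw [cell, Finset.mem_filter, Finset.mem_Ico]

theorem exists_cell_eq_Ico {g : ℤ → ℤ} (hg : Monotone g) (u : ℤ) (M : ℕ) (q : ℤ) :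
    ∃ w : ℤ, cell g u M q = Finset.Ico w (w + (cell g u M q).card) := by
  rcases (cell g u M q).eq_empty_or_nonempty with h | h
  · exact ⟨0, by simp [h]⟩
  · set F := cell g u M q with hF
    have hI : F = Finset.Icc (F.min' h) (F.max' h) := by
      ext x
      rw [Finset.mem_Icc]
      refine ⟨fun hx => ⟨F.min'_le x hx, F.le_max' x hx⟩, fun ⟨h1, h2⟩ => ?_⟩
      have ha := F.min'_mem h
      have hb := F.max'_mem h
      rw [mem_cell] at ha hb ⊢
      have h3 := hg h1
      have h4 := hg h2
      exact ⟨⟨by omega, by omega⟩, by omega⟩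
    have hle := F.min'_le _ (F.max'_mem h)
    refine ⟨F.min' h, ?_⟩
    have hc : (F.card : ℤ) = F.max' h + 1 - F.min' h := by
      conv_lhs => rw [hI]
      rw [Int.card_Icc]
      omega
    rw [hc]
    conv_lhs => rw [hI]
    ext x
    simp only [Finset.mem_Icc, Finset.mem_Ico]
    omega

theorem card_cell_pos {g : ℤ → ℤ} {u : ℤ} {M : ℕ} {q : ℤ}
    (hq : q ∈ (Finset.Ico u (u + M)).image g) : 1 ≤ (cell g u M q).card := by
  obtain ⟨x, hx, rfl⟩ := Finset.mem_image.1 hq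
  exact Finset.card_pos.2 ⟨x, Finset.mem_filter.2 ⟨hx, rfl⟩⟩

theorem sum_card_cell (g : ℤ → ℤ) (u : ℤ) (M : ℕ) :
    ∑ q ∈ (Finset.Ico u (u + M)).image g, (cell g u M q).card = M := by
  have h := Finset.card_eq_sum_card_image g (Finset.Ico u (u + (M : ℤ)))
  rw [Int.card_Ico] at h
  have h2 : (u + (M : ℤ) - u).toNat = M := by omega
  rw [h2] at h
  exact h.symm

/-- Every family over `M` consecutive blocks that avoids the pattern has total size at most
`K * (number of letters + E * (M - 1))`.  The bound counts the `M - 1` boundaries between the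
blocks, so that it adds up without rounding errors over the parts of a partition. -/
def BoundOn (ι : Type) (r k : ℕ) (μ : ℕ → ℕ) (K E : ℤ) (M : ℕ) : Prop :=
  ∀ (A : Finset ι) (X : ι → Finset ℤ) (u : ℤ), (∀ a ∈ A, X a ⊆ Finset.Ico u (u + M)) →
    Avoids r k μ A X → (∑ a ∈ A, ((X a).card : ℤ)) ≤ K * (A.card + E * (M - 1))

theorem sum_cells_le {ι : Type} {r k : ℕ} {μ : ℕ → ℕ} {K E : ℤ} {B : ℕ}
    (hb : ∀ M', 1 ≤ M' → M' ≤ B → BoundOn ι r k μ K E M') {g : ℤ → ℤ} (hg : Monotone g) {u : ℤ}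
    {M : ℕ} (hB : ∀ q, (cell g u M q).card ≤ B) (T : ℤ → Finset ι) (V : ℤ → ι → Finset ℤ)
    (hV : ∀ q ∈ (Finset.Ico u (u + M)).image g, ∀ a ∈ T q, V q a ⊆ cell g u M q)
    (hA : ∀ q ∈ (Finset.Ico u (u + M)).image g, Avoids r k μ (T q) (V q)) :
    ∑ q ∈ (Finset.Ico u (u + M)).image g, ∑ a ∈ T q, ((V q a).card : ℤ) ≤
      K * ((∑ q ∈ (Finset.Ico u (u + M)).image g, ((T q).card : ℤ)) +
        E * (M - ((Finset.Ico u (u + M)).image g).card)) := by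
  have h1 : ∀ q ∈ (Finset.Ico u (u + M)).image g, ∑ a ∈ T q, ((V q a).card : ℤ) ≤
      K * ((T q).card + E * ((cell g u M q).card - 1)) := by
    intro q hq
    obtain ⟨w, hw⟩ := exists_cell_eq_Ico hg u M q
    refine hb _ (card_cell_pos hq) (hB q) (T q) (V q) w ?_ (hA q hq)
    intro a ha
    rw [← hw]
    exact hV q hq a ha
  refine (Finset.sum_le_sum h1).trans (le_of_eq ?_)
  have h2 : (∑ q ∈ (Finset.Ico u (u + M)).image g, ((cell g u M q).card : ℤ)) = M := by
    exact_mod_cast sum_card_cell g u M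
  rw [← Finset.mul_sum, Finset.sum_add_distrib, ← Finset.mul_sum, Finset.sum_sub_distrib, h2]
  simp

/-! ### A linear bound for the doubled pattern with three windows -/

section FullLetters

variable {ι : Type}

/-- The letters that occur before `p`, at least twice in `[p, q]`, and after `q`. -/
noncomputable def fullLetters (A : Finset ι) (X : ι → Finset ℤ) (p q : ℤ) : Finset ι :=
  A.filter (fun a => (∃ x ∈ X a, x < p) ∧ 2 ≤ ((X a).filter (fun x => p ≤ x ∧ x ≤ q)).card ∧
    ∃ x ∈ X a, q < x)

/-- Every window has fewer than `r` full letters. -/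
def FewFull (r : ℕ) (A : Finset ι) (X : ι → Finset ℤ) : Prop :=
  ∀ p q, (fullLetters A X p q).card < r

theorem mem_fullLetters {A : Finset ι} {X : ι → Finset ℤ} {p q : ℤ} {a : ι} :
    a ∈ fullLetters A X p q ↔ a ∈ A ∧ (∃ x ∈ X a, x < p) ∧
      (∃ x ∈ X a, ∃ y ∈ X a, p ≤ x ∧ x < y ∧ y ≤ q) ∧ ∃ x ∈ X a, q < x := by
  rw [fullLetters, Finset.mem_filter]
  refine and_congr_right fun _ => and_congr_right fun _ => and_congr_left fun _ => ?_
  constructor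
  · intro h
    obtain ⟨x, hx, y, hy, hne⟩ := Finset.one_lt_card.1 (Nat.lt_of_succ_le h)
    rw [Finset.mem_filter] at hx hy
    rcases lt_or_gt_of_ne hne with h1 | h1
    · exact ⟨x, hx.1, y, hy.1, hx.2.1, h1, hy.2.2⟩
    · exact ⟨y, hy.1, x, hx.1, hy.2.1, h1, hx.2.2⟩
  · rintro ⟨x, hx, y, hy, h1, h2, h3⟩
    have : 1 < ((X a).filter (fun x => p ≤ x ∧ x ≤ q)).card := by
      refine Finset.one_lt_card.2 ⟨x, ?_, y, ?_, h2.ne⟩ <;> rw [Finset.mem_filter]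
      · exact ⟨hx, h1, by omega⟩
      · exact ⟨hy, by omega, h3⟩
    omega

/-- A window with `r` full letters, together with what precedes and follows it, is the doubled
pattern with three windows. -/
theorem Avoids.fewFull {r : ℕ} {A : Finset ι} {X : ι → Finset ℤ}
    (h : Avoids r 3 (dblMult 3) A X) : FewFull r A X := by
  intro p q
  by_contra! hc
  obtain ⟨D, hD, hDc⟩ := Finset.exists_subset_card_eq hc
  refine h D (hD.trans (Finset.filter_subset _ _)) hDc
    ⟨fun x => if x < p then 0 else if x ≤ q then 1 else 2, ?_, ?_⟩
  · intro x y hxy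
    dsimp only
    split_ifs <;> omega
  · intro d hd i hi
    obtain ⟨-, ⟨x, hx, hxp⟩, ⟨y, hy, z, hz, h1, h2, h3⟩, ⟨t, ht, htq⟩⟩ :=
      mem_fullLetters.1 (hD hd)
    interval_cases i
    · rw [show dblMult 3 0 = 1 from rfl, Nat.one_le_iff_ne_zero, Finset.card_ne_zero]
      exact ⟨x, Finset.mem_filter.2 ⟨hx, if_pos hxp⟩⟩
    · rw [show dblMult 3 1 = 2 from rfl]
      refine Finset.one_lt_card.2 ⟨y, ?_, z, ?_, h2.ne⟩ <;> rw [Finset.mem_filter]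
      · exact ⟨hy, by dsimp only; rw [if_neg (by omega), if_pos (by omega)]⟩
      · exact ⟨hz, by dsimp only; rw [if_neg (by omega), if_pos (by omega)]⟩
    · rw [show dblMult 3 2 = 1 from rfl, Nat.one_le_iff_ne_zero, Finset.card_ne_zero]
      exact ⟨t, Finset.mem_filter.2 ⟨ht, by dsimp only; rw [if_neg (by omega), if_neg (by omega)]⟩⟩

/-- The condition is symmetric under reversal, which exchanges leaving and entering letters. -/
theorem FewFull.reflect {r : ℕ} {A : Finset ι} {X : ι → Finset ℤ} (h : FewFull r A X) :
    FewFull r A (fun a => (X a).image (fun x => -x)) := by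
  intro p q
  refine lt_of_le_of_lt (Finset.card_le_card ?_) (h (-q) (-p))
  intro a ha
  rw [mem_fullLetters] at ha ⊢
  obtain ⟨haA, ⟨x, hx, h1⟩, ⟨y, hy, z, hz, h2, h3, h4⟩, ⟨t, ht, h5⟩⟩ := ha
  simp only [Finset.mem_image] at hx hy hz ht
  obtain ⟨x, hx, rfl⟩ := hx
  obtain ⟨y, hy, rfl⟩ := hy
  obtain ⟨z, hz, rfl⟩ := hz
  obtain ⟨t, ht, rfl⟩ := ht
  exact ⟨haA, ⟨t, ht, by omega⟩, ⟨z, hz, y, hy, by omega, by omega, by omega⟩, ⟨x, hx, by omega⟩⟩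

/-- The letters all of whose elements lie in the given interval of `M` blocks. -/
noncomputable def insideLetters (A : Finset ι) (X : ι → Finset ℤ) (u : ℤ) (M : ℕ) : Finset ι :=
  A.filter (fun a => X a ⊆ Finset.Ico u (u + M))

/-- The letters that start in the interval, have at least four elements there, and continue
after it. -/
noncomputable def leavingLetters (A : Finset ι) (X : ι → Finset ℤ) (u : ℤ) (M : ℕ) : Finset ι :=
  A.filter (fun a => 4 ≤ ((X a).filter (fun x => x ∈ Finset.Ico u (u + M))).card ∧
    (∃ x ∈ X a, u + M ≤ x) ∧ ∀ x ∈ X a, u ≤ x)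

/-- The letters that end in the interval, have at least four elements there, and start
before it. -/
noncomputable def enteringLetters (A : Finset ι) (X : ι → Finset ℤ) (u : ℤ) (M : ℕ) : Finset ι :=
  A.filter (fun a => 4 ≤ ((X a).filter (fun x => x ∈ Finset.Ico u (u + M))).card ∧
    (∃ x ∈ X a, x < u) ∧ ∀ x ∈ X a, x < u + M)

/-- The cells of a partition with at least two cells are proper. -/
theorem card_cell_lt {g : ℤ → ℤ} {u : ℤ} {M : ℕ}
    (h2 : 2 ≤ ((Finset.Ico u (u + M)).image g).card) (q : ℤ) : (cell g u M q).card < M := by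
  have hs := sum_card_cell g u M
  obtain ⟨q', hq', hne⟩ := Finset.exists_mem_ne (Nat.lt_of_succ_le h2) q
  have hp := card_cell_pos hq'
  by_cases hq : q ∈ (Finset.Ico u (u + (M : ℤ))).image g
  · have : ∑ x ∈ {q, q'}, (cell g u M x).card ≤
        ∑ q ∈ (Finset.Ico u (u + (M : ℤ))).image g, (cell g u M q).card :=
      Finset.sum_le_sum_of_subset (by
        intro x hx
        rcases Finset.mem_insert.1 hx with rfl | hx
        · exact hq
        · rw [Finset.mem_singleton.1 hx]; exact hq')
    rw [Finset.sum_pair hne.symm] at this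
    omega
  · have h0 : (cell g u M q).card = 0 := by
      rw [Finset.card_eq_zero, Finset.eq_empty_iff_forall_notMem]
      intro x hx
      rw [mem_cell] at hx
      exact hq (Finset.mem_image.2 ⟨x, Finset.mem_Ico.2 hx.1, hx.2⟩)
    have := Finset.single_le_sum (f := fun q => (cell g u M q).card) (fun _ _ => Nat.zero_le _) hq'
    omega

/-- A finite set whose extreme fibres under `g` have at most three elements, and whose other fibres
have at most one, is at most four larger than its image. -/
theorem card_le_card_image_add_four {g : ℤ → ℤ} {S : Finset ℤ} {q₀ q₁ : ℤ} (hne : q₀ ≠ q₁)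
    (h0 : q₀ ∈ S.image g) (h1 : q₁ ∈ S.image g)
    (c0 : (S.filter (fun x => g x = q₀)).card ≤ 3) (c1 : (S.filter (fun x => g x = q₁)).card ≤ 3)
    (cm : ∀ q ∈ S.image g, q ≠ q₀ → q ≠ q₁ → (S.filter (fun x => g x = q)).card ≤ 1) :
    S.card ≤ (S.image g).card + 4 := by
  rw [Finset.card_eq_sum_card_image g S]
  have h1' : q₁ ∈ (S.image g).erase q₀ := Finset.mem_erase.2 ⟨hne.symm, h1⟩
  rw [← Finset.add_sum_erase _ _ h0, ← Finset.add_sum_erase _ _ h1']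
  have hs : ∑ q ∈ ((S.image g).erase q₀).erase q₁, (S.filter (fun x => g x = q)).card ≤
      (((S.image g).erase q₀).erase q₁).card • 1 := by
    refine Finset.sum_le_card_nsmul _ _ _ fun q hq => ?_
    rw [Finset.mem_erase, Finset.mem_erase] at hq
    exact cm q hq.2.2 hq.2.1 hq.1
  rw [Finset.card_erase_of_mem h1', Finset.card_erase_of_mem h0] at hs
  have : 2 ≤ (S.image g).card := Finset.one_lt_card.2 ⟨_, h0, _, h1, hne⟩
  simp only [smul_eq_mul, mul_one] at hs
  omega

/-- The step of the count: an interval is cut into `k + 1 ≥ 2` cells, and the letters of the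
interval are distributed over the cells.  A letter inside the interval is inside a cell, or has many
elements in its first or last cell, or has two elements in a cell strictly between them (and is
full there), or meets almost as many cells as it has elements. -/
theorem card_le_of_cut {r K E E' k : ℕ} {A : Finset ι} {X : ι → Finset ℤ} {u : ℤ} {M : ℕ}
    (hF : FewFull r A X) (hK : ∀ a ∈ A, K ≤ (X a).card) (hK1 : 1 ≤ K) {g : ℤ → ℤ}
    (hg : Monotone g)
    (hk : 1 ≤ k) (hgk : ((Finset.Ico u (u + M)).image g).card = k + 1)
    (IH : ∀ u' M', 1 ≤ M' → M' < M → (insideLetters A X u' M').card +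
      (leavingLetters A X u' M').card + (enteringLetters A X u' M').card ≤ E * (M' - 1))
    (hX : ((insideLetters A X u M).filter (fun a => K ≤ ((X a).image g).card + 4)).card ≤ E' * k)
    (hP : (leavingLetters A X u M).card + (enteringLetters A X u M).card ≤ 2 * (r - 1) * k)
    (hE : 4 * (r - 1) + E' ≤ E) :
    (insideLetters A X u M).card + (leavingLetters A X u M).card +
      (enteringLetters A X u M).card ≤ E * (M - 1) := by
  classical
  set Q := (Finset.Ico u (u + (M : ℤ))).image g with hQ
  choose w hw using exists_cell_eq_Ico hg u M
  set m : ℤ → ℕ := fun q => (cell g u M q).card with hm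
  have hmem : ∀ q x, (w q ≤ x ∧ x < w q + m q) ↔ ((u ≤ x ∧ x < u + M) ∧ g x = q) := by
    intro q x
    rw [← mem_cell, hw q, Finset.mem_Ico]
  have hmpos : ∀ q ∈ Q, 1 ≤ m q := fun q hq => card_cell_pos hq
  have hlow : ∀ q ∈ Q, ∀ x, g x < q → x < w q := by
    intro q hq x hx
    by_contra! hc
    have := hg hc
    have h1 := ((hmem q (w q)).1 ⟨le_rfl, by have := hmpos q hq; omega⟩).2
    omega
  have hhigh : ∀ q ∈ Q, ∀ x, q < g x → w q + m q ≤ x := by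
    intro q hq x hx
    by_contra! hc
    have := hg (show x ≤ w q + m q - 1 by omega)
    have h1 := ((hmem q (w q + m q - 1)).1 ⟨by have := hmpos q hq; omega, by omega⟩).2
    omega
  have hcover : insideLetters A X u M ⊆
      (Q.biUnion fun q => (insideLetters A X (w q) (m q) ∪ leavingLetters A X (w q) (m q)) ∪
        (enteringLetters A X (w q) (m q) ∪ fullLetters A X (w q) (w q + m q - 1))) ∪
      (insideLetters A X u M).filter (fun a => K ≤ ((X a).image g).card + 4) := by
    intro a ha
    obtain ⟨haA, hau⟩ := Finset.mem_filter.1 ha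
    have hau' : ∀ x ∈ X a, u ≤ x ∧ x < u + M := fun x hx => Finset.mem_Ico.1 (hau hx)
    have hYQ : (X a).image g ⊆ Q := Finset.image_subset_image hau
    have hne : ((X a).image g).Nonempty := by
      rw [Finset.image_nonempty, ← Finset.card_pos]
      have := hK a haA
      omega
    set Y := (X a).image g with hY
    have h0 := Y.min'_mem hne
    have h1 := Y.max'_mem hne
    set q₀ := Y.min' hne with hq₀
    set q₁ := Y.max' hne with hq₁
    have hmin : ∀ x ∈ X a, q₀ ≤ g x := fun x hx => Y.min'_le _ (Finset.mem_image_of_mem g hx)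
    have hmax : ∀ x ∈ X a, g x ≤ q₁ := fun x hx => Y.le_max' _ (Finset.mem_image_of_mem g hx)
    obtain ⟨x₀, hx₀, hgx₀⟩ := Finset.mem_image.1 h0
    obtain ⟨x₁, hx₁, hgx₁⟩ := Finset.mem_image.1 h1
    have hfil : ∀ q, (X a).filter (fun x => x ∈ Finset.Ico (w q) (w q + m q)) =
        (X a).filter (fun x => g x = q) := by
      intro q
      refine Finset.filter_congr fun x hx => ?_
      rw [Finset.mem_Ico, hmem]
      exact ⟨fun h => h.2, fun h => ⟨hau' x hx, h⟩⟩
    rw [Finset.mem_union]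
    by_cases hcase : (∃ q ∈ Q, a ∈ (insideLetters A X (w q) (m q) ∪
        leavingLetters A X (w q) (m q)) ∪
        (enteringLetters A X (w q) (m q) ∪ fullLetters A X (w q) (w q + m q - 1)))
    · exact Or.inl (Finset.mem_biUnion.2 hcase)
    · right
      push Not at hcase
      simp only [Finset.mem_union, not_or] at hcase
      have hq01 : q₀ ≠ q₁ := by
        intro he
        refine (hcase q₀ (hYQ h0)).1.1 (Finset.mem_filter.2 ⟨haA, fun x hx => ?_⟩)
        rw [Finset.mem_Ico, hmem]
        exact ⟨hau' x hx, le_antisymm (he ▸ hmax x hx) (hmin x hx)⟩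
      have hlt : q₀ < q₁ := lt_of_le_of_ne (by rw [← hgx₀]; exact hmax x₀ hx₀) hq01
      refine Finset.mem_filter.2 ⟨ha, (hK a haA).trans
        (card_le_card_image_add_four hq01 h0 h1 ?_ ?_ ?_)⟩
      · by_contra! hc
        refine (hcase q₀ (hYQ h0)).1.2 (Finset.mem_filter.2 ⟨haA, ?_, ⟨x₁, hx₁, ?_⟩, ?_⟩)
        · rw [hfil]; omega
        · exact hhigh q₀ (hYQ h0) x₁ (by omega)
        · intro x hx
          rcases (hmin x hx).lt_or_eq with h | h
          · have := hhigh q₀ (hYQ h0) x h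
            omega
          · exact ((hmem q₀ x).2 ⟨hau' x hx, h.symm⟩).1
      · by_contra! hc
        refine (hcase q₁ (hYQ h1)).2.1 (Finset.mem_filter.2 ⟨haA, ?_, ⟨x₀, hx₀, ?_⟩, ?_⟩)
        · rw [hfil]; omega
        · exact hlow q₁ (hYQ h1) x₀ (by omega)
        · intro x hx
          rcases (hmax x hx).lt_or_eq with h | h
          · have := hlow q₁ (hYQ h1) x h
            omega
          · exact ((hmem q₁ x).2 ⟨hau' x hx, h⟩).2
      · intro q hq hqa hqb
        by_contra! hc
        obtain ⟨z, hz, hgz⟩ := Finset.mem_image.1 hq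
        have hz1 := hmin z hz
        have hz2 := hmax z hz
        refine (hcase q (hYQ hq)).2.2 (Finset.mem_filter.2 ⟨haA, ⟨x₀, hx₀, ?_⟩, ?_, ⟨x₁, hx₁, ?_⟩⟩)
        · exact hlow q (hYQ hq) x₀ (by omega)
        · refine (Nat.succ_le_of_lt hc).trans (le_of_eq ?_)
          rw [← hfil]
          congr 1
          refine Finset.filter_congr fun x _ => ?_
          rw [Finset.mem_Ico]
          omega
        · have := hhigh q (hYQ hq) x₁ (by omega)
          omega
  have hcell : ∀ q ∈ Q, ((insideLetters A X (w q) (m q) ∪ leavingLetters A X (w q) (m q)) ∪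
        (enteringLetters A X (w q) (m q) ∪ fullLetters A X (w q) (w q + m q - 1))).card ≤
      E * (m q - 1) + (r - 1) := by
    intro q hq
    have h1 := IH (w q) (m q) (hmpos q hq) (card_cell_lt (hgk ▸ Nat.succ_le_succ hk) q)
    have h2 := hF (w q) (w q + m q - 1)
    have h3 := Finset.card_union_le (insideLetters A X (w q) (m q) ∪ leavingLetters A X (w q) (m q))
      (enteringLetters A X (w q) (m q) ∪ fullLetters A X (w q) (w q + m q - 1))
    have h4 := Finset.card_union_le (insideLetters A X (w q) (m q)) (leavingLetters A X (w q) (m q))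
    have h5 := Finset.card_union_le (enteringLetters A X (w q) (m q))
      (fullLetters A X (w q) (w q + m q - 1))
    omega
  have hsum : ∑ q ∈ Q, (m q - 1) + (k + 1) = M := by
    have h1 := sum_card_cell g u M
    rw [← hgk, Finset.card_eq_sum_ones, ← Finset.sum_add_distrib]
    conv_rhs => rw [← h1]
    refine Finset.sum_congr rfl fun q hq => ?_
    exact Nat.sub_add_cancel (hmpos q hq)
  have hin : (insideLetters A X u M).card ≤
      E * (∑ q ∈ Q, (m q - 1)) + (k + 1) * (r - 1) + E' * k := by
    refine (Finset.card_le_card hcover).trans ((Finset.card_union_le _ _).trans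
      (Nat.add_le_add ?_ hX))
    refine (Finset.card_biUnion_le).trans ((Finset.sum_le_sum hcell).trans (le_of_eq ?_))
    rw [Finset.sum_add_distrib, ← Finset.mul_sum, Finset.sum_const, hgk, smul_eq_mul]
  have hM : M - 1 = ∑ q ∈ Q, (m q - 1) + k := by omega
  rw [hM, mul_add]
  have h1 : (4 * (r - 1) + E') * k ≤ E * k := Nat.mul_le_mul_right k hE
  have h2 : (k + 1) * (r - 1) ≤ 2 * (r - 1) * k := by
    have : (k + 1) * (r - 1) ≤ (2 * k) * (r - 1) := Nat.mul_le_mul_right _ (by omega)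
    linarith
  linarith

end FullLetters

/-! ### Cutting an interval along disjoint parts of letters -/

/-- Every second element of a finite set, beginning with the least one. -/
noncomputable def everySecond (Y : Finset ℤ) : Finset ℤ :=
  Y.filter (fun y => Even (Y.filter (fun x => x < y)).card)

theorem card_le_two_mul_card_everySecond (Y : Finset ℤ) : Y.card ≤ 2 * (everySecond Y).card := by
  have h : (everySecond Y).card = (Y.card + 1) / 2 := by
    induction Y using Finset.induction_on_max with
    | empty => rfl
    | insert m Y hm ih =>
      have hmY : m ∉ Y := fun h => lt_irrefl _ (hm m h)
      have hlow : ∀ y ∈ Y, (insert m Y).filter (fun x => x < y) = Y.filter (fun x => x < y) := by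
        intro y hy
        rw [Finset.filter_insert, if_neg (not_lt.2 (hm y hy).le)]
      have htop : (insert m Y).filter (fun x => x < m) = Y := by
        rw [Finset.filter_insert, if_neg (lt_irrefl m)]
        exact Finset.filter_true_of_mem hm
      have hrest : Y.filter (fun y => Even ((insert m Y).filter (fun x => x < y)).card) =
          everySecond Y := Finset.filter_congr fun y hy => by rw [hlow y hy]
      rw [everySecond, Finset.filter_insert, htop, hrest, Finset.card_insert_of_notMem hmY]
      split_ifs with he
      · have hmE : m ∉ everySecond Y := fun h => hmY (Finset.mem_filter.1 h).1
        rw [Finset.card_insert_of_notMem hmE, ih]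
        obtain ⟨c, hc⟩ := he
        omega
      · rw [ih]
        rw [Nat.not_even_iff_odd] at he
        obtain ⟨c, hc⟩ := he
        omega
  omega

theorem exists_between_of_mem_everySecond {Y : Finset ℤ} {z z' : ℤ} (hz : z ∈ everySecond Y)
    (hz' : z' ∈ everySecond Y) (hlt : z < z') : ∃ x ∈ Y, z < x ∧ x < z' := by
  by_contra! hc
  obtain ⟨hzY, h1⟩ := Finset.mem_filter.1 hz
  obtain ⟨-, h2⟩ := Finset.mem_filter.1 hz'
  have : Y.filter (fun x => x < z') = insert z (Y.filter (fun x => x < z)) := by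
    ext x
    simp only [Finset.mem_filter, Finset.mem_insert]
    constructor
    · rintro ⟨hx, hxz⟩
      rcases lt_trichotomy x z with h | h | h
      · exact Or.inr ⟨hx, h⟩
      · exact Or.inl h
      · have := hc x hx h
        omega
    · rintro (rfl | ⟨hx, h⟩)
      · exact ⟨hzY, hlt⟩
      · exact ⟨hx, h.trans hlt⟩
  rw [this, Finset.card_insert_of_notMem (by simp), Nat.even_add_one] at h2
  exact h2 h1

/-- Among intervals `(f a, t a]` of depth at most `d` there are pairwise disjoint ones, at least
one for every `d`. -/
theorem exists_disjoint_intervals {ι : Type} (f t : ι → ℤ) (d : ℕ) (A : Finset ι)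
    (hft : ∀ a ∈ A, f a < t a)
    (hd : ∀ p, (A.filter (fun a => f a < p ∧ p ≤ t a)).card ≤ d) :
    ∃ L ⊆ A, (∀ a ∈ L, ∀ b ∈ L, a ≠ b → t a ≤ f b ∨ t b ≤ f a) ∧ A.card ≤ d * L.card := by
  classical
  induction A using Finset.strongInduction with
  | H A ih =>
    rcases A.eq_empty_or_nonempty with rfl | hne
    · exact ⟨∅, by simp⟩
    · obtain ⟨a, ha, hmin⟩ := Finset.exists_min_image A t hne
      set A' := A.filter (fun b => t a ≤ f b) with hA'
      have hss : A' ⊂ A := by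
        refine Finset.filter_ssubset.2 ⟨a, ha, ?_⟩
        have := hft a ha
        omega
      obtain ⟨L, hL, hdis, hcard⟩ := ih A' hss (fun b hb => hft b (hss.1 hb)) (fun p =>
        (Finset.card_le_card (Finset.filter_subset_filter _ hss.1)).trans (hd p))
      have haL : a ∉ L := by
        intro h
        have h1 := (Finset.mem_filter.1 (hL h)).2
        have := hft a ha
        omega
      refine ⟨insert a L, Finset.insert_subset ha (hL.trans hss.1), ?_, ?_⟩
      · intro b hb c hc hbc
        rcases Finset.mem_insert.1 hb with rfl | hbL <;>
          rcases Finset.mem_insert.1 hc with rfl | hcL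
        · exact absurd rfl hbc
        · exact Or.inl (Finset.mem_filter.1 (hL hcL)).2
        · exact Or.inr (Finset.mem_filter.1 (hL hbL)).2
        · exact hdis b hbL c hcL hbc
      · have h1 : A ⊆ A' ∪ A.filter (fun b => f b < t a ∧ t a ≤ t b) := by
          intro b hb
          rw [Finset.mem_union, Finset.mem_filter, Finset.mem_filter]
          rcases le_or_gt (t a) (f b) with h | h
          · exact Or.inl ⟨hb, h⟩
          · exact Or.inr ⟨hb, h, hmin b hb⟩
        have h2 := (Finset.card_le_card h1).trans (Finset.card_union_le _ _)
        have h3 := hd (t a)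
        rw [Finset.card_insert_of_notMem haL, mul_add, mul_one]
        omega

/-- The number of cuts `t a`, `a ∈ L`, up to `x`. -/
noncomputable def cutCount {ι : Type} (L : Finset ι) (t : ι → ℤ) (x : ℤ) : ℤ :=
  (L.filter (fun a => t a ≤ x)).card

section CutCount

variable {ι : Type} {L : Finset ι} {t : ι → ℤ}

theorem cutCount_mono (L : Finset ι) (t : ι → ℤ) : Monotone (cutCount L t) := by
  intro x y hxy
  unfold cutCount
  exact_mod_cast Finset.card_le_card
    (Finset.monotone_filter_right L (fun a _ (ha : t a ≤ x) => ha.trans hxy))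

theorem cutCount_nonneg (x : ℤ) : 0 ≤ cutCount L t x := by
  unfold cutCount; positivity

theorem cutCount_le (x : ℤ) : cutCount L t x ≤ L.card := by
  unfold cutCount
  exact_mod_cast Finset.card_filter_le _ _

theorem cutCount_lt_iff {a : ι} (ha : a ∈ L) (x : ℤ) :
    cutCount L t x < cutCount L t (t a) ↔ x < t a := by
  constructor
  · intro h
    by_contra! hc
    have := cutCount_mono L t hc
    omega
  · intro h
    unfold cutCount
    norm_cast
    refine Finset.card_lt_card (Finset.ssubset_iff_of_subset
      (Finset.monotone_filter_right L (fun b _ (hb : t b ≤ x) => hb.trans h.le))|>.2 ⟨a, ?_, ?_⟩)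
    · exact Finset.mem_filter.2 ⟨ha, le_rfl⟩
    · rw [Finset.mem_filter]
      rintro ⟨-, h'⟩
      omega

theorem exists_cutCount_eq (hinj : Set.InjOn t L) {j : ℤ} (h1 : 1 ≤ j) (h2 : j ≤ L.card) :
    ∃ a ∈ L, cutCount L t (t a) = j := by
  have hmaps : Set.MapsTo (fun a => cutCount L t (t a)) L (Finset.Icc (1 : ℤ) L.card) := by
    intro a ha
    rw [Finset.coe_Icc, Set.mem_Icc]
    refine ⟨?_, cutCount_le _⟩
    have := (cutCount_lt_iff (t := t) ha (t a - 1)).2 (by omega)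
    have h0 : 0 ≤ cutCount L t (t a - 1) := cutCount_nonneg _
    exact Int.add_one_le_of_lt (h0.trans_lt this)
  have hinj' : Set.InjOn (fun a => cutCount L t (t a)) (L : Set ι) := by
    intro a ha b hb hab
    refine hinj ha hb ?_
    dsimp only at hab
    by_contra hne
    rcases lt_or_gt_of_ne hne with h | h
    · have := (cutCount_lt_iff hb (t a)).2 h
      omega
    · have := (cutCount_lt_iff ha (t b)).2 h
      omega
  have hsurj := Finset.surjOn_of_injOn_of_card_le _ hmaps hinj' (by rw [Int.card_Icc]; omega)
  have hj : j ∈ ((Finset.Icc (1 : ℤ) L.card : Finset ℤ) : Set ℤ) := by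
    rw [Finset.coe_Icc, Set.mem_Icc]; exact ⟨h1, h2⟩
  exact hsurj hj

theorem card_image_cutCount (hinj : Set.InjOn t L) {u : ℤ} {M : ℕ} (hM : 1 ≤ M)
    (ht : ∀ a ∈ L, u < t a ∧ t a < u + M) :
    ((Finset.Ico u (u + (M : ℤ))).image (cutCount L t)).card = L.card + 1 := by
  have : (Finset.Ico u (u + (M : ℤ))).image (cutCount L t) = Finset.Icc (0 : ℤ) L.card := by
    ext j
    rw [Finset.mem_image, Finset.mem_Icc]
    constructor
    · rintro ⟨x, -, rfl⟩
      exact ⟨cutCount_nonneg x, cutCount_le x⟩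
    · rintro ⟨h0, h1⟩
      rcases h0.lt_or_eq with h | rfl
      · obtain ⟨a, ha, hj⟩ := exists_cutCount_eq hinj (by omega : 1 ≤ j) h1
        exact ⟨t a, Finset.mem_Ico.2 ⟨(ht a ha).1.le, (ht a ha).2⟩, hj⟩
      · refine ⟨u, Finset.mem_Ico.2 ⟨le_rfl, by omega⟩, ?_⟩
        unfold cutCount
        rw [Finset.filter_false_of_mem (fun a ha => by have := ht a ha; omega)]
        rfl
  rw [this, Int.card_Icc]
  omega

end CutCount

/-- The number of letters with at least `K` elements in a family with few full letters is linear
in the number of blocks. -/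
def LinearCount (ι : Type) (r K E : ℕ) : Prop :=
  ∀ (A : Finset ι) (X : ι → Finset ℤ) (u : ℤ) (M : ℕ), 1 ≤ M →
    (∀ a ∈ A, X a ⊆ Finset.Ico u (u + M)) → (∀ a ∈ A, K ≤ (X a).card) → FewFull r A X →
    A.card ≤ E * (M - 1)

/-- The letters that meet many cells of a partition, when the cuts come from letters of `L` that
leave the interval and whose parts `(f a, t a]` are disjoint.  Every second cell met by such a
letter yields a family over the cells, and a window of cells with `r` full letters would contain
two elements of a letter of `L` that makes them `r + 1` full letters of the original family. -/
theorem card_spread_letters_le {ι : Type} {r K E : ℕ} (hr : 1 ≤ r) (hK : 4 ≤ K)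
    (hlin : LinearCount ι r K E) {A L : Finset ι} {X : ι → Finset ℤ} {u : ℤ} {M : ℕ}
    (hF : FewFull (r + 1) A X) (f y t : ι → ℤ) (hLA : L ⊆ A)
    (hfX : ∀ a ∈ L, f a ∈ X a) (hyX : ∀ a ∈ L, y a ∈ X a) (htX : ∀ a ∈ L, t a ∈ X a)
    (hfy : ∀ a ∈ L, f a < y a) (hyt : ∀ a ∈ L, y a < t a) (htM : ∀ a ∈ L, t a < u + M)
    (hout : ∀ a ∈ L, ∃ x ∈ X a, u + M ≤ x)
    (hdis : ∀ a ∈ L, ∀ b ∈ L, a ≠ b → t a ≤ f b ∨ t b ≤ f a) :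
    ((insideLetters A X u M).filter
      (fun a => 3 * K ≤ ((X a).image (cutCount L t)).card + 4)).card ≤ E * L.card := by
  classical
  set g := cutCount L t with hg
  set D := (insideLetters A X u M).filter (fun a => 3 * K ≤ ((X a).image g).card + 4) with hD
  have hinj : Set.InjOn t L := by
    intro a ha b hb hab
    by_contra hne
    have h1 := hfy a ha
    have h2 := hyt a ha
    have h3 := hfy b hb
    have h4 := hyt b hb
    rcases hdis a ha b hb hne with h | h <;> omega
  have key := hlin D (fun d => everySecond ((X d).image g)) 0 (L.card + 1) (by omega) ?_ ?_ ?_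
  · simpa using key
  · intro d _ z hz
    obtain ⟨x, -, rfl⟩ := Finset.mem_image.1 (Finset.mem_filter.1 hz).1
    have h1 : 0 ≤ g x := cutCount_nonneg x
    have h2 : g x ≤ L.card := cutCount_le x
    rw [Finset.mem_Ico]
    push_cast
    omega
  · intro d hd
    have h1 := (Finset.mem_filter.1 hd).2
    have h2 := card_le_two_mul_card_everySecond ((X d).image g)
    omega
  · intro p q
    set W := fullLetters D (fun d => everySecond ((X d).image g)) p q with hW
    by_contra! hc
    -- every letter of `W` meets a cell before `p`, cells with indices `p < i < j ≤ q`, and a cell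
    -- after `q`
    have hdat : ∀ d ∈ W, (∃ x ∈ X d, g x < p) ∧ (∃ x ∈ X d, ∃ x' ∈ X d, p < g x ∧ g x < g x' ∧
        g x' ≤ q) ∧ ∃ x ∈ X d, q < g x := by
      intro d hd
      obtain ⟨-, ⟨z₀, hz₀, h0⟩, ⟨z₁, hz₁, z₂, hz₂, h1, h2, h3⟩, ⟨z₃, hz₃, h4⟩⟩ :=
        mem_fullLetters.1 hd
      obtain ⟨z, hz, h5, h6⟩ := exists_between_of_mem_everySecond hz₁ hz₂ h2
      obtain ⟨x₀, hx₀, rfl⟩ := Finset.mem_image.1 (Finset.mem_filter.1 hz₀).1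
      obtain ⟨x₁, hx₁, rfl⟩ := Finset.mem_image.1 hz
      obtain ⟨x₂, hx₂, rfl⟩ := Finset.mem_image.1 (Finset.mem_filter.1 hz₂).1
      obtain ⟨x₃, hx₃, rfl⟩ := Finset.mem_image.1 (Finset.mem_filter.1 hz₃).1
      exact ⟨⟨x₀, hx₀, h0⟩, ⟨x₁, hx₁, x₂, hx₂, by omega, h6, h3⟩, ⟨x₃, hx₃, h4⟩⟩
    obtain ⟨d₀, hd₀⟩ := Finset.card_pos.1 (lt_of_lt_of_le hr hc)
    obtain ⟨⟨x₀, -, h0⟩, ⟨x₁, -, x₂, -, h1, h2, h3⟩, ⟨x₃, -, h4⟩⟩ := hdat d₀ hd₀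
    have hg0 : 0 ≤ g x₀ := cutCount_nonneg x₀
    have hg3 : g x₃ ≤ L.card := cutCount_le x₃
    obtain ⟨b, hb, hgb⟩ := exists_cutCount_eq hinj (show 1 ≤ p by omega) (by omega)
    obtain ⟨a, ha, hga⟩ := exists_cutCount_eq hinj (show 1 ≤ p + 1 by omega) (by omega)
    obtain ⟨e, he, hge⟩ := exists_cutCount_eq hinj (show 1 ≤ q + 1 by omega) (by omega)
    rw [← hg] at hgb hga hge
    have hba : t b ≤ f a := by
      have hne : b ≠ a := by rintro rfl; omega
      rcases hdis b hb a ha hne with h | h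
      · exact h
      · have h5 := (cutCount_lt_iff (t := t) ha (t b)).1 (by rw [← hg]; omega)
        have h6 := hfy b hb
        have h7 := hyt b hb
        omega
    have hWA : ∀ d ∈ W, d ∈ A ∧ X d ⊆ Finset.Ico u (u + M) := fun d hd =>
      Finset.mem_filter.1 (Finset.mem_filter.1 (Finset.mem_filter.1 hd).1).1
    have hsub : insert a W ⊆ fullLetters A X (y a) (t e - 1) := by
      intro d hd
      rw [mem_fullLetters]
      rcases Finset.mem_insert.1 hd with rfl | hd
      · refine ⟨hLA ha, ⟨f d, hfX d ha, hfy d ha⟩,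
          ⟨y d, hyX d ha, t d, htX d ha, le_rfl, hyt d ha, ?_⟩, ?_⟩
        · have := (cutCount_lt_iff (t := t) he (t d)).1 (by rw [← hg]; omega)
          omega
        · obtain ⟨x, hx, hxM⟩ := hout d ha
          have := htM e he
          exact ⟨x, hx, by omega⟩
      · obtain ⟨⟨x₀, hx₀, h0⟩, ⟨x₁, hx₁, x₂, hx₂, h1, h2, h3⟩, ⟨x₃, hx₃, h4⟩⟩ := hdat d hd
        refine ⟨(hWA d hd).1, ⟨x₀, hx₀, ?_⟩, ⟨x₁, hx₁, x₂, hx₂, ?_, ?_, ?_⟩, ⟨x₃, hx₃, ?_⟩⟩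
        · have h5 := (cutCount_lt_iff (t := t) hb x₀).1 (by rw [← hg]; omega)
          have := hfy a ha
          omega
        · have h5 : ¬ x₁ < t a := fun h => by
            have := (cutCount_lt_iff (t := t) ha x₁).2 h
            rw [← hg] at this
            omega
          have := hyt a ha
          omega
        · by_contra! hle
          have := cutCount_mono L t hle
          rw [← hg] at this
          omega
        · have h5 := (cutCount_lt_iff (t := t) he x₂).1 (by rw [← hg]; omega)
          omega
        · have h5 : ¬ x₃ < t e := fun h => by
            have := (cutCount_lt_iff (t := t) he x₃).2 h
            rw [← hg] at this
            omega
          omega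
    have haW : a ∉ W := by
      intro h
      obtain ⟨x, hx, hxM⟩ := hout a ha
      have := Finset.mem_Ico.1 ((hWA a h).2 hx)
      omega
    have h5 := Finset.card_le_card hsub
    rw [Finset.card_insert_of_notMem haW] at h5
    have h6 := hF (y a) (t e - 1)
    omega

/-! ### The number of letters with many elements -/

theorem exists_four_of_card {S : Finset ℤ} (h : 4 ≤ S.card) :
    ∃ a ∈ S, ∃ b ∈ S, ∃ c ∈ S, ∃ d ∈ S, a < b ∧ b < c ∧ c < d := by
  have hm := fun i => S.orderEmbOfFin_mem rfl i
  have hlt : ∀ i j : Fin S.card, i < j → S.orderEmbOfFin rfl i < S.orderEmbOfFin rfl j :=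
    fun i j hij => (S.orderEmbOfFin rfl).strictMono hij
  exact ⟨_, hm ⟨0, by omega⟩, _, hm ⟨1, by omega⟩, _, hm ⟨2, by omega⟩, _, hm ⟨3, by omega⟩,
    hlt _ _ (by simp), hlt _ _ (by simp), hlt _ _ (by simp)⟩

/-- The inductive step of `LinearCount` in the case where at least as many letters leave the
interval as enter it: the leaving letters provide the cuts. -/
theorem card_le_of_leaving {ι : Type} {r K E E' : ℕ} (hr : 1 ≤ r) (hK4 : 4 ≤ K)
    (hlin : LinearCount ι r K E') {A : Finset ι} {X : ι → Finset ℤ} {u : ℤ} {M : ℕ} (hM : 1 ≤ M)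
    (hF : FewFull (r + 1) A X) (hK : ∀ a ∈ A, 3 * K ≤ (X a).card)
    (IH : ∀ u' M', 1 ≤ M' → M' < M → (insideLetters A X u' M').card +
      (leavingLetters A X u' M').card + (enteringLetters A X u' M').card ≤ E * (M' - 1))
    (hne : (leavingLetters A X u M).Nonempty)
    (hle : (enteringLetters A X u M).card ≤ (leavingLetters A X u M).card)
    (hE : 4 * r + E' ≤ E) :
    (insideLetters A X u M).card + (leavingLetters A X u M).card +
      (enteringLetters A X u M).card ≤ E * (M - 1) := by
  classical
  have hfour : ∀ a ∈ leavingLetters A X u M, ∃ s : ℤ × ℤ × ℤ × ℤ,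
      (s.1 ∈ X a ∧ s.2.1 ∈ X a ∧ s.2.2.1 ∈ X a ∧ s.2.2.2 ∈ X a) ∧
      u ≤ s.1 ∧ s.1 < s.2.1 ∧ s.2.1 < s.2.2.1 ∧ s.2.2.1 < s.2.2.2 ∧ s.2.2.2 < u + M := by
    intro a ha
    obtain ⟨x, hx, y, hy, t, ht, z, hz, h1, h2, h3⟩ :=
      exists_four_of_card (Finset.mem_filter.1 ha).2.1
    simp only [Finset.mem_filter, Finset.mem_Ico] at hx hy ht hz
    exact ⟨(x, y, t, z), ⟨hx.1, hy.1, ht.1, hz.1⟩, hx.2.1, h1, h2, h3, hz.2.2⟩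
  choose! s hsX hsu hs1 hs2 hs3 hsM using hfour
  have hout : ∀ a ∈ leavingLetters A X u M, ∃ x ∈ X a, u + M ≤ x := fun a ha =>
    (Finset.mem_filter.1 ha).2.2.1
  obtain ⟨L, hL, hdis, hcard⟩ := exists_disjoint_intervals (fun a => (s a).1)
    (fun a => (s a).2.2.1) r (leavingLetters A X u M)
    (fun a ha => (hs1 a ha).trans (hs2 a ha)) (by
      intro p
      refine Nat.le_of_lt_succ (lt_of_le_of_lt (Finset.card_le_card ?_) (hF p (u + M - 1)))
      intro a ha
      obtain ⟨ha, h1, h2⟩ := Finset.mem_filter.1 ha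
      obtain ⟨x, hx, hxM⟩ := hout a ha
      have h3 := hs3 a ha
      have h4 := hsM a ha
      exact mem_fullLetters.2 ⟨(Finset.mem_filter.1 ha).1, ⟨_, (hsX a ha).1, h1⟩,
        ⟨_, (hsX a ha).2.2.1, _, (hsX a ha).2.2.2, h2, h3, by omega⟩, ⟨x, hx, by omega⟩⟩)
  have hLpos : 1 ≤ L.card := by
    have := Finset.card_pos.2 hne
    by_contra! h0
    have h1 : L.card = 0 := by omega
    rw [h1] at hcard
    omega
  have htu : ∀ a ∈ L, u < (s a).2.2.1 ∧ (s a).2.2.1 < u + M := by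
    intro a ha
    have h1 := hsu a (hL ha)
    have h2 := hs1 a (hL ha)
    have h3 := hs2 a (hL ha)
    have h4 := hs3 a (hL ha)
    have h5 := hsM a (hL ha)
    constructor <;> omega
  have hinj : Set.InjOn (fun a => (s a).2.2.1) L := by
    intro a ha b hb hab
    by_contra hne
    have h1 := hs1 a (hL ha)
    have h2 := hs2 a (hL ha)
    have h3 := hs1 b (hL hb)
    have h4 := hs2 b (hL hb)
    dsimp only at hab
    rcases hdis a ha b hb hne with h | h <;> omega
  refine card_le_of_cut (r := r + 1) (K := 3 * K) (E' := E') (k := L.card) hF hK (by omega)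
    (cutCount_mono L (fun a => (s a).2.2.1)) hLpos (card_image_cutCount hinj hM htu) IH ?_ ?_
    (by simpa using hE)
  · exact card_spread_letters_le hr hK4 hlin hF (fun a => (s a).1) (fun a => (s a).2.1)
      (fun a => (s a).2.2.1) (hL.trans (Finset.filter_subset _ _))
      (fun a ha => (hsX a (hL ha)).1) (fun a ha => (hsX a (hL ha)).2.1)
      (fun a ha => (hsX a (hL ha)).2.2.1) (fun a ha => hs1 a (hL ha)) (fun a ha => hs2 a (hL ha))
      (fun a ha => (htu a ha).2) (fun a ha => hout a (hL ha)) hdis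
  · have : 2 * (r + 1 - 1) * L.card = r * L.card + r * L.card := by rw [Nat.add_sub_cancel]; ring
    omega

section Reflection

variable {ι : Type} {A : Finset ι} {X : ι → Finset ℤ} {u : ℤ} {M : ℕ}

theorem card_filter_Ico_reflect (S : Finset ℤ) (u : ℤ) (M : ℕ) :
    ((S.image (fun x => -x)).filter (fun x => x ∈ Finset.Ico (1 - u - M) (1 - u - M + M))).card =
      (S.filter (fun x => x ∈ Finset.Ico u (u + M))).card := by
  rw [Finset.filter_image, Finset.card_image_of_injective _ neg_injective]
  congr 1
  refine Finset.filter_congr fun x _ => ?_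
  rw [Finset.mem_Ico, Finset.mem_Ico]
  omega

theorem insideLetters_reflect : insideLetters A (fun a => (X a).image (fun x => -x)) (1 - u - M) M =
    insideLetters A X u M := by
  refine Finset.filter_congr fun a _ => ?_
  rw [Finset.image_subset_iff, Finset.subset_iff]
  refine forall₂_congr fun x _ => ?_
  rw [Finset.mem_Ico, Finset.mem_Ico]
  omega

theorem leavingLetters_reflect :
    leavingLetters A (fun a => (X a).image (fun x => -x)) (1 - u - M) M =
      enteringLetters A X u M := by
  refine Finset.filter_congr fun a _ => ?_
  rw [card_filter_Ico_reflect]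
  refine and_congr_right fun _ => and_congr ?_ ?_
  · simp only [Finset.exists_mem_image]
    refine exists_congr fun x => and_congr_right fun _ => ?_
    omega
  · simp only [Finset.forall_mem_image]
    refine forall₂_congr fun x _ => ?_
    omega

theorem enteringLetters_reflect :
    enteringLetters A (fun a => (X a).image (fun x => -x)) (1 - u - M) M =
      leavingLetters A X u M := by
  refine Finset.filter_congr fun a _ => ?_
  rw [card_filter_Ico_reflect]
  refine and_congr_right fun _ => and_congr ?_ ?_
  · simp only [Finset.exists_mem_image]
    refine exists_congr fun x => and_congr_right fun _ => ?_
    omega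
  · simp only [Finset.forall_mem_image]
    refine forall₂_congr fun x _ => ?_
    omega

end Reflection

/-- The count for `r + 1` from the count for `r`.  The letters that are inside, leave or enter an
interval are counted together, by induction on its length.  Three times as many elements are
needed: up to four may be lost to the cells at the ends, and only every second cell is kept, so
that `(3 * K - 4) / 2 ≥ K` elements remain. -/
theorem LinearCount.succ {ι : Type} {r K E' : ℕ} (hr : 1 ≤ r) (hK4 : 4 ≤ K)
    (hlin : LinearCount ι r K E') : LinearCount ι (r + 1) (3 * K) (4 * r + E') := by
  classical
  have main : ∀ M, 1 ≤ M → ∀ (A : Finset ι) (X : ι → Finset ℤ) (u : ℤ),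
      (∀ a ∈ A, 3 * K ≤ (X a).card) → FewFull (r + 1) A X →
      (insideLetters A X u M).card + (leavingLetters A X u M).card +
        (enteringLetters A X u M).card ≤ (4 * r + E') * (M - 1) := by
    intro M
    induction M using Nat.strong_induction_on with
    | _ M ih =>
    intro hM A X u hK hF
    have IH : ∀ u' M', 1 ≤ M' → M' < M → (insideLetters A X u' M').card +
        (leavingLetters A X u' M').card + (enteringLetters A X u' M').card ≤
          (4 * r + E') * (M' - 1) := fun u' M' h1 h2 => ih M' h2 h1 A X u' hK hF
    have hK' : ∀ a ∈ A, 3 * K ≤ ((X a).image (fun x => -x)).card := by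
      intro a ha
      rw [Finset.card_image_of_injective _ neg_injective]
      exact hK a ha
    rcases le_or_gt (enteringLetters A X u M).card (leavingLetters A X u M).card with hle | hlt
    · rcases (leavingLetters A X u M).eq_empty_or_nonempty with he | hne
      · have he' : (enteringLetters A X u M).card = 0 := by
          rw [he, Finset.card_empty] at hle
          omega
        rcases hM.lt_or_eq with hM2 | rfl
        · -- no letter leaves or enters the interval: cut off the first block
          have hg : Monotone (fun x : ℤ => if x ≤ u then (0 : ℤ) else 1) := by
            intro x y hxy
            dsimp only
            split_ifs <;> omega
          have himg : (Finset.Ico u (u + (M : ℤ))).image (fun x : ℤ => if x ≤ u then (0 : ℤ) else 1)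
              = {0, 1} := by
            ext j
            simp only [Finset.mem_image, Finset.mem_Ico, Finset.mem_insert, Finset.mem_singleton]
            constructor
            · rintro ⟨x, -, rfl⟩
              split_ifs <;> simp
            · rintro (rfl | rfl)
              · exact ⟨u, ⟨le_rfl, by omega⟩, if_pos le_rfl⟩
              · exact ⟨u + 1, ⟨by omega, by omega⟩, if_neg (by omega)⟩
          refine card_le_of_cut (r := r + 1) (K := 3 * K) (E' := E') (k := 1) hF hK (by omega) hg
            le_rfl (by rw [himg]; rfl) IH ?_ (by rw [he, he']; simp) (by simp)
          rw [Finset.filter_false_of_mem]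
          · simp
          · intro a ha
            have h1 := Finset.card_le_card (Finset.image_subset_image
              (f := (fun x : ℤ => if x ≤ u then (0 : ℤ) else 1)) (Finset.mem_filter.1 ha).2)
            rw [himg, show ({0, 1} : Finset ℤ).card = 2 from rfl] at h1
            omega
        · -- a single block holds no letter with several elements
          have hin : insideLetters A X u 1 = ∅ := by
            refine Finset.filter_false_of_mem fun a ha hsub => ?_
            have h1 := Finset.card_le_card hsub
            rw [Int.card_Ico] at h1
            have := hK a ha
            omega
          rw [hin, he, he']
          simp
      · exact card_le_of_leaving hr hK4 hlin hM hF hK IH hne hle le_rfl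
    · have h := card_le_of_leaving (E := 4 * r + E') (u := 1 - u - M) hr hK4 hlin hM hF.reflect hK'
        (fun u' M' h1 h2 => ih M' h2 h1 A _ u' hK' hF.reflect)
        (by rw [leavingLetters_reflect, ← Finset.card_pos]; omega)
        (by rw [leavingLetters_reflect, enteringLetters_reflect]; exact hlt.le) le_rfl
      rw [insideLetters_reflect, leavingLetters_reflect, enteringLetters_reflect] at h
      omega
  intro A X u M hM hX hK hF
  have h := main M hM A X u hK hF
  rw [show insideLetters A X u M = A from Finset.filter_true_of_mem hX] at h
  omega

theorem exists_linearCount (ι : Type) (r : ℕ) (hr : 1 ≤ r) :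
    ∃ E, LinearCount ι r (4 * 3 ^ (r - 1)) E := by
  induction r, hr using Nat.le_induction with
  | base =>
    refine ⟨0, fun A X u M _ _ hK hF => ?_⟩
    rw [zero_mul, Nat.le_zero, Finset.card_eq_zero, Finset.eq_empty_iff_forall_notMem]
    intro a ha
    obtain ⟨x, hx, y, hy, z, hz, t, ht, h1, h2, h3⟩ := exists_four_of_card (S := X a) (hK a ha)
    have := hF y z
    rw [Nat.lt_one_iff, Finset.card_eq_zero] at this
    exact Finset.notMem_empty a (this ▸ mem_fullLetters.2
      ⟨ha, ⟨x, hx, h1⟩, ⟨y, hy, z, hz, le_rfl, h2, le_rfl⟩, ⟨t, ht, h3⟩⟩)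
  | succ r hr ih =>
    obtain ⟨E, hE⟩ := ih
    refine ⟨4 * r + E, ?_⟩
    have := hE.succ hr (by have := Nat.one_le_pow (r - 1) 3 (by norm_num); omega)
    have he : 4 * 3 ^ (r + 1 - 1) = 3 * (4 * 3 ^ (r - 1)) := by
      obtain ⟨q, rfl⟩ := Nat.exists_eq_add_of_le' hr
      simp only [Nat.add_sub_cancel, pow_succ]
      ring
    rwa [he]

/-! ### The base cases -/

/-- The disjoint consecutive groups of `K` elements of a finite set; the remaining fewer than `K`
elements are dropped. -/
theorem exists_consecutive_groups (S : Finset ℤ) {K : ℕ} : ∃ G : ℕ → Finset ℤ,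
    ∀ t < S.card / K, G t ⊆ S ∧ K ≤ (G t).card ∧
      ∀ t' < S.card / K, t < t' → ∀ x ∈ G t, ∀ y ∈ G t', x < y := by
  classical
  set e := S.orderEmbOfFin rfl with he
  have hlt : ∀ t < S.card / K, ∀ i ∈ Finset.Ico (t * K) (t * K + K), i < S.card := by
    intro t ht i hi
    have h1 : (t + 1) * K ≤ S.card / K * K := Nat.mul_le_mul_right K ht
    have h2 := Nat.div_mul_le_self S.card K
    rw [Finset.mem_Ico] at hi
    rw [add_mul, one_mul] at h1
    omega
  refine ⟨fun t => (Finset.Ico (t * K) (t * K + K)).image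
    (fun i => if h : i < S.card then e ⟨i, h⟩ else 0), fun t ht => ⟨?_, ?_, ?_⟩⟩
  · intro x hx
    obtain ⟨i, hi, rfl⟩ := Finset.mem_image.1 hx
    rw [dif_pos (hlt t ht i hi)]
    exact S.orderEmbOfFin_mem rfl _
  · rw [Finset.card_image_of_injOn]
    · simp
    · intro i hi j hj hij
      dsimp only at hij
      rw [dif_pos (hlt t ht i hi), dif_pos (hlt t ht j hj)] at hij
      simpa using e.injective hij
  · intro t' ht' htt x hx y hy
    obtain ⟨i, hi, rfl⟩ := Finset.mem_image.1 hx
    obtain ⟨j, hj, rfl⟩ := Finset.mem_image.1 hy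
    rw [dif_pos (hlt t ht i hi), dif_pos (hlt t' ht' j hj)]
    refine e.strictMono ?_
    have h1 : (t + 1) * K ≤ t' * K := Nat.mul_le_mul_right K htt
    rw [Finset.mem_Ico] at hi hj
    rw [add_mul, one_mul] at h1
    rw [Fin.mk_lt_mk]
    omega

/-- Letters with many elements are cut into new letters with `K` elements each, to which
`LinearCount` applies; at most `K - 1` elements of every letter are left over. -/
theorem LinearCount.boundOn {ι : Type} {r K E : ℕ} (hK : 2 ≤ K)
    (h : LinearCount (Σ _ : ι, ℕ) r K E) {M : ℕ} (hM : 1 ≤ M) :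
    BoundOn ι r 3 (dblMult 3) (K - 1) (K * E) M := by
  classical
  intro A X u hX hA
  choose G hG using fun a => exists_consecutive_groups (X a) (K := K)
  have hF := hA.fewFull
  set B := A.sigma (fun a => Finset.range ((X a).card / K)) with hB
  have hcount := h B (fun b => G b.1 b.2) u M hM ?_ ?_ ?_
  · rw [hB, Finset.card_sigma] at hcount
    simp only [Finset.card_range] at hcount
    have h1 : ∑ a ∈ A, (X a).card ≤ ∑ a ∈ A, (K * ((X a).card / K) + (K - 1)) := by
      refine Finset.sum_le_sum fun a _ => ?_
      have h2 := Nat.div_add_mod (X a).card K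
      have h3 := Nat.mod_lt (X a).card (by omega : 0 < K)
      omega
    rw [Finset.sum_add_distrib, ← Finset.mul_sum, Finset.sum_const, smul_eq_mul] at h1
    have h4 := Nat.mul_le_mul_left K hcount
    zify [hM, show 1 ≤ K by omega] at h1 h4
    have h5 : (0 : ℤ) ≤ ((K : ℤ) - 2) * (K * (E * (M - 1))) :=
      mul_nonneg (by omega) (mul_nonneg (by positivity) (mul_nonneg (by positivity) (by omega)))
    linarith
  · rintro ⟨a, t⟩ hb
    obtain ⟨ha, ht⟩ := Finset.mem_sigma.1 hb
    exact ((hG a t (Finset.mem_range.1 ht)).1).trans (hX a ha)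
  · rintro ⟨a, t⟩ hb
    obtain ⟨ha, ht⟩ := Finset.mem_sigma.1 hb
    exact (hG a t (Finset.mem_range.1 ht)).2.1
  · intro p q
    refine lt_of_le_of_lt (Finset.card_le_card_of_injOn Sigma.fst ?_ ?_) (hF p q)
    · rintro ⟨a, t⟩ hb
      obtain ⟨hb, ⟨x, hx, h1⟩, ⟨y, hy, z, hz, h2, h3, h4⟩, ⟨v, hv, h5⟩⟩ := mem_fullLetters.1 hb
      obtain ⟨ha, ht⟩ := Finset.mem_sigma.1 hb
      have hs := (hG a t (Finset.mem_range.1 ht)).1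
      exact mem_fullLetters.2 ⟨ha, ⟨x, hs hx, h1⟩, ⟨y, hs hy, z, hs hz, h2, h3, h4⟩,
        ⟨v, hs hv, h5⟩⟩
    · -- two groups of one letter lie on different sides of each other
      rintro ⟨a, t⟩ hb ⟨a', t'⟩ hb' hab
      obtain rfl : a = a' := hab
      obtain ⟨hb, ⟨x, hx, h1⟩, ⟨y, hy, z, hz, h2, h3, h4⟩, ⟨v, hv, h5⟩⟩ :=
        mem_fullLetters.1 (Finset.mem_coe.1 hb)
      obtain ⟨hb', ⟨x', hx', h1'⟩, -, ⟨v', hv', h5'⟩⟩ := mem_fullLetters.1 (Finset.mem_coe.1 hb')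
      have ht := Finset.mem_range.1 (Finset.mem_sigma.1 hb).2
      have ht' := Finset.mem_range.1 (Finset.mem_sigma.1 hb').2
      dsimp only at *
      rcases lt_trichotomy t t' with hlt | rfl | hlt
      · have := (hG a t ht).2.2 t' ht' hlt v hv x' hx'
        omega
      · rfl
      · have := (hG a t' ht').2.2 t ht hlt v' hv' x hx
        omega

theorem card_le_card_notMin_add_one (S : Finset ℤ) :
    S.card ≤ (S.filter (fun x => ∃ y ∈ S, y < x)).card + 1 := by
  rw [← Finset.card_filter_add_card_filter_not (s := S) (fun x => ∃ y ∈ S, y < x)]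
  refine Nat.add_le_add_left (Finset.card_le_one.2 fun x hx y hy => ?_) _
  obtain ⟨hx, hx'⟩ := Finset.mem_filter.1 hx
  obtain ⟨hy, hy'⟩ := Finset.mem_filter.1 hy
  push Not at hx' hy'
  exact le_antisymm (hx' y hy) (hy' x hx)

theorem card_le_card_notMax_add_one (S : Finset ℤ) :
    S.card ≤ (S.filter (fun x => ∃ y ∈ S, x < y)).card + 1 := by
  rw [← Finset.card_filter_add_card_filter_not (s := S) (fun x => ∃ y ∈ S, x < y)]
  refine Nat.add_le_add_left (Finset.card_le_one.2 fun x hx y hy => ?_) _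
  obtain ⟨hx, hx'⟩ := Finset.mem_filter.1 hx
  obtain ⟨hy, hy'⟩ := Finset.mem_filter.1 hy
  push Not at hx' hy'
  exact le_antisymm (hy' x hx) (hx' y hy)

theorem card_le_card_inner_add_two (S : Finset ℤ) :
    S.card ≤ (S.filter (fun x => (∃ y ∈ S, y < x) ∧ ∃ y ∈ S, x < y)).card + 2 := by
  have h1 := card_le_card_notMin_add_one S
  have h2 := card_le_card_notMax_add_one (S.filter (fun x => ∃ y ∈ S, y < x))
  have h3 : (S.filter (fun x => ∃ y ∈ S, y < x)).filter
      (fun x => ∃ y ∈ S.filter (fun x => ∃ y ∈ S, y < x), x < y) ⊆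
      S.filter (fun x => (∃ y ∈ S, y < x) ∧ ∃ y ∈ S, x < y) := by
    intro x hx
    obtain ⟨hx, y, hy, hxy⟩ := Finset.mem_filter.1 hx
    obtain ⟨hx, hx'⟩ := Finset.mem_filter.1 hx
    exact Finset.mem_filter.2 ⟨hx, hx', y, (Finset.mem_filter.1 hy).1, hxy⟩
  have h4 := Finset.card_le_card h3
  omega

/-- If every block after the first is in at most `d` of the sets `Z a`, and the first in none, the
sets have total size at most `d * (M - 1)`. -/
theorem sum_card_le_of_depth {ι : Type} {d M : ℕ} (hM : 1 ≤ M) {A : Finset ι} {Z : ι → Finset ℤ}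
    {u : ℤ} (hZ : ∀ a ∈ A, Z a ⊆ Finset.Ico (u + 1) (u + M))
    (hd : ∀ x, (A.filter (fun a => x ∈ Z a)).card ≤ d) :
    ∑ a ∈ A, ((Z a).card : ℤ) ≤ d * (M - 1) := by
  classical
  have h := Finset.sum_card_bipartiteAbove_eq_sum_card_bipartiteBelow (s := A)
    (t := Finset.Ico (u + 1) (u + (M : ℤ))) (fun a x => x ∈ Z a)
  have h1 : ∀ a ∈ A, (Finset.Ico (u + 1) (u + (M : ℤ))).bipartiteAbove (fun a x => x ∈ Z a) a =
      Z a := by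
    intro a ha
    ext x
    rw [Finset.mem_bipartiteAbove]
    exact ⟨fun h => h.2, fun h => ⟨hZ a ha h, h⟩⟩
  rw [Finset.sum_congr rfl (fun a ha => by rw [h1 a ha])] at h
  have h2 := Finset.sum_le_card_nsmul (Finset.Ico (u + 1) (u + (M : ℤ)))
    (fun x => (A.bipartiteBelow (fun a x => x ∈ Z a) x).card) d (fun x _ => hd x)
  rw [← h, Int.card_Ico, smul_eq_mul] at h2
  have h3 : (u + M - (u + 1)).toNat = M - 1 := by omega
  rw [h3] at h2
  zify [hM] at h2
  linarith

/-- A block contains non-first elements of fewer than `r` letters: cutting before it would give two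
windows. -/
theorem boundOn_perm_two (ι : Type) {r : ℕ} (hr : 1 ≤ r) {M : ℕ} (hM : 1 ≤ M) :
    BoundOn ι r 2 permMult 1 (r - 1) M := by
  classical
  intro A X u hX hA
  have hZ := sum_card_le_of_depth (d := r - 1) hM (A := A) (u := u)
    (Z := fun a => (X a).filter (fun x => ∃ y ∈ X a, y < x)) ?_ ?_
  · have h1 : ∑ a ∈ A, ((X a).card : ℤ) ≤
        ∑ a ∈ A, ((((X a).filter (fun x => ∃ y ∈ X a, y < x)).card : ℤ) + 1) := by
      refine Finset.sum_le_sum fun a _ => ?_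
      exact_mod_cast card_le_card_notMin_add_one (X a)
    rw [Finset.sum_add_distrib] at h1
    push_cast [hr] at hZ
    simp only [Finset.sum_const, nsmul_eq_mul, mul_one] at h1
    linarith
  · intro a ha x hx
    obtain ⟨hx, y, hy, hyx⟩ := Finset.mem_filter.1 hx
    have h1 := Finset.mem_Ico.1 (hX a ha hx)
    have h2 := Finset.mem_Ico.1 (hX a ha hy)
    rw [Finset.mem_Ico]
    omega
  · intro x
    by_contra! hc
    obtain ⟨D, hD, hDc⟩ := Finset.exists_subset_card_eq (Nat.le_of_pred_lt hc)
    refine hA D (hD.trans (Finset.filter_subset _ _)) hDc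
      ⟨fun z => if z < x then 0 else 1, ?_, ?_⟩
    · intro y z hyz
      dsimp only
      split_ifs <;> omega
    · intro d hd i hi
      rw [permMult_le_card_iff]
      obtain ⟨hx, y, hy, hyx⟩ := Finset.mem_filter.1 (Finset.mem_filter.1 (hD hd)).2
      interval_cases i
      · exact ⟨y, hy, if_pos hyx⟩
      · exact ⟨x, hx, if_neg (lt_irrefl x)⟩

/-- A block contains elements of fewer than `r` letters that are neither first nor last: the block
would be the middle one of three windows. -/
theorem boundOn_perm_three (ι : Type) {r : ℕ} (hr : 1 ≤ r) {M : ℕ} (hM : 1 ≤ M) :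
    BoundOn ι r 3 permMult 2 (r - 1) M := by
  classical
  intro A X u hX hA
  have hZ := sum_card_le_of_depth (d := r - 1) hM (A := A) (u := u)
    (Z := fun a => (X a).filter (fun x => (∃ y ∈ X a, y < x) ∧ ∃ y ∈ X a, x < y)) ?_ ?_
  · have h1 : ∑ a ∈ A, ((X a).card : ℤ) ≤ ∑ a ∈ A, ((((X a).filter
        (fun x => (∃ y ∈ X a, y < x) ∧ ∃ y ∈ X a, x < y)).card : ℤ) + 2) := by
      refine Finset.sum_le_sum fun a _ => ?_
      exact_mod_cast card_le_card_inner_add_two (X a)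
    rw [Finset.sum_add_distrib] at h1
    push_cast [hr] at hZ
    simp only [Finset.sum_const, nsmul_eq_mul] at h1
    have h0 : (0 : ℤ) ≤ ((r : ℤ) - 1) * (M - 1) := mul_nonneg (by omega) (by omega)
    linarith
  · intro a ha x hx
    obtain ⟨hx, ⟨y, hy, hyx⟩, -⟩ := Finset.mem_filter.1 hx
    have h1 := Finset.mem_Ico.1 (hX a ha hx)
    have h2 := Finset.mem_Ico.1 (hX a ha hy)
    rw [Finset.mem_Ico]
    omega
  · intro x
    by_contra! hc
    obtain ⟨D, hD, hDc⟩ := Finset.exists_subset_card_eq (Nat.le_of_pred_lt hc)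
    refine hA D (hD.trans (Finset.filter_subset _ _)) hDc
      ⟨fun z => if z < x then 0 else if z ≤ x then 1 else 2, ?_, ?_⟩
    · intro y z hyz
      dsimp only
      split_ifs <;> omega
    · intro d hd i hi
      rw [permMult_le_card_iff]
      obtain ⟨hx, ⟨y, hy, hyx⟩, ⟨z, hz, hxz⟩⟩ :=
        Finset.mem_filter.1 (Finset.mem_filter.1 (hD hd)).2
      interval_cases i
      · exact ⟨y, hy, if_pos hyx⟩
      · exact ⟨x, hx, by simp⟩
      · refine ⟨z, hz, ?_⟩
        rw [if_neg (by omega), if_neg (by omega)]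

theorem boundOn_dbl_two (ι : Type) {r : ℕ} (hr : 1 ≤ r) {M : ℕ} (hM : 1 ≤ M) :
    BoundOn ι r 2 (dblMult 2) 1 (r - 1) M := by
  intro A X u hX hA
  refine boundOn_perm_two ι hr hM A X u hX fun D hD hc ⟨w, hw, hh⟩ => hA D hD hc ⟨w, hw, ?_⟩
  intro d hd i hi
  have := hh d hd i hi
  interval_cases i <;> exact this

/-! ### The recursive decomposition into superblocks -/

section Decomposition

variable {ι : Type} {r k : ℕ} {A : Finset ι} {X : ι → Finset ℤ} {u : ℤ} {M : ℕ} {g : ℤ → ℤ}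

/-- The letters of `A` that occur only in the superblock `q`. -/
noncomputable def localLetters (g : ℤ → ℤ) (A : Finset ι) (X : ι → Finset ℤ) (q : ℤ) : Finset ι :=
  A.filter (fun a => (X a).image g = {q})

/-- The letters of `A` that occur in several superblocks, for the first time in `q`. -/
noncomputable def firstLetters (g : ℤ → ℤ) (A : Finset ι) (X : ι → Finset ℤ) (q : ℤ) : Finset ι :=
  A.filter (fun a => q ∈ (X a).image g ∧ (∃ x ∈ X a, q < g x) ∧ ∀ x ∈ X a, q ≤ g x)

/-- The letters of `A` that occur in several superblocks, for the last time in `q`. -/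
noncomputable def lastLetters (g : ℤ → ℤ) (A : Finset ι) (X : ι → Finset ℤ) (q : ℤ) : Finset ι :=
  A.filter (fun a => q ∈ (X a).image g ∧ (∃ x ∈ X a, g x < q) ∧ ∀ x ∈ X a, g x ≤ q)

/-- The letters of `A` that occur in the superblock `q`, before it, and after it. -/
noncomputable def midLetters (g : ℤ → ℤ) (A : Finset ι) (X : ι → Finset ℤ) (q : ℤ) : Finset ι :=
  A.filter (fun a => q ∈ (X a).image g ∧ (∃ x ∈ X a, g x < q) ∧ ∃ x ∈ X a, q < g x)

/-- The letters of `A` that occur in several superblocks. -/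
noncomputable def globalLetters (g : ℤ → ℤ) (A : Finset ι) (X : ι → Finset ℤ) : Finset ι :=
  A.filter (fun a => 2 ≤ ((X a).image g).card)

/-- The elements of `S` in the superblock `q`. -/
noncomputable def part (g : ℤ → ℤ) (S : Finset ℤ) (q : ℤ) : Finset ℤ := S.filter (fun x => g x = q)

theorem mem_part {S : Finset ℤ} {q x : ℤ} : x ∈ part g S q ↔ x ∈ S ∧ g x = q := Finset.mem_filter

/-- The superblocks that meet the interval of `M` blocks starting at `u`. -/
noncomputable def superblocks (g : ℤ → ℤ) (u : ℤ) (M : ℕ) : Finset ℤ :=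
  (Finset.Ico u (u + M)).image g

theorem part_subset_cell {S : Finset ℤ} (hS : S ⊆ Finset.Ico u (u + M)) (q : ℤ) :
    part g S q ⊆ cell g u M q := Finset.filter_subset_filter _ hS

theorem card_eq_sum_part {S : Finset ℤ} (hS : S ⊆ Finset.Ico u (u + M)) :
    S.card = ∑ q ∈ superblocks g u M, (part g S q).card :=
  Finset.card_eq_sum_card_fiberwise fun _ hx => Finset.mem_image_of_mem g (hS hx)

theorem exists_threshold (hg : Monotone g) (u : ℤ) (M : ℕ) (q : ℤ) :
    ∃ v, ∀ x ∈ Finset.Ico u (u + (M : ℤ)), v ≤ x ↔ q < g x := by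
  classical
  rcases ((Finset.Ico u (u + (M : ℤ))).filter (fun x => q < g x)).eq_empty_or_nonempty with h | h
  · refine ⟨u + M, fun x hx => ⟨fun hx' => ?_, fun hx' => ?_⟩⟩
    · have := (Finset.mem_Ico.1 hx).2
      omega
    · exact absurd (h ▸ Finset.mem_filter.2 ⟨hx, hx'⟩) (Finset.notMem_empty x)
  · refine ⟨Finset.min' _ h, fun x hx => ⟨fun hx' => ?_, fun hx' => ?_⟩⟩
    · exact lt_of_lt_of_le (Finset.mem_filter.1 (Finset.min'_mem _ h)).2 (hg hx')
    · exact Finset.min'_le _ _ (Finset.mem_filter.2 ⟨hx, hx'⟩)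

theorem exists_start_threshold (hg : Monotone g) (u : ℤ) (M : ℕ) (q : ℤ) :
    ∃ v, ∀ x ∈ Finset.Ico u (u + (M : ℤ)), v ≤ x ↔ q ≤ g x := by
  obtain ⟨v, hv⟩ := exists_threshold hg u M (q - 1)
  exact ⟨v, fun x hx => (hv x hx).trans (by omega)⟩

theorem card_cases_of_mem_image {S : Finset ℤ} {q : ℤ} (hq : q ∈ S.image g) :
    S.image g = {q} ∨ (2 ≤ (S.image g).card ∧
      (((∃ x ∈ S, q < g x) ∧ ∀ x ∈ S, q ≤ g x) ∨ ((∃ x ∈ S, g x < q) ∧ ∀ x ∈ S, g x ≤ q) ∨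
        ((∃ x ∈ S, g x < q) ∧ ∃ x ∈ S, q < g x))) := by
  by_cases h1 : ∃ x ∈ S, g x < q
  · right
    obtain ⟨x, hx, hxq⟩ := id h1
    refine ⟨Finset.one_lt_card.2 ⟨_, Finset.mem_image_of_mem g hx, _, hq, hxq.ne⟩, ?_⟩
    by_cases h2 : ∃ x ∈ S, q < g x
    · exact Or.inr (Or.inr ⟨h1, h2⟩)
    · push Not at h2
      exact Or.inr (Or.inl ⟨h1, h2⟩)
  · by_cases h2 : ∃ x ∈ S, q < g x
    · right
      obtain ⟨x, hx, hxq⟩ := id h2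
      refine ⟨Finset.one_lt_card.2 ⟨_, hq, _, Finset.mem_image_of_mem g hx, hxq.ne⟩, ?_⟩
      push Not at h1
      exact Or.inl ⟨h2, h1⟩
    · left
      push Not at h1 h2
      refine Finset.eq_singleton_iff_unique_mem.2 ⟨hq, fun y hy => ?_⟩
      obtain ⟨x, hx, rfl⟩ := Finset.mem_image.1 hy
      exact le_antisymm (h2 x hx) (h1 x hx)

theorem sum_card_filter_comm (A : Finset ι) (Q : Finset ℤ) (P : ι → ℤ → Prop)
    [∀ a q, Decidable (P a q)] :
    ∑ q ∈ Q, (A.filter (fun a => P a q)).card = ∑ a ∈ A, (Q.filter (fun q => P a q)).card :=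
  (Finset.sum_card_bipartiteAbove_eq_sum_card_bipartiteBelow P).symm

theorem sum_card_localLetters_add_card_globalLetters (A : Finset ι) (X : ι → Finset ℤ)
    (g : ℤ → ℤ) (Q : Finset ℤ) :
    ∑ q ∈ Q, (localLetters g A X q).card + (globalLetters g A X).card ≤ A.card := by
  classical
  unfold localLetters globalLetters
  rw [sum_card_filter_comm A Q (fun a q => (X a).image g = {q}), Finset.card_filter,
    ← Finset.sum_add_distrib, Finset.card_eq_sum_ones]
  refine Finset.sum_le_sum fun a _ => ?_
  have h1 : (Q.filter (fun q => (X a).image g = {q})).card ≤ 1 := by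
    refine Finset.card_le_one.2 fun x hx y hy => ?_
    exact Finset.singleton_injective
      ((Finset.mem_filter.1 hx).2.symm.trans (Finset.mem_filter.1 hy).2)
  split_ifs with h2
  · have : Q.filter (fun q => (X a).image g = {q}) = ∅ := by
      refine Finset.filter_false_of_mem fun q _ he => ?_
      rw [he, Finset.card_singleton] at h2
      omega
    rw [this]
    simp
  · exact h1

theorem sum_card_firstLetters_le (A : Finset ι) (X : ι → Finset ℤ) (g : ℤ → ℤ) (Q : Finset ℤ) :
    ∑ q ∈ Q, (firstLetters g A X q).card ≤ (globalLetters g A X).card := by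
  classical
  unfold firstLetters globalLetters
  rw [sum_card_filter_comm A Q (fun a q => q ∈ (X a).image g ∧ (∃ x ∈ X a, q < g x) ∧
    ∀ x ∈ X a, q ≤ g x), Finset.card_filter]
  refine Finset.sum_le_sum fun a _ => ?_
  split_ifs with h2
  · refine Finset.card_le_one.2 fun p hp q hq => ?_
    obtain ⟨-, h3, -, h4⟩ := Finset.mem_filter.1 hp
    obtain ⟨-, h5, -, h6⟩ := Finset.mem_filter.1 hq
    obtain ⟨x, hx, rfl⟩ := Finset.mem_image.1 h3
    obtain ⟨y, hy, rfl⟩ := Finset.mem_image.1 h5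
    exact le_antisymm (h4 y hy) (h6 x hx)
  · rw [Nat.le_zero, Finset.card_eq_zero]
    refine Finset.filter_false_of_mem fun q _ ⟨h3, ⟨x, hx, h4⟩, _⟩ => h2 ?_
    exact Finset.one_lt_card.2 ⟨_, h3, _, Finset.mem_image_of_mem g hx, h4.ne⟩

theorem sum_card_lastLetters_le (A : Finset ι) (X : ι → Finset ℤ) (g : ℤ → ℤ) (Q : Finset ℤ) :
    ∑ q ∈ Q, (lastLetters g A X q).card ≤ (globalLetters g A X).card := by
  classical
  unfold lastLetters globalLetters
  rw [sum_card_filter_comm A Q (fun a q => q ∈ (X a).image g ∧ (∃ x ∈ X a, g x < q) ∧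
    ∀ x ∈ X a, g x ≤ q), Finset.card_filter]
  refine Finset.sum_le_sum fun a _ => ?_
  split_ifs with h2
  · refine Finset.card_le_one.2 fun p hp q hq => ?_
    obtain ⟨-, h3, -, h4⟩ := Finset.mem_filter.1 hp
    obtain ⟨-, h5, -, h6⟩ := Finset.mem_filter.1 hq
    obtain ⟨x, hx, rfl⟩ := Finset.mem_image.1 h3
    obtain ⟨y, hy, rfl⟩ := Finset.mem_image.1 h5
    exact le_antisymm (h6 x hx) (h4 y hy)
  · rw [Nat.le_zero, Finset.card_eq_zero]
    refine Finset.filter_false_of_mem fun q _ ⟨h3, ⟨x, hx, h4⟩, _⟩ => h2 ?_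
    exact Finset.one_lt_card.2 ⟨_, h3, _, Finset.mem_image_of_mem g hx, h4.ne'⟩

theorem sum_card_midLetters_add_le {S : Finset ℤ} (h2 : 2 ≤ (S.image g).card) :
    ((S.image g).filter (fun q => (∃ x ∈ S, g x < q) ∧ ∃ x ∈ S, q < g x)).card + 2 ≤
      (S.image g).card := by
  have hne : (S.image g).Nonempty := Finset.card_pos.1 (by omega)
  have hlt := Finset.min'_lt_max'_of_card _ h2
  have hsub : (S.image g).filter (fun q => (∃ x ∈ S, g x < q) ∧ ∃ x ∈ S, q < g x) ⊆
      ((S.image g).erase ((S.image g).min' hne)).erase ((S.image g).max' hne) := by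
    intro q hq
    obtain ⟨hq, ⟨x, hx, hxq⟩, ⟨y, hy, hyq⟩⟩ := Finset.mem_filter.1 hq
    have h3 := (S.image g).min'_le _ (Finset.mem_image_of_mem g hx)
    have h4 := (S.image g).le_max' _ (Finset.mem_image_of_mem g hy)
    refine Finset.mem_erase.2 ⟨?_, Finset.mem_erase.2 ⟨?_, hq⟩⟩ <;> omega
  have := Finset.card_le_card hsub
  rw [Finset.card_erase_of_mem (Finset.mem_erase.2 ⟨hlt.ne', Finset.max'_mem _ _⟩),
    Finset.card_erase_of_mem (Finset.min'_mem _ _)] at this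
  omega

theorem sum_sum_ite_eq (A : Finset ι) (Q : Finset ℤ) (P : ι → ℤ → Prop)
    [∀ a q, Decidable (P a q)] (f : ι → ℤ → ℤ) :
    ∑ a ∈ A, ∑ q ∈ Q, (if P a q then f a q else 0) =
      ∑ q ∈ Q, ∑ a ∈ A.filter (fun a => P a q), f a q := by
  rw [Finset.sum_comm]
  exact Finset.sum_congr rfl fun q _ => (Finset.sum_filter _ _).symm

/-- The recursion for avoiding concatenated permutations: local letters avoid the same
pattern, the first and the last superblock of a global letter contribute sequences avoiding the
pattern with one window less, the superblocks between them the pattern with two windows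
less. -/
theorem sum_card_le_of_superblocks (hg : Monotone g) {B : ℕ}
    (hX : ∀ a ∈ A, X a ⊆ Finset.Ico u (u + M)) (hB : ∀ q, (cell g u M q).card ≤ B)
    (hA : Avoids r (k + 2) permMult A X) {Kl K₁ K₂ El E₁ E₂ H : ℤ}
    (hl : ∀ M', 1 ≤ M' → M' ≤ B → BoundOn ι r (k + 2) permMult Kl El M')
    (h1 : ∀ M', 1 ≤ M' → M' ≤ B → BoundOn ι r (k + 1) permMult K₁ E₁ M')
    (h2 : ∀ M', 1 ≤ M' → M' ≤ B → BoundOn ι r k permMult K₂ E₂ M')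
    (hKl : 0 ≤ Kl) (hK₁ : 0 ≤ K₁) (hK₂ : 0 ≤ K₂)
    (hH : ∑ q ∈ superblocks g u M, ((midLetters g A X q).card : ℤ) ≤ H) :
    ∑ a ∈ A, ((X a).card : ℤ) ≤
      Kl * (A.card - (globalLetters g A X).card + El * (M - (superblocks g u M).card)) +
      2 * (K₁ * ((globalLetters g A X).card + E₁ * (M - (superblocks g u M).card))) +
      K₂ * (H + E₂ * (M - (superblocks g u M).card)) := by
  classical
  set Q := superblocks g u M with hQ
  have hXA : ∀ a ∈ A, ∀ x ∈ X a, x ∈ Finset.Ico u (u + (M : ℤ)) := fun a ha x hx => hX a ha hx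
  have hpart : ∀ a ∈ A, ∀ q ∈ Q, ((part g (X a) q).card : ℤ) ≤
      (if (X a).image g = {q} then ((part g (X a) q).card : ℤ) else 0) +
      (if q ∈ (X a).image g ∧ (∃ x ∈ X a, q < g x) ∧ ∀ x ∈ X a, q ≤ g x
        then ((part g (X a) q).card : ℤ) else 0) +
      (if q ∈ (X a).image g ∧ (∃ x ∈ X a, g x < q) ∧ ∀ x ∈ X a, g x ≤ q
        then ((part g (X a) q).card : ℤ) else 0) +
      (if q ∈ (X a).image g ∧ (∃ x ∈ X a, g x < q) ∧ ∃ x ∈ X a, q < g x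
        then ((part g (X a) q).card : ℤ) else 0) := by
    intro a _ q _
    have h0 : (0 : ℤ) ≤ (part g (X a) q).card := by positivity
    by_cases hq : q ∈ (X a).image g
    · rcases card_cases_of_mem_image hq with h | ⟨-, h | h | h⟩
      · rw [if_pos h]
        split_ifs <;> omega
      · rw [if_pos (show q ∈ (X a).image g ∧ (∃ x ∈ X a, q < g x) ∧ ∀ x ∈ X a, q ≤ g x from
          ⟨hq, h⟩)]
        split_ifs <;> omega
      · rw [if_pos (show q ∈ (X a).image g ∧ (∃ x ∈ X a, g x < q) ∧ ∀ x ∈ X a, g x ≤ q from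
          ⟨hq, h⟩)]
        split_ifs <;> omega
      · rw [if_pos (show q ∈ (X a).image g ∧ (∃ x ∈ X a, g x < q) ∧ ∃ x ∈ X a, q < g x from
          ⟨hq, h⟩)]
        split_ifs <;> omega
    · have : part g (X a) q = ∅ := by
        refine Finset.filter_false_of_mem fun x hx he => hq ?_
        exact Finset.mem_image.2 ⟨x, hx, he⟩
      rw [this]
      simp
  have htot : ∑ a ∈ A, ((X a).card : ℤ) ≤
      ∑ q ∈ Q, ∑ a ∈ localLetters g A X q, ((part g (X a) q).card : ℤ) +
      ∑ q ∈ Q, ∑ a ∈ firstLetters g A X q, ((part g (X a) q).card : ℤ) +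
      ∑ q ∈ Q, ∑ a ∈ lastLetters g A X q, ((part g (X a) q).card : ℤ) +
      ∑ q ∈ Q, ∑ a ∈ midLetters g A X q, ((part g (X a) q).card : ℤ) := by
    unfold localLetters firstLetters lastLetters midLetters
    rw [← sum_sum_ite_eq, ← sum_sum_ite_eq, ← sum_sum_ite_eq, ← sum_sum_ite_eq,
      ← Finset.sum_add_distrib, ← Finset.sum_add_distrib, ← Finset.sum_add_distrib]
    refine Finset.sum_le_sum fun a ha => ?_
    rw [← Finset.sum_add_distrib, ← Finset.sum_add_distrib, ← Finset.sum_add_distrib,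
      card_eq_sum_part (hX a ha), Nat.cast_sum]
    exact Finset.sum_le_sum fun q hq => hpart a ha q hq
  have hcell : ∀ (T : ℤ → Finset ι), (∀ q, T q ⊆ A) → ∀ q ∈ Q, ∀ a ∈ T q,
      part g (X a) q ⊆ cell g u M q := fun T hT q _ a ha => part_subset_cell (hX a (hT q ha)) q
  have hsl := sum_cells_le hl hg hB (localLetters g A X) (fun q a => part g (X a) q)
    (hcell _ fun q => Finset.filter_subset _ _)
    (fun q _ => hA.mono (Finset.filter_subset _ _) fun a _ => Finset.filter_subset _ _)
  have hsf := sum_cells_le h1 hg hB (firstLetters g A X) (fun q a => part g (X a) q)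
    (hcell _ fun q => Finset.filter_subset _ _) (fun q _ => by
      obtain ⟨v, hv⟩ := exists_threshold hg u M q
      refine hA.perm_of_later v (Finset.filter_subset _ _) (fun a _ => Finset.filter_subset _ _)
        ?_ ?_
      · intro a ha x hx
        obtain ⟨hx, hgx⟩ := mem_part.1 hx
        have := (hv x (hXA a (Finset.mem_filter.1 ha).1 x hx))
        by_contra! hc
        have := this.1 hc
        omega
      · intro a ha
        obtain ⟨haA, -, ⟨x, hx, hqx⟩, -⟩ := Finset.mem_filter.1 ha
        exact ⟨x, hx, (hv x (hXA a haA x hx)).2 hqx⟩)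
  have hse := sum_cells_le h1 hg hB (lastLetters g A X) (fun q a => part g (X a) q)
    (hcell _ fun q => Finset.filter_subset _ _) (fun q _ => by
      obtain ⟨v, hv⟩ := exists_start_threshold hg u M q
      refine hA.perm_of_earlier v (Finset.filter_subset _ _) (fun a _ => Finset.filter_subset _ _)
        ?_ ?_
      · intro a ha x hx
        obtain ⟨hx, hgx⟩ := mem_part.1 hx
        exact (hv x (hXA a (Finset.mem_filter.1 ha).1 x hx)).2 hgx.ge
      · intro a ha
        obtain ⟨haA, -, ⟨x, hx, hqx⟩, -⟩ := Finset.mem_filter.1 ha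
        have := (hv x (hXA a haA x hx)).1
        exact ⟨x, hx, by by_contra! hc; have := this hc; omega⟩)
  have hsm := sum_cells_le h2 hg hB (midLetters g A X) (fun q a => part g (X a) q)
    (hcell _ fun q => Finset.filter_subset _ _) (fun q _ => by
      obtain ⟨v, hv⟩ := exists_threshold hg u M q
      obtain ⟨v', hv'⟩ := exists_start_threshold hg u M q
      have hA' : Avoids r (k + 1) permMult (midLetters g A X q)
          (fun a => (X a).filter (fun x => g x ≤ q)) := by
        refine hA.perm_of_later v (Finset.filter_subset _ _)
          (fun a _ => Finset.filter_subset _ _) ?_ ?_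
        · intro a ha x hx
          obtain ⟨hx, hgx⟩ := Finset.mem_filter.1 hx
          have := (hv x (hXA a (Finset.mem_filter.1 ha).1 x hx))
          by_contra! hc
          have := this.1 hc
          omega
        · intro a ha
          obtain ⟨haA, -, -, ⟨x, hx, hqx⟩⟩ := Finset.mem_filter.1 ha
          exact ⟨x, hx, (hv x (hXA a haA x hx)).2 hqx⟩
      refine hA'.perm_of_earlier v' subset_rfl (fun a _ => ?_) ?_ ?_
      · exact Finset.monotone_filter_right (X a) fun x _ (h : g x = q) => h.le
      · intro a ha x hx
        obtain ⟨hx, hgx⟩ := mem_part.1 hx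
        exact (hv' x (hXA a (Finset.mem_filter.1 ha).1 x hx)).2 hgx.ge
      · intro a ha
        obtain ⟨haA, -, ⟨x, hx, hqx⟩, -⟩ := Finset.mem_filter.1 ha
        have := (hv' x (hXA a haA x hx)).1
        exact ⟨x, Finset.mem_filter.2 ⟨hx, hqx.le⟩, by by_contra! hc; have := this hc; omega⟩)
  have cl : ∑ q ∈ Q, ((localLetters g A X q).card : ℤ) ≤ A.card - (globalLetters g A X).card := by
    have := sum_card_localLetters_add_card_globalLetters A X g Q
    zify at this
    linarith
  have cf : ∑ q ∈ Q, ((firstLetters g A X q).card : ℤ) ≤ (globalLetters g A X).card := by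
    exact_mod_cast sum_card_firstLetters_le A X g Q
  have ce : ∑ q ∈ Q, ((lastLetters g A X q).card : ℤ) ≤ (globalLetters g A X).card := by
    exact_mod_cast sum_card_lastLetters_le A X g Q
  have m1 := mul_le_mul_of_nonneg_left cl hKl
  have m2 := mul_le_mul_of_nonneg_left cf hK₁
  have m3 := mul_le_mul_of_nonneg_left ce hK₁
  have m4 := mul_le_mul_of_nonneg_left hH hK₂
  rw [show (Finset.Ico u (u + (M : ℤ))).image g = Q from rfl, mul_add] at hsl hsf hse hsm
  linarith

/-- The doubled recursion.  In the first superblock of a global letter its last occurrence is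
removed, in the last one its first occurrence, and in every superblock between them both, so that
the windows at the ends of a pattern become doubled.  One removed occurrence is charged to every
superblock of a global letter; a second one is needed only for letters that occur twice in a
superblock between the first and the last. -/
theorem sum_card_le_of_superblocks_dbl (hg : Monotone g) {B : ℕ}
    (hX : ∀ a ∈ A, X a ⊆ Finset.Ico u (u + M)) (hB : ∀ q, (cell g u M q).card ≤ B)
    (hA : Avoids r (k + 2) (dblMult (k + 2)) A X) {Kl K₁ K₂ El E₁ E₂ H H₂ : ℤ}
    (hl : ∀ M', 1 ≤ M' → M' ≤ B → BoundOn ι r (k + 2) (dblMult (k + 2)) Kl El M')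
    (h1 : ∀ M', 1 ≤ M' → M' ≤ B → BoundOn ι r (k + 1) (dblMult (k + 1)) K₁ E₁ M')
    (h2 : ∀ M', 1 ≤ M' → M' ≤ B → BoundOn ι r k (dblMult k) K₂ E₂ M')
    (hKl : 0 ≤ Kl) (hK₁ : 0 ≤ K₁) (hK₂ : 0 ≤ K₂)
    (hH : ∑ a ∈ globalLetters g A X, (((X a).image g).card : ℤ) ≤ H)
    (hH₂ : ∑ q ∈ superblocks g u M, (((midLetters g A X q).filter
      (fun a => 2 ≤ (part g (X a) q).card)).card : ℤ) ≤ H₂) :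
    ∑ a ∈ A, ((X a).card : ℤ) ≤
      Kl * (A.card - (globalLetters g A X).card + El * (M - (superblocks g u M).card)) +
      2 * (K₁ * ((globalLetters g A X).card + E₁ * (M - (superblocks g u M).card))) +
      K₂ * (H₂ + E₂ * (M - (superblocks g u M).card)) + H₂ + H := by
  classical
  set Q := superblocks g u M with hQ
  have hXA : ∀ a ∈ A, ∀ x ∈ X a, x ∈ Finset.Ico u (u + (M : ℤ)) := fun a ha x hx => hX a ha hx
  set F : ℤ → ι → Finset ℤ := fun q a =>
    (part g (X a) q).filter (fun x => ∃ y ∈ part g (X a) q, x < y) with hF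
  set R : ℤ → ι → Finset ℤ := fun q a =>
    (part g (X a) q).filter (fun x => ∃ y ∈ part g (X a) q, y < x) with hR
  set I : ℤ → ι → Finset ℤ := fun q a => (part g (X a) q).filter
    (fun x => (∃ y ∈ part g (X a) q, y < x) ∧ ∃ y ∈ part g (X a) q, x < y) with hI
  have hpart : ∀ a ∈ A, ∀ q ∈ Q, ((part g (X a) q).card : ℤ) ≤
      (if (X a).image g = {q} then ((part g (X a) q).card : ℤ) else 0) +
      (if q ∈ (X a).image g ∧ (∃ x ∈ X a, q < g x) ∧ ∀ x ∈ X a, q ≤ g x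
        then ((F q a).card : ℤ) else 0) +
      (if q ∈ (X a).image g ∧ (∃ x ∈ X a, g x < q) ∧ ∀ x ∈ X a, g x ≤ q
        then ((R q a).card : ℤ) else 0) +
      (if (q ∈ (X a).image g ∧ (∃ x ∈ X a, g x < q) ∧ ∃ x ∈ X a, q < g x) ∧
        2 ≤ (part g (X a) q).card then ((I q a).card : ℤ) + 1 else 0) +
      (if 2 ≤ ((X a).image g).card ∧ q ∈ (X a).image g then 1 else 0) := by
    intro a _ q _
    have h0 : (0 : ℤ) ≤ (part g (X a) q).card := by positivity
    have h0F : (0 : ℤ) ≤ (F q a).card := by positivity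
    have h0R : (0 : ℤ) ≤ (R q a).card := by positivity
    have h0I : (0 : ℤ) ≤ (I q a).card := by positivity
    have hF1 : ((part g (X a) q).card : ℤ) ≤ (F q a).card + 1 := by
      exact_mod_cast card_le_card_notMax_add_one (part g (X a) q)
    have hR1 : ((part g (X a) q).card : ℤ) ≤ (R q a).card + 1 := by
      exact_mod_cast card_le_card_notMin_add_one (part g (X a) q)
    have hI2 : ((part g (X a) q).card : ℤ) ≤ (I q a).card + 2 := by
      exact_mod_cast card_le_card_inner_add_two (part g (X a) q)
    by_cases hq : q ∈ (X a).image g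
    · rcases card_cases_of_mem_image hq with h | ⟨h3, h | h | h⟩
      · rw [if_pos h]
        split_ifs <;> omega
      · rw [if_pos (show 2 ≤ ((X a).image g).card ∧ q ∈ (X a).image g from ⟨h3, hq⟩),
          if_pos (show q ∈ (X a).image g ∧ (∃ x ∈ X a, q < g x) ∧ ∀ x ∈ X a, q ≤ g x from ⟨hq, h⟩)]
        split_ifs <;> omega
      · rw [if_pos (show 2 ≤ ((X a).image g).card ∧ q ∈ (X a).image g from ⟨h3, hq⟩),
          if_pos (show q ∈ (X a).image g ∧ (∃ x ∈ X a, g x < q) ∧ ∀ x ∈ X a, g x ≤ q from ⟨hq, h⟩)]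
        split_ifs <;> omega
      · rw [if_pos (show 2 ≤ ((X a).image g).card ∧ q ∈ (X a).image g from ⟨h3, hq⟩)]
        by_cases h4 : 2 ≤ (part g (X a) q).card
        · rw [if_pos (show (q ∈ (X a).image g ∧ (∃ x ∈ X a, g x < q) ∧ ∃ x ∈ X a, q < g x) ∧
            2 ≤ (part g (X a) q).card from ⟨⟨hq, h⟩, h4⟩)]
          split_ifs <;> omega
        · split_ifs <;> omega
    · have : part g (X a) q = ∅ := by
        refine Finset.filter_false_of_mem fun x hx he => hq ?_
        exact Finset.mem_image.2 ⟨x, hx, he⟩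
      rw [this, Finset.card_empty, Nat.cast_zero]
      split_ifs <;> omega
  have htot : ∑ a ∈ A, ((X a).card : ℤ) ≤
      ∑ q ∈ Q, ∑ a ∈ localLetters g A X q, ((part g (X a) q).card : ℤ) +
      ∑ q ∈ Q, ∑ a ∈ firstLetters g A X q, ((F q a).card : ℤ) +
      ∑ q ∈ Q, ∑ a ∈ lastLetters g A X q, ((R q a).card : ℤ) +
      ∑ q ∈ Q, ∑ a ∈ (midLetters g A X q).filter (fun a => 2 ≤ (part g (X a) q).card),
        (((I q a).card : ℤ) + 1) +
      ∑ a ∈ A, ∑ q ∈ Q, (if 2 ≤ ((X a).image g).card ∧ q ∈ (X a).image g then (1 : ℤ) else 0) := by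
    unfold localLetters firstLetters lastLetters midLetters
    simp only [Finset.filter_filter]
    rw [← sum_sum_ite_eq, ← sum_sum_ite_eq, ← sum_sum_ite_eq, ← sum_sum_ite_eq,
      ← Finset.sum_add_distrib, ← Finset.sum_add_distrib, ← Finset.sum_add_distrib,
      ← Finset.sum_add_distrib]
    refine Finset.sum_le_sum fun a ha => ?_
    rw [← Finset.sum_add_distrib, ← Finset.sum_add_distrib, ← Finset.sum_add_distrib,
      ← Finset.sum_add_distrib, card_eq_sum_part (hX a ha), Nat.cast_sum]
    exact Finset.sum_le_sum fun q hq => hpart a ha q hq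
  have hglob : ∑ a ∈ A, ∑ q ∈ Q,
      (if 2 ≤ ((X a).image g).card ∧ q ∈ (X a).image g then (1 : ℤ) else 0) ≤ H := by
    refine le_trans (le_of_eq ?_) hH
    rw [globalLetters, Finset.sum_filter]
    refine Finset.sum_congr rfl fun a ha => ?_
    split_ifs with h
    · simp only [h, true_and]
      rw [← Finset.sum_filter, Finset.sum_const, nsmul_eq_mul, mul_one,
        Finset.filter_mem_eq_inter, Finset.inter_eq_right.2
          (show (X a).image g ⊆ Q from Finset.image_subset_image (hX a ha))]
    · simp [h]
  have hmid1 : ∑ q ∈ Q, ∑ a ∈ (midLetters g A X q).filter (fun a => 2 ≤ (part g (X a) q).card),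
        (((I q a).card : ℤ) + 1) ≤ ∑ q ∈ Q, ∑ a ∈ (midLetters g A X q).filter
          (fun a => 2 ≤ (part g (X a) q).card), ((I q a).card : ℤ) + H₂ := by
    refine le_trans (le_of_eq ?_) (add_le_add_right hH₂ _)
    rw [← Finset.sum_add_distrib]
    refine Finset.sum_congr rfl fun q _ => ?_
    rw [Finset.sum_add_distrib, Finset.sum_const, nsmul_eq_mul, mul_one]
  have hcell : ∀ (T : ℤ → Finset ι), (∀ q, T q ⊆ A) → ∀ q ∈ Q, ∀ a ∈ T q,
      part g (X a) q ⊆ cell g u M q := fun T hT q _ a ha => part_subset_cell (hX a (hT q ha)) q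
  have hsl := sum_cells_le hl hg hB (localLetters g A X) (fun q a => part g (X a) q)
    (hcell _ fun q => Finset.filter_subset _ _)
    (fun q _ => hA.mono (Finset.filter_subset _ _) fun a _ => Finset.filter_subset _ _)
  have hsf := sum_cells_le h1 hg hB (firstLetters g A X) F
    (fun q hq a ha => (Finset.filter_subset _ _).trans
      (hcell (firstLetters g A X) (fun q => Finset.filter_subset _ _) q hq a ha)) (fun q _ => by
      obtain ⟨v, hv⟩ := exists_threshold hg u M q
      refine hA.dbl_of_later v (Finset.filter_subset _ _)
        (fun a _ => (Finset.filter_subset _ _).trans (Finset.filter_subset _ _)) ?_ ?_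
      · rintro a ha ⟨x, hx⟩
        have hne : (part g (X a) q).Nonempty := ⟨x, (Finset.mem_filter.1 hx).1⟩
        obtain ⟨hm, hgm⟩ := mem_part.1 (Finset.max'_mem _ hne)
        refine ⟨_, hm, ?_, fun z hz => ?_⟩
        · have := hv _ (hXA a (Finset.mem_filter.1 ha).1 _ hm)
          by_contra! hc
          have := this.1 hc
          omega
        · obtain ⟨-, y, hy, hzy⟩ := Finset.mem_filter.1 hz
          exact hzy.trans_le (Finset.le_max' _ y hy)
      · intro a ha
        obtain ⟨haA, -, ⟨x, hx, hqx⟩, -⟩ := Finset.mem_filter.1 ha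
        exact ⟨x, hx, (hv x (hXA a haA x hx)).2 hqx⟩)
  have hse := sum_cells_le h1 hg hB (lastLetters g A X) R
    (fun q hq a ha => (Finset.filter_subset _ _).trans
      (hcell (lastLetters g A X) (fun q => Finset.filter_subset _ _) q hq a ha)) (fun q _ => by
      obtain ⟨v, hv⟩ := exists_start_threshold hg u M q
      refine hA.dbl_of_earlier v (Finset.filter_subset _ _)
        (fun a _ => (Finset.filter_subset _ _).trans (Finset.filter_subset _ _)) ?_ ?_
      · rintro a ha ⟨x, hx⟩
        have hne : (part g (X a) q).Nonempty := ⟨x, (Finset.mem_filter.1 hx).1⟩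
        obtain ⟨hm, hgm⟩ := mem_part.1 (Finset.min'_mem _ hne)
        refine ⟨_, hm, (hv _ (hXA a (Finset.mem_filter.1 ha).1 _ hm)).2 hgm.ge, fun z hz => ?_⟩
        obtain ⟨-, y, hy, hzy⟩ := Finset.mem_filter.1 hz
        exact (Finset.min'_le _ y hy).trans_lt hzy
      · intro a ha
        obtain ⟨haA, -, ⟨x, hx, hqx⟩, -⟩ := Finset.mem_filter.1 ha
        have := (hv x (hXA a haA x hx)).1
        exact ⟨x, hx, by by_contra! hc; have := this hc; omega⟩)
  have hsm := sum_cells_le h2 hg hB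
    (fun q => (midLetters g A X q).filter (fun a => 2 ≤ (part g (X a) q).card)) I
    (fun q hq a ha => (Finset.filter_subset _ _).trans
      (hcell (midLetters g A X) (fun q => Finset.filter_subset _ _) q hq a
        (Finset.mem_filter.1 ha).1)) (fun q _ => by
      obtain ⟨v, hv⟩ := exists_threshold hg u M q
      obtain ⟨v', hv'⟩ := exists_start_threshold hg u M q
      -- the elements up to the superblock `q`, without the last one
      have hA' : Avoids r (k + 1) (dblMult (k + 1)) (midLetters g A X q)
          (fun a => (X a).filter (fun x => ∃ y ∈ part g (X a) q, x < y)) := by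
        refine hA.dbl_of_later v (Finset.filter_subset _ _)
          (fun a _ => Finset.filter_subset _ _) ?_ ?_
        · rintro a ha ⟨x, hx⟩
          obtain ⟨-, y, hy, -⟩ := Finset.mem_filter.1 hx
          obtain ⟨hm, hgm⟩ := mem_part.1 (Finset.max'_mem _ ⟨y, hy⟩)
          refine ⟨_, hm, ?_, fun z hz => ?_⟩
          · have := hv _ (hXA a (Finset.mem_filter.1 ha).1 _ hm)
            by_contra! hc
            have := this.1 hc
            omega
          · obtain ⟨-, y, hy, hzy⟩ := Finset.mem_filter.1 hz
            exact hzy.trans_le (Finset.le_max' _ y hy)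
        · intro a ha
          obtain ⟨haA, -, -, ⟨x, hx, hqx⟩⟩ := Finset.mem_filter.1 ha
          exact ⟨x, hx, (hv x (hXA a haA x hx)).2 hqx⟩
      refine hA'.dbl_of_earlier v' (Finset.filter_subset _ _) (fun a _ => ?_) ?_ ?_
      · intro x hx
        obtain ⟨hx, -, h⟩ := Finset.mem_filter.1 hx
        exact Finset.mem_filter.2 ⟨(mem_part.1 hx).1, h⟩
      · rintro a ha ⟨x, hx⟩
        obtain ⟨hxp, ⟨y, hy, hyx⟩, -⟩ := Finset.mem_filter.1 hx
        have hlt : (part g (X a) q).min' ⟨x, hxp⟩ < x := (Finset.min'_le _ y hy).trans_lt hyx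
        obtain ⟨hm, hgm⟩ := mem_part.1 (Finset.min'_mem _ ⟨x, hxp⟩)
        refine ⟨_, Finset.mem_filter.2 ⟨hm, x, hxp, hlt⟩,
          (hv' _ (hXA a (Finset.mem_filter.1 (Finset.mem_filter.1 ha).1).1 _ hm)).2 hgm.ge,
          fun z hz => ?_⟩
        obtain ⟨-, ⟨y, hy, hzy⟩, -⟩ := Finset.mem_filter.1 hz
        exact (Finset.min'_le _ y hy).trans_lt hzy
      · intro a ha
        obtain ⟨haA, hq, ⟨x, hx, hqx⟩, -⟩ := Finset.mem_filter.1 (Finset.mem_filter.1 ha).1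
        obtain ⟨y, hy, hyq⟩ := Finset.mem_image.1 hq
        have := (hv' x (hXA a haA x hx)).1
        exact ⟨x, Finset.mem_filter.2 ⟨hx, y, mem_part.2 ⟨hy, hyq⟩, hg.reflect_lt (by omega)⟩,
          by by_contra! hc; have := this hc; omega⟩)
  have cl : ∑ q ∈ Q, ((localLetters g A X q).card : ℤ) ≤ A.card - (globalLetters g A X).card := by
    have := sum_card_localLetters_add_card_globalLetters A X g Q
    zify at this
    linarith
  have cf : ∑ q ∈ Q, ((firstLetters g A X q).card : ℤ) ≤ (globalLetters g A X).card := by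
    exact_mod_cast sum_card_firstLetters_le A X g Q
  have ce : ∑ q ∈ Q, ((lastLetters g A X q).card : ℤ) ≤ (globalLetters g A X).card := by
    exact_mod_cast sum_card_lastLetters_le A X g Q
  have m1 := mul_le_mul_of_nonneg_left cl hKl
  have m2 := mul_le_mul_of_nonneg_left cf hK₁
  have m3 := mul_le_mul_of_nonneg_left ce hK₁
  have m4 := mul_le_mul_of_nonneg_left hH₂ hK₂
  rw [show (Finset.Ico u (u + (M : ℤ))).image g = Q from rfl, mul_add] at hsl hsf hse hsm
  linarith

end Decomposition

/-! ### Superblocks of equal size and operations on bounds -/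

section SuperblockCounts

variable {ι : Type} {A : Finset ι} {X : ι → Finset ℤ} {u : ℤ} {M : ℕ}

/-- The first and the last superblock of a global letter are not middle ones. -/
theorem sum_card_midLetters_add_two_mul_le (A : Finset ι) (X : ι → Finset ℤ) (g : ℤ → ℤ)
    (Q : Finset ℤ) : ∑ q ∈ Q, (midLetters g A X q).card + 2 * (globalLetters g A X).card ≤
      ∑ a ∈ globalLetters g A X, ((X a).image g).card := by
  classical
  unfold midLetters globalLetters
  rw [sum_card_filter_comm A Q (fun a q => q ∈ (X a).image g ∧ (∃ x ∈ X a, g x < q) ∧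
    ∃ x ∈ X a, q < g x), Finset.card_filter, Finset.mul_sum, ← Finset.sum_add_distrib,
    Finset.sum_filter]
  refine Finset.sum_le_sum fun a _ => ?_
  split_ifs with h
  · refine le_trans (Nat.add_le_add_right (Finset.card_le_card ?_) _)
      (sum_card_midLetters_add_le h)
    intro q hq
    obtain ⟨-, h1, h2⟩ := Finset.mem_filter.1 hq
    exact Finset.mem_filter.2 ⟨h1, h2⟩
  · rw [Finset.filter_false_of_mem]
    · simp
    · rintro q _ ⟨h1, ⟨x, hx, hxq⟩, -⟩
      exact h (Finset.one_lt_card.2 ⟨_, Finset.mem_image_of_mem g hx, _, h1, hxq.ne⟩)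

theorem sum_card_doubled_midLetters_le (A : Finset ι) (X : ι → Finset ℤ) (g : ℤ → ℤ)
    (Q : Finset ℤ) :
    ∑ q ∈ Q, ((midLetters g A X q).filter (fun a => 2 ≤ (part g (X a) q).card)).card ≤
      ∑ a ∈ globalLetters g A X, (doublePoints g (X a)).card := by
  classical
  unfold midLetters globalLetters
  simp only [Finset.filter_filter]
  rw [sum_card_filter_comm A Q (fun a q => (q ∈ (X a).image g ∧ (∃ x ∈ X a, g x < q) ∧
    ∃ x ∈ X a, q < g x) ∧ 2 ≤ (part g (X a) q).card), Finset.sum_filter]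
  refine Finset.sum_le_sum fun a _ => ?_
  split_ifs with h
  · refine Finset.card_le_card fun q hq => ?_
    obtain ⟨-, ⟨h1, -⟩, h2⟩ := Finset.mem_filter.1 hq
    exact Finset.mem_filter.2 ⟨h1, h2⟩
  · rw [Finset.filter_false_of_mem]
    · simp
    · rintro q _ ⟨⟨h1, ⟨x, hx, hxq⟩, -⟩, -⟩
      exact h (Finset.one_lt_card.2 ⟨_, Finset.mem_image_of_mem g hx, _, h1, hxq.ne⟩)

/-- The map to superblocks of `B` blocks each, numbered from zero at the block `u`. -/
def blockMap (u : ℤ) (B : ℕ) (x : ℤ) : ℤ := (x - u) / B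

theorem blockMap_mono (u : ℤ) {B : ℕ} (hB : 1 ≤ B) : Monotone (blockMap u B) := fun x y hxy =>
  Int.ediv_le_ediv (by exact_mod_cast hB) (by omega)

theorem card_cell_blockMap_le (u : ℤ) (M : ℕ) {B : ℕ} (hB : 1 ≤ B) (q : ℤ) :
    (cell (blockMap u B) u M q).card ≤ B := by
  have hsub : cell (blockMap u B) u M q ⊆ Finset.Ico (u + q * B) (u + q * B + B) := by
    intro x hx
    obtain ⟨-, rfl⟩ := mem_cell.1 hx
    have hB' : (0 : ℤ) < B := by exact_mod_cast hB
    have h1 := Int.ediv_mul_le (x - u) hB'.ne'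
    have h2 := Int.lt_ediv_add_one_mul_self (x - u) hB'
    rw [Finset.mem_Ico]
    unfold blockMap
    constructor <;> linarith
  refine (Finset.card_le_card hsub).trans (le_of_eq ?_)
  rw [Int.card_Ico]
  omega

theorem blockMap_mem_Ico {B : ℕ} (hB : 1 ≤ B) (hM : 1 ≤ M) {x : ℤ}
    (hx : x ∈ Finset.Ico u (u + (M : ℤ))) :
    blockMap u B x ∈ Finset.Ico (0 : ℤ) (0 + (((M - 1) / B + 1 : ℕ) : ℤ)) := by
  rw [Finset.mem_Ico] at hx ⊢
  have hB' : (0 : ℤ) < B := by exact_mod_cast hB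
  refine ⟨Int.ediv_nonneg (by omega) hB'.le, ?_⟩
  have h1 : (x - u) / (B : ℤ) ≤ ((M - 1 : ℕ) : ℤ) / B :=
    Int.ediv_le_ediv hB' (by omega)
  unfold blockMap
  push_cast
  omega

theorem one_le_card_superblocks (g : ℤ → ℤ) (u : ℤ) (hM : 1 ≤ M) :
    1 ≤ (superblocks g u M).card :=
  Finset.card_pos.2 ⟨_, Finset.mem_image_of_mem g (Finset.mem_Ico.2 ⟨le_rfl, by omega⟩)⟩

end SuperblockCounts

section BoundOn

variable {ι : Type} {r k : ℕ} {μ : ℕ → ℕ} {M : ℕ}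

theorem BoundOn.mono {K K' E E' : ℤ} (h : BoundOn ι r k μ K E M) (hM : 1 ≤ M) (hK : 0 ≤ K)
    (hKK : K ≤ K') (hE : 0 ≤ E) (hEE : E ≤ E') : BoundOn ι r k μ K' E' M := by
  intro A X u hX hA
  have hM' : (0 : ℤ) ≤ M - 1 := by omega
  refine (h A X u hX hA).trans ?_
  have h1 : E * (M - 1) ≤ E' * (M - 1) := mul_le_mul_of_nonneg_right hEE hM'
  have h2 : 0 ≤ E * ((M : ℤ) - 1) := mul_nonneg hE hM'
  exact mul_le_mul hKK (by linarith) (by positivity) (hK.trans hKK)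

/-- A letter occurs at most once in a single block. -/
theorem boundOn_one_block {K E : ℤ} (hK : 1 ≤ K) : BoundOn ι r k μ K E 1 := by
  intro A X u hX _
  have h1 : ∑ a ∈ A, ((X a).card : ℤ) ≤ ∑ a ∈ A, 1 := by
    refine Finset.sum_le_sum fun a ha => ?_
    have := Finset.card_le_card (hX a ha)
    rw [Int.card_Ico] at this
    omega
  rw [Finset.sum_const, nsmul_eq_mul, mul_one] at h1
  push_cast
  rw [mul_zero, add_zero]
  exact h1.trans (le_mul_of_one_le_left (by positivity) hK)

end BoundOn

/-! ### The coefficients -/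

theorem coeffK_one (i : ℕ) : coeffK 1 i = 1 := by rw [coeffK]

theorem coeffK_two (i : ℕ) : coeffK 2 i = 2 := by rw [coeffK]

theorem coeffK_first (s : ℕ) : coeffK (s + 3) 1 = 2 * coeffK (s + 2) 1 := by rw [coeffK]

theorem coeffK_rec (s i : ℕ) : coeffK (s + 3) (i + 2) =
    2 * coeffK (s + 2) (i + 2) + coeffK (s + 1) (i + 2) * (coeffK (s + 3) (i + 1) - 2) := by
  rw [coeffK]

theorem coeffKdbl_one (r i : ℕ) : coeffKdbl r 1 i = 1 := by rw [coeffKdbl]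

theorem coeffKdbl_two (r i : ℕ) : coeffKdbl r 2 i = 2 * 6 ^ (r - 1) := by rw [coeffKdbl]

theorem coeffKdbl_first (r s : ℕ) : coeffKdbl r (s + 3) 1 = 2 * coeffKdbl r (s + 2) 1 + 1 := by
  rw [coeffKdbl]

theorem coeffKdbl_rec (r s i : ℕ) : coeffKdbl r (s + 3) (i + 2) =
    coeffKdbl r (s + 3) (i + 1) + 2 * coeffKdbl r (s + 2) (i + 2)
      + (coeffKdbl r (s + 1) (i + 2) + 2) * coeffK (s + 3) (i + 1) := by
  rw [coeffKdbl]

theorem two_le_coeffK (s i : ℕ) : 2 ≤ coeffK (s + 2) (i + 1) := by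
  induction s using Nat.strong_induction_on generalizing i with
  | _ s ih =>
  rcases s with _ | s
  · rw [coeffK_two]
  · induction i with
    | zero =>
      rw [coeffK_first]
      linarith [ih s (by omega) 0]
    | succ i hi =>
      have h3 : 0 ≤ coeffK (s + 1) (i + 2) := by
        rcases s with _ | s
        · rw [coeffK_one]; norm_num
        · linarith [ih s (by omega) (i + 1)]
      rw [coeffK_rec]
      have := ih s (by omega) (i + 1)
      have := mul_nonneg h3 (sub_nonneg.2 hi)
      linarith

theorem one_le_coeffK (s i : ℕ) : 1 ≤ coeffK (s + 1) (i + 1) := by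
  rcases s with _ | s
  · rw [coeffK_one]
  · linarith [two_le_coeffK s i]

theorem two_mul_coeffK_le (s i : ℕ) : 2 * coeffK (s + 2) (i + 1) ≤ coeffK (s + 3) (i + 1) := by
  rcases i with _ | i
  · rw [coeffK_first]
  · rw [coeffK_rec]
    have h1 := one_le_coeffK s (i + 1)
    have h2 := two_le_coeffK (s + 1) i
    have := mul_nonneg (show 0 ≤ coeffK (s + 1) (i + 2) by linarith)
      (show 0 ≤ coeffK (s + 3) (i + 1) - 2 by linarith)
    linarith

theorem coeffK_le_succ (s i : ℕ) : coeffK (s + 3) (i + 1) ≤ coeffK (s + 3) (i + 2) := by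
  rw [coeffK_rec]
  have h1 := one_le_coeffK s (i + 1)
  have h2 := two_le_coeffK (s + 1) i
  have h3 := two_le_coeffK s (i + 1)
  have := mul_le_mul_of_nonneg_right h1 (show 0 ≤ coeffK (s + 3) (i + 1) - 2 by linarith)
  linarith

theorem one_le_coeffKdbl (r s i : ℕ) : 1 ≤ coeffKdbl r (s + 1) (i + 1) := by
  induction s using Nat.strong_induction_on generalizing i with
  | _ s ih =>
  rcases s with _ | _ | s
  · rw [coeffKdbl_one]
  · rw [coeffKdbl_two]
    have : (1 : ℤ) ≤ 6 ^ (r - 1) := one_le_pow₀ (by norm_num)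
    linarith
  · induction i with
    | zero =>
      rw [coeffKdbl_first]
      linarith [ih (s + 1) (by omega) 0]
    | succ i hi =>
      rw [coeffKdbl_rec]
      have h1 := ih (s + 1) (by omega) (i + 1)
      have h2 := ih s (by omega) (i + 1)
      have h3 := two_le_coeffK (s + 1) i
      have := mul_nonneg (show 0 ≤ coeffKdbl r (s + 1) (i + 2) + 2 by linarith)
        (show 0 ≤ coeffK (s + 3) (i + 1) by linarith)
      linarith

theorem coeffKdbl_le_succ_left (r s i : ℕ) :
    coeffKdbl r (s + 2) (i + 1) ≤ coeffKdbl r (s + 3) (i + 1) := by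
  have h0 := one_le_coeffKdbl r (s + 1) i
  rcases i with _ | i
  · rw [coeffKdbl_first]
    linarith
  · rw [coeffKdbl_rec]
    have h1 := one_le_coeffKdbl r (s + 2) i
    have h2 := one_le_coeffKdbl r s (i + 1)
    have h3 := two_le_coeffK (s + 1) i
    have := mul_nonneg (show 0 ≤ coeffKdbl r (s + 1) (i + 2) + 2 by linarith)
      (show 0 ≤ coeffK (s + 3) (i + 1) by linarith)
    linarith

theorem coeffKdbl_le_succ (r s i : ℕ) :
    coeffKdbl r (s + 3) (i + 1) ≤ coeffKdbl r (s + 3) (i + 2) := by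
  rw [coeffKdbl_rec]
  have h1 := one_le_coeffKdbl r (s + 1) (i + 1)
  have h2 := one_le_coeffKdbl r s (i + 1)
  have h3 := two_le_coeffK (s + 1) i
  have := mul_nonneg (show 0 ≤ coeffKdbl r (s + 1) (i + 2) + 2 by linarith)
    (show 0 ≤ coeffK (s + 3) (i + 1) by linarith)
  linarith

theorem coeffK_first_le (s i : ℕ) : coeffK (s + 3) 1 ≤ coeffK (s + 3) (i + 1) := by
  induction i with
  | zero => exact le_rfl
  | succ i ih => exact ih.trans (coeffK_le_succ s i)

theorem coeffKdbl_first_le (r s i : ℕ) : coeffKdbl r (s + 3) 1 ≤ coeffKdbl r (s + 3) (i + 1) := by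
  induction i with
  | zero => exact le_rfl
  | succ i ih => exact ih.trans (coeffKdbl_le_succ r s i)

/-- Hence upper bounds for the doubled coefficients apply to both families. -/
theorem coeffK_le_coeffKdbl (r s i : ℕ) : coeffK (s + 1) (i + 1) ≤ coeffKdbl r (s + 1) (i + 1) := by
  induction s using Nat.strong_induction_on generalizing i with
  | _ s ih =>
  rcases s with _ | _ | s
  · rw [coeffKdbl_one, coeffK_one]
  · rw [coeffKdbl_two, coeffK_two]
    have : (1 : ℤ) ≤ 6 ^ (r - 1) := one_le_pow₀ (by norm_num)
    linarith
  · have h1 := ih (s + 1) (by omega) i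
    rcases i with _ | i
    · rw [coeffKdbl_first, coeffK_first]
      linarith
    · rw [coeffKdbl_rec, coeffK_rec]
      have h2 := ih s (by omega) (i + 1)
      have h3 := two_le_coeffK (s + 1) i
      have h4 := one_le_coeffKdbl r (s + 2) i
      have h5 := one_le_coeffK s (i + 1)
      have h6 := mul_le_mul_of_nonneg_right h2 (show 0 ≤ coeffK (s + 3) (i + 1) by linarith)
      linarith

theorem coeffK_first_eq (s : ℕ) : coeffK (s + 2) 1 = 2 ^ (s + 1) := by
  induction s with
  | zero => rw [coeffK_two]; rfl
  | succ s ih => rw [coeffK_first, ih]; ring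

theorem coeffKdbl_first_eq (r s : ℕ) :
    coeffKdbl r (s + 2) 1 = 2 ^ s * (2 * 6 ^ (r - 1) + 1) - 1 := by
  induction s with
  | zero => rw [coeffKdbl_two]; ring
  | succ s ih => rw [coeffKdbl_first, ih]; ring

theorem coeffK_three (i : ℕ) : coeffK 3 (i + 1) = 2 * (i + 1) + 2 := by
  induction i with
  | zero => rw [coeffK_first, coeffK_two]; norm_num
  | succ i ih =>
    rw [coeffK_rec 0 i, ih, coeffK_two, coeffK_one]
    push_cast
    ring

/-! ### The error terms -/

/-- The error term at order `s` and level `J`: a multiple of `J ^ (s - 2)`.  The constant `E` at the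
orders one and two is smaller by a factor of three, which starts the recursion at order three. -/
def levelErr (E : ℤ) (s J : ℕ) : ℤ := if s ≤ 2 then E else 3 * E * (J : ℤ) ^ (s - 2)

theorem levelErr_of_le (E : ℤ) {s : ℕ} (hs : s ≤ 2) (J : ℕ) : levelErr E s J = E := if_pos hs

theorem levelErr_add_three (E : ℤ) (n J : ℕ) :
    levelErr E (n + 3) J = 3 * E * (J : ℤ) ^ (n + 1) := by
  rw [levelErr, if_neg (by omega)]
  rfl

theorem levelErr_nonneg {E : ℤ} (hE : 0 ≤ E) (s J : ℕ) : 0 ≤ levelErr E s J := by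
  unfold levelErr
  split_ifs
  · exact hE
  · positivity

theorem levelErr_le_succ {E : ℤ} (hE : 0 ≤ E) (n : ℕ) {J : ℕ} (hJ : 1 ≤ J) :
    levelErr E (n + 1) J ≤ levelErr E (n + 2) J := by
  have hJ' : (1 : ℤ) ≤ J := by exact_mod_cast hJ
  rcases n with _ | _ | n
  · exact le_rfl
  · rw [levelErr_of_le E (by omega), levelErr_add_three]
    rw [zero_add, pow_one]
    nlinarith [mul_nonneg hE (by linarith : (0 : ℤ) ≤ J - 1)]
  · rw [levelErr_add_three, levelErr_add_three]
    exact mul_le_mul_of_nonneg_left (pow_le_pow_right₀ hJ' (by omega)) (by linarith)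

theorem pow_add_pow_add_pow_le (n J : ℕ) :
    (J : ℤ) ^ (n + 3) + (J : ℤ) ^ (n + 2) + (J : ℤ) ^ (n + 1) ≤ ((J : ℤ) + 1) ^ (n + 3) := by
  have hJ : (0 : ℤ) ≤ J := by positivity
  induction n with
  | zero =>
    norm_num
    nlinarith [sq_nonneg (J : ℤ)]
  | succ n ih =>
    have h1 := mul_le_mul_of_nonneg_right ih (show (0 : ℤ) ≤ J + 1 by linarith)
    have h2 : (0 : ℤ) ≤ (J : ℤ) ^ (n + 3) := by positivity
    have h3 : (0 : ℤ) ≤ (J : ℤ) ^ (n + 2) := by positivity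
    have h4 : (0 : ℤ) ≤ (J : ℤ) ^ (n + 1) := by positivity
    calc (J : ℤ) ^ (n + 1 + 3) + (J : ℤ) ^ (n + 1 + 2) + (J : ℤ) ^ (n + 1 + 1)
        ≤ ((J : ℤ) ^ (n + 3) + (J : ℤ) ^ (n + 2) + (J : ℤ) ^ (n + 1)) * (J + 1) := by
          ring_nf
          ring_nf at h2 h3 h4
          linarith
      _ ≤ _ := h1.trans (le_of_eq (by ring))

/-- Passing to the next level pays for the error terms of the two lower orders. -/
theorem levelErr_add_le_next {E : ℤ} (hE : 0 ≤ E) (n J : ℕ) :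
    levelErr E (n + 3) J + (levelErr E (n + 2) J + levelErr E (n + 1) J) ≤
      levelErr E (n + 3) (J + 1) := by
  have hJ : (0 : ℤ) ≤ J := by positivity
  have hEJ : 0 ≤ E * J := mul_nonneg hE hJ
  rcases n with _ | _ | n
  · rw [levelErr_add_three, levelErr_add_three, levelErr_of_le E (by omega),
      levelErr_of_le E (by omega)]
    push_cast
    linarith
  · rw [levelErr_add_three, levelErr_add_three, levelErr_add_three, levelErr_of_le E (by omega)]
    push_cast
    ring_nf
    ring_nf at hEJ
    linarith
  · rw [levelErr_add_three, levelErr_add_three, levelErr_add_three, levelErr_add_three]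
    have := mul_le_mul_of_nonneg_left (pow_add_pow_add_pow_le n J)
      (show 0 ≤ 3 * E by linarith)
    push_cast
    linarith

theorem pow_add_two_mul_pow_le (n : ℕ) {j : ℤ} (hj : 0 ≤ j) :
    j ^ (n + 2) + 2 * j ^ (n + 1) ≤ (j + 1) ^ (n + 2) := by
  induction n with
  | zero =>
    norm_num
    linarith [add_sq j 1]
  | succ n ih =>
    have h1 := mul_le_mul_of_nonneg_right ih (show (0 : ℤ) ≤ j + 1 by linarith)
    have h2 : (0 : ℤ) ≤ j ^ (n + 2) := by positivity
    have h3 : (0 : ℤ) ≤ j ^ (n + 1) := by positivity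
    calc j ^ (n + 1 + 2) + 2 * j ^ (n + 1 + 1)
        ≤ (j ^ (n + 2) + 2 * j ^ (n + 1)) * (j + 1) := by
          ring_nf
          ring_nf at h2 h3
          linarith
      _ ≤ _ := h1.trans (le_of_eq (by ring))

/-- The increase of the error term from `c * j` to `c * (j + 1)` is at least the error term at the
level `c`. -/
theorem levelErr_mul_add_le {E : ℤ} (hE : 0 ≤ E) (n c j : ℕ) :
    levelErr E (n + 3) (c * j) + levelErr E (n + 3) c ≤ levelErr E (n + 3) (c * (j + 1)) := by
  rw [levelErr_add_three, levelErr_add_three, levelErr_add_three]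
  have h : (j : ℤ) ^ (n + 1) + 1 ≤ ((j : ℤ) + 1) ^ (n + 1) := by
    have := pow_add_pow_le (show (0 : ℤ) ≤ j by positivity) (show (0 : ℤ) ≤ 1 by norm_num)
      (Nat.succ_ne_zero n)
    simpa using this
  have := mul_le_mul_of_nonneg_left h (show 0 ≤ 3 * E * (c : ℤ) ^ (n + 1) by positivity)
  push_cast
  rw [mul_pow, mul_pow]
  linarith

/-- The increase of the error term from `c * j` to `c * (j + 1)` pays for the error terms of the
two lower orders. -/
theorem four_mul_levelErr_add_le {E : ℤ} (hE : 0 ≤ E) (n : ℕ) {c j : ℕ} (hc : n + 1 ≤ c)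
    (hj : 1 ≤ j) : 4 * levelErr E (n + 2) (c * j) + levelErr E (n + 1) (c * j) ≤
      2 * (levelErr E (n + 3) (c * (j + 1)) - levelErr E (n + 3) (c * j)) := by
  have h1 := levelErr_le_succ hE n (J := c * j) (Nat.mul_pos (by omega) hj)
  have hc' : (n : ℤ) + 1 ≤ c := by exact_mod_cast hc
  rcases n with _ | n
  · rw [levelErr_add_three, levelErr_add_three, levelErr_of_le E (by omega),
      levelErr_of_le E (by omega)]
    push_cast at hc' ⊢
    nlinarith [mul_nonneg hE (show (0 : ℤ) ≤ c - 1 by linarith)]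
  · have h2 : 4 * levelErr E (n + 3) (c * j) ≤
        levelErr E (n + 4) (c * (j + 1)) - levelErr E (n + 4) (c * j) := by
      rw [levelErr_add_three, levelErr_add_three E (n + 1), levelErr_add_three E (n + 1)]
      have h3 := mul_le_mul_of_nonneg_left (pow_add_two_mul_pow_le n (j := (j : ℤ)) (by positivity))
        (show 0 ≤ 3 * E * (c : ℤ) ^ (n + 2) by positivity)
      have h4 : 0 ≤ 3 * E * (c : ℤ) ^ (n + 1) * (j : ℤ) ^ (n + 1) := by positivity
      have h5 := mul_nonneg h4 (show (0 : ℤ) ≤ c - 2 by push_cast at hc'; linarith)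
      push_cast
      rw [mul_pow, mul_pow, mul_pow]
      ring_nf
      ring_nf at h3 h4 h5
      linarith
    have h6 := levelErr_nonneg hE (n + 3) (c * j)
    have h7 : levelErr E (n + 1 + 1) (c * j) ≤ levelErr E (n + 3) (c * j) := h1
    show 4 * levelErr E (n + 3) (c * j) + levelErr E (n + 1 + 1) (c * j) ≤
      2 * (levelErr E (n + 4) (c * (j + 1)) - levelErr E (n + 4) (c * j))
    linarith

/-! ### The upper bounds at the first row -/

section FirstRow

variable {ι : Type} {r : ℕ}

theorem image_blockMap_subset_pair {X : Finset ℤ} {u : ℤ} {M B : ℕ} (hB : 1 ≤ B) (hM : M ≤ B * 2)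
    (hX : X ⊆ Finset.Ico u (u + (M : ℤ))) : X.image (blockMap u B) ⊆ {0, 1} := by
  intro q hq
  obtain ⟨x, hx, rfl⟩ := Finset.mem_image.1 hq
  have h1 := Finset.mem_Ico.1 (hX hx)
  have hB' : (0 : ℤ) < B := by exact_mod_cast hB
  have h2 : 0 ≤ (x - u) / (B : ℤ) := Int.ediv_nonneg (by omega) hB'.le
  have h3 : (x - u) / (B : ℤ) < 2 := by
    refine Int.ediv_lt_of_lt_mul hB' ?_
    have : (M : ℤ) ≤ B * 2 := by exact_mod_cast hM
    linarith
  rw [Finset.mem_insert, Finset.mem_singleton]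
  unfold blockMap
  omega

/-- A superblock that is neither first nor last for some letter needs a third superblock. -/
theorem midLetters_eq_empty {g : ℤ → ℤ} {A : Finset ι} {X : ι → Finset ℤ}
    (h : ∀ a ∈ A, (X a).image g ⊆ {0, 1}) (q : ℤ) : midLetters g A X q = ∅ := by
  refine Finset.filter_false_of_mem fun a ha ⟨h1, ⟨x, hx, hxq⟩, ⟨y, hy, hyq⟩⟩ => ?_
  have h2 := h a ha h1
  have h3 := h a ha (Finset.mem_image_of_mem g hx)
  have h4 := h a ha (Finset.mem_image_of_mem g hy)
  simp only [Finset.mem_insert, Finset.mem_singleton] at h2 h3 h4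
  omega

/-- The row `i = 1`: halving the sequence gives two superblocks, so that there are no middle ones.
The order is `s + 1`, that is, the pattern has `s + 2` windows. -/
theorem boundOn_perm_first {E : ℤ} (hr : 1 ≤ r) (hE : (r : ℤ) - 1 ≤ E) (s J M : ℕ) (hM : 1 ≤ M)
    (hMJ : M ≤ 2 ^ J) :
    BoundOn ι r (s + 2) permMult (coeffK (s + 1) 1) (levelErr E (s + 1) J) M := by
  have hr' : (0 : ℤ) ≤ r - 1 := by omega
  have hE0 : 0 ≤ E := hr'.trans hE
  induction s using Nat.strong_induction_on generalizing J M with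
  | _ s ih =>
  rcases s with _ | _ | s
  · rw [coeffK_one, levelErr_of_le E (by omega)]
    exact (boundOn_perm_two ι hr hM).mono hM (by norm_num) le_rfl hr' hE
  · rw [coeffK_two, levelErr_of_le E (by omega)]
    exact (boundOn_perm_three ι hr hM).mono hM (by norm_num) le_rfl hr' hE
  · induction J generalizing M with
    | zero =>
      obtain rfl : M = 1 := by omega
      exact boundOn_one_block (one_le_coeffK (s + 2) 0)
    | succ J ihJ =>
      intro A X u hX hA
      have hB : 1 ≤ 2 ^ J := Nat.one_le_two_pow
      rw [pow_succ] at hMJ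
      have hK := one_le_coeffK s 0
      have hK1 := one_le_coeffK (s + 1) 0
      have hK2 : coeffK (s + 1) 1 ≤ 2 * coeffK (s + 2) 1 := by
        rcases s with _ | s
        · rw [coeffK_one, coeffK_two]; norm_num
        · rw [coeffK_first s]
          linarith [one_le_coeffK (s + 1) 0]
      have key := sum_card_le_of_superblocks (blockMap_mono u hB) hX
        (card_cell_blockMap_le u M hB) hA
        (fun M' h1 h2 => ihJ M' h1 h2)
        (fun M' h1 h2 => ih (s + 1) (by omega) J M' h1 h2)
        (fun M' h1 h2 => ih s (by omega) J M' h1 h2)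
        (by linarith [one_le_coeffK (s + 2) 0]) (by linarith) (by linarith) (H := 0)
        (by simp [midLetters_eq_empty fun a ha => image_blockMap_subset_pair hB hMJ (hX a ha)])
      refine key.trans ?_
      have hQ := one_le_card_superblocks (blockMap u (2 ^ J)) u hM
      set Q : ℤ := ((superblocks (blockMap u (2 ^ J)) u M).card : ℤ) with hQdef
      have hQ' : 1 ≤ Q := by rw [hQdef]; exact_mod_cast hQ
      have hMQ : (M : ℤ) - Q ≤ M - 1 := by linarith
      have hM' : (0 : ℤ) ≤ M - 1 := by omega
      have e0 := levelErr_nonneg hE0 (s + 2 + 1) J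
      have e1 := levelErr_nonneg hE0 (s + 1 + 1) J
      have e2 := levelErr_nonneg hE0 (s + 1) J
      have e3 : levelErr E (s + 2 + 1) J + (levelErr E (s + 1 + 1) J + levelErr E (s + 1) J) ≤
        levelErr E (s + 2 + 1) (J + 1) := levelErr_add_le_next hE0 s J
      have hKrec : coeffK (s + 2 + 1) 1 = 2 * coeffK (s + 1 + 1) 1 := coeffK_first s
      change coeffK (s + 1) 1 ≤ 2 * coeffK (s + 1 + 1) 1 at hK2
      show _ ≤ coeffK (s + 2 + 1) 1 * ((A.card : ℤ) + levelErr E (s + 2 + 1) (J + 1) * (M - 1))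
      rw [hKrec]
      generalize coeffK (s + 1 + 1) 1 = K1 at *
      generalize coeffK (s + 1) 1 = K2 at *
      generalize levelErr E (s + 2 + 1) J = L0 at *
      generalize levelErr E (s + 1 + 1) J = L1 at *
      generalize levelErr E (s + 1) J = L2 at *
      generalize levelErr E (s + 2 + 1) (J + 1) = L3 at *
      have a1 : (2 * K1 * L0 + 2 * K1 * L1 + K2 * L2) * ((M : ℤ) - Q) ≤
          (2 * K1 * L0 + 2 * K1 * L1 + K2 * L2) * (M - 1) :=
        mul_le_mul_of_nonneg_left hMQ (by positivity)
      have a2 : 2 * K1 * L0 + 2 * K1 * L1 + K2 * L2 ≤ 2 * K1 * L3 := by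
        have := mul_le_mul_of_nonneg_right hK2 e2
        have := mul_le_mul_of_nonneg_left e3 (show 0 ≤ 2 * K1 by linarith)
        linarith
      have a3 := mul_le_mul_of_nonneg_right a2 hM'
      linarith

/-- The coefficients obtained for the doubled patterns at the first row; `firstCoeff r s` belongs
to the order `s + 1`.  They satisfy the recursion `K_s = 2 * K_{s-1} + 2` and are therefore one
less than `coeffKdbl r (s + 1) 1`, except at order one. -/
def firstCoeff (r : ℕ) : ℕ → ℤ
  | 0 => 1
  | s + 1 => coeffKdbl r (s + 2) 1 - 1

theorem firstCoeff_succ_succ (r s : ℕ) :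
    firstCoeff r (s + 2) = 2 * firstCoeff r (s + 1) + 2 := by
  rw [firstCoeff, firstCoeff, coeffKdbl_first]
  ring

theorem one_le_firstCoeff (r s : ℕ) : 1 ≤ firstCoeff r s := by
  induction s with
  | zero => exact le_rfl
  | succ s ih =>
    rcases s with _ | s
    · have : (1 : ℤ) ≤ 6 ^ (r - 1) := one_le_pow₀ (by norm_num)
      rw [firstCoeff, coeffKdbl_two]
      linarith
    · rw [firstCoeff_succ_succ]
      linarith

theorem firstCoeff_le_two_mul_succ (r s : ℕ) : firstCoeff r s ≤ 2 * firstCoeff r (s + 1) := by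
  have h := one_le_firstCoeff r (s + 1)
  rcases s with _ | s
  · rw [firstCoeff]; linarith
  · rw [firstCoeff_succ_succ] at h ⊢
    linarith [one_le_firstCoeff r (s + 1)]

theorem firstCoeff_le (r s : ℕ) : firstCoeff r s ≤ coeffKdbl r (s + 1) 1 := by
  rcases s with _ | s
  · rw [firstCoeff, coeffKdbl_one]
  · rw [firstCoeff]; linarith

/-- The doubled pattern with three windows.  The count `exists_linearCount` gives the coefficient
`4 * 3 ^ (r - 1) - 1`, which is at most `2 * 6 ^ (r - 1) - 1` for `r ≥ 2`. -/
theorem boundOn_dbl_three (ι : Type) {r : ℕ} (hr : 2 ≤ r) : ∃ E : ℕ, ∀ M, 1 ≤ M →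
    BoundOn ι r 3 (dblMult 3) (2 * 6 ^ (r - 1) - 1) E M := by
  obtain ⟨E, hE⟩ := exists_linearCount (Σ _ : ι, ℕ) r (by omega)
  refine ⟨4 * 3 ^ (r - 1) * E, fun M hM => ?_⟩
  have h3 : 1 ≤ 3 ^ (r - 1) := Nat.one_le_pow _ _ (by norm_num)
  have h := LinearCount.boundOn (by omega) hE hM
  refine h.mono hM ?_ ?_ (by positivity) (by push_cast; exact le_rfl)
  · have : (1 : ℤ) ≤ 3 ^ (r - 1) := by exact_mod_cast h3
    push_cast
    linarith
  · have h2 : (2 : ℤ) ≤ 2 ^ (r - 1) := le_self_pow₀ (by norm_num) (by omega)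
    have h6 : (6 : ℤ) ^ (r - 1) = 2 ^ (r - 1) * 3 ^ (r - 1) := by rw [← mul_pow]; norm_num
    have := mul_le_mul_of_nonneg_right h2 (show (0 : ℤ) ≤ 3 ^ (r - 1) by positivity)
    push_cast
    rw [h6]
    linarith

/-- The row `i = 1` for the doubled patterns; a global letter meets just two superblocks, from each
of which one occurrence is removed. -/
theorem boundOn_dbl_first {E : ℤ} (hr : 1 ≤ r) (hE : (r : ℤ) - 1 ≤ E)
    (h3 : ∀ M, 1 ≤ M → BoundOn ι r 3 (dblMult 3) (2 * 6 ^ (r - 1) - 1) E M) (s J M : ℕ)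
    (hM : 1 ≤ M) (hMJ : M ≤ 2 ^ J) :
    BoundOn ι r (s + 2) (dblMult (s + 2)) (firstCoeff r s) (levelErr E (s + 1) J) M := by
  have hr' : (0 : ℤ) ≤ r - 1 := by omega
  have hE0 : 0 ≤ E := hr'.trans hE
  induction s using Nat.strong_induction_on generalizing J M with
  | _ s ih =>
  rcases s with _ | _ | s
  · rw [firstCoeff, levelErr_of_le E (by omega)]
    exact (boundOn_dbl_two ι hr hM).mono hM (by norm_num) le_rfl hr' hE
  · rw [firstCoeff, coeffKdbl_two, levelErr_of_le E (by omega)]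
    exact h3 M hM
  · induction J generalizing M with
    | zero =>
      obtain rfl : M = 1 := by omega
      exact boundOn_one_block (one_le_firstCoeff r _)
    | succ J ihJ =>
      intro A X u hX hA
      have hB : 1 ≤ 2 ^ J := Nat.one_le_two_pow
      rw [pow_succ] at hMJ
      have hK := one_le_firstCoeff r s
      have hK1 := one_le_firstCoeff r (s + 1)
      have hK2 := firstCoeff_le_two_mul_succ r s
      have hpair := fun a (ha : a ∈ A) => image_blockMap_subset_pair hB hMJ (hX a ha)
      have key := sum_card_le_of_superblocks_dbl (blockMap_mono u hB) hX
        (card_cell_blockMap_le u M hB) hA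
        (fun M' h1 h2 => ihJ M' h1 h2)
        (fun M' h1 h2 => ih (s + 1) (by omega) J M' h1 h2)
        (fun M' h1 h2 => ih s (by omega) J M' h1 h2)
        (by linarith [one_le_firstCoeff r (s + 2)]) (by linarith) (by linarith) (H₂ := 0)
        (H := (globalLetters (blockMap u (2 ^ J)) A X).card * 2)
        (by
          rw [← nsmul_eq_mul]
          refine Finset.sum_le_card_nsmul _ _ _ fun a ha => ?_
          have := Finset.card_le_card (hpair a (Finset.mem_filter.1 ha).1)
          exact_mod_cast this)
        (by simp [midLetters_eq_empty hpair])
      refine key.trans ?_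
      have hQ := one_le_card_superblocks (blockMap u (2 ^ J)) u hM
      set Q : ℤ := ((superblocks (blockMap u (2 ^ J)) u M).card : ℤ) with hQdef
      have hQ' : 1 ≤ Q := by rw [hQdef]; exact_mod_cast hQ
      have hMQ : (M : ℤ) - Q ≤ M - 1 := by linarith
      have hM' : (0 : ℤ) ≤ M - 1 := by omega
      have e0 := levelErr_nonneg hE0 (s + 2 + 1) J
      have e1 := levelErr_nonneg hE0 (s + 1 + 1) J
      have e2 := levelErr_nonneg hE0 (s + 1) J
      have e3 : levelErr E (s + 2 + 1) J + (levelErr E (s + 1 + 1) J + levelErr E (s + 1) J) ≤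
        levelErr E (s + 2 + 1) (J + 1) := levelErr_add_le_next hE0 s J
      show _ ≤ firstCoeff r (s + 2) * ((A.card : ℤ) + levelErr E (s + 2 + 1) (J + 1) * (M - 1))
      rw [firstCoeff_succ_succ]
      generalize firstCoeff r (s + 1) = K1 at *
      generalize firstCoeff r s = K2 at *
      generalize levelErr E (s + 2 + 1) J = L0 at *
      generalize levelErr E (s + 1 + 1) J = L1 at *
      generalize levelErr E (s + 1) J = L2 at *
      generalize levelErr E (s + 2 + 1) (J + 1) = L3 at *
      have a1 : ((2 * K1 + 2) * L0 + 2 * K1 * L1 + K2 * L2) * ((M : ℤ) - Q) ≤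
          ((2 * K1 + 2) * L0 + 2 * K1 * L1 + K2 * L2) * (M - 1) :=
        mul_le_mul_of_nonneg_left hMQ (by positivity)
      have a2 : (2 * K1 + 2) * L0 + 2 * K1 * L1 + K2 * L2 ≤ (2 * K1 + 2) * L3 := by
        have := mul_le_mul_of_nonneg_right hK2 e2
        have := mul_le_mul_of_nonneg_left e3 (show 0 ≤ 2 * K1 + 2 by linarith)
        linarith
      have a3 := mul_le_mul_of_nonneg_right a2 hM'
      linarith

end FirstRow

/-! ### The upper bounds at the later rows -/

theorem ackA_one (j : ℕ) : ackA 1 j = 2 ^ j := by rw [ackA]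

theorem ackA_at_one (i : ℕ) : ackA (i + 1) 1 = 2 := by
  rcases i with _ | i
  · rw [ackA_one, pow_one]
  · rw [ackA]

theorem ackA_rec (i j : ℕ) : ackA (i + 2) (j + 2) =
    ackA (i + 2) (j + 1) * ackA (i + 1) (ackA (i + 2) (j + 1)) := by
  rw [ackA]

theorem one_le_ackA (i j : ℕ) (hj : 1 ≤ j) : 1 ≤ ackA (i + 1) j := by
  induction i generalizing j with
  | zero => rw [ackA_one]; exact Nat.one_le_two_pow
  | succ i ih =>
    induction j, hj using Nat.le_induction with
    | base => rw [ackA_at_one]; norm_num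
    | succ j hj ihj =>
      obtain ⟨j, rfl⟩ : ∃ k, j = k + 1 := ⟨j - 1, by omega⟩
      rw [ackA_rec]
      exact Nat.mul_pos ihj (ih _ ihj)

/-- The error term of the sequence of superblocks of `w ^ c` blocks each at level `c * w`, in terms
of the number of blocks: the size of the superblocks absorbs the power of `w`. -/
theorem levelErr_mul_div_le {E : ℤ} (hE : 0 ≤ E) {n c w M : ℕ} (hc : n + 1 ≤ c) (hw : 1 ≤ w)
    (hM : 1 ≤ M) : levelErr E (n + 3) (c * w) * ((((M - 1) / w ^ c + 1 : ℕ) : ℤ) - 1) ≤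
      levelErr E (n + 3) c * (M - 1) := by
  rw [levelErr_add_three, levelErr_add_three]
  have h1 : w ^ (n + 1) * ((M - 1) / w ^ c) ≤ M - 1 :=
    (Nat.mul_le_mul_right _ (Nat.pow_le_pow_right hw hc)).trans (Nat.mul_div_le _ _)
  have h2 : ((w ^ (n + 1) * ((M - 1) / w ^ c) : ℕ) : ℤ) ≤ ((M - 1 : ℕ) : ℤ) := by exact_mod_cast h1
  have h3 : ((M - 1 : ℕ) : ℤ) = (M : ℤ) - 1 := by omega
  rw [h3] at h2
  have h4 := mul_le_mul_of_nonneg_left h2 (show 0 ≤ 3 * E * (c : ℤ) ^ (n + 1) by positivity)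
  push_cast at h4 ⊢
  rw [mul_pow]
  linarith

/-- The number of superblocks of `w ^ c` blocks is within the range of the previous row. -/
theorem card_superblocks_le {M w a c : ℕ} (hM : 1 ≤ M) (hw : 1 ≤ w) (h : M ≤ (w * a) ^ c) :
    (M - 1) / w ^ c + 1 ≤ a ^ c := by
  have hB : 0 < w ^ c := Nat.pow_pos hw
  rw [Nat.add_one_le_iff, Nat.div_lt_iff_lt_mul hB]
  rw [mul_pow, mul_comm] at h
  omega

section LaterRows

variable {ι : Type} {r : ℕ}

/-- The bound for all rows.  The order is `s + 1` and the row `i + 1`. -/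
theorem boundOn_perm {E : ℤ} (hr : 1 ≤ r) (hE : (r : ℤ) - 1 ≤ E) (i s c j M : ℕ) (hc : s ≤ c + 1)
    (hj : 1 ≤ j) (hM : 1 ≤ M) (hMj : M ≤ ackA (i + 1) j ^ c) :
    BoundOn ι r (s + 2) permMult (coeffK (s + 1) (i + 1)) (levelErr E (s + 1) (c * j)) M := by
  have hr' : (0 : ℤ) ≤ r - 1 := by omega
  have hE0 : 0 ≤ E := hr'.trans hE
  induction i generalizing s j M with
  | zero =>
    rw [ackA_one, ← pow_mul, mul_comm] at hMj
    exact boundOn_perm_first hr hE s (c * j) M hM hMj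
  | succ i ihi =>
  induction s using Nat.strong_induction_on generalizing j M with
  | _ s ih =>
  rcases s with _ | _ | s
  · rw [coeffK_one, levelErr_of_le E (by omega)]
    exact (boundOn_perm_two ι hr hM).mono hM (by norm_num) le_rfl hr' hE
  · rw [coeffK_two, levelErr_of_le E (by omega)]
    exact (boundOn_perm_three ι hr hM).mono hM (by norm_num) le_rfl hr' hE
  induction j, hj using Nat.le_induction generalizing M with
  | base =>
    rw [ackA_at_one] at hMj
    rw [mul_one]
    exact (boundOn_perm_first hr hE (s + 2) c M hM hMj).mono hM
      (by linarith [one_le_coeffK (s + 2) 0]) (coeffK_first_le s (i + 1))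
      (levelErr_nonneg hE0 _ _) le_rfl
  | succ j hj ihj =>
    intro A X u hX hA
    obtain ⟨w, hw⟩ : ∃ w, w = ackA (i + 2) j := ⟨_, rfl⟩
    have hw1 : 1 ≤ w := hw ▸ one_le_ackA (i + 1) j hj
    have hMw : M ≤ (w * ackA (i + 1) w) ^ c := by
      obtain ⟨j, rfl⟩ : ∃ k, j = k + 1 := ⟨j - 1, by omega⟩
      rw [hw, ← ackA_rec]
      exact hMj
    have hB : 1 ≤ w ^ c := Nat.pow_pos hw1
    have hmono := blockMap_mono u hB
    have hK := one_le_coeffK s (i + 1)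
    have hK1 := one_le_coeffK (s + 1) (i + 1)
    have hK0 := one_le_coeffK (s + 2) (i + 1)
    have hKp := one_le_coeffK (s + 2) i
    have hK2 : 2 * coeffK (s + 1) (i + 2) ≤ coeffK (s + 2) (i + 2) := by
      rcases s with _ | s
      · rw [coeffK_one, coeffK_two]; norm_num
      · exact two_mul_coeffK_le s (i + 1)
    set g := blockMap u (w ^ c) with hg
    set G := globalLetters g A X with hGdef
    -- the contraction of the letters occurring in several superblocks, one row earlier
    have hcon := ihi (s + 2) w _ hc hw1 (Nat.succ_pos _) (card_superblocks_le hM hw1 hMw) G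
      (fun a => (X a).image g) 0
      (fun a ha q hq => by
        obtain ⟨x, hx, rfl⟩ := Finset.mem_image.1 hq
        exact blockMap_mem_Ico hB hM (hX a (Finset.mem_filter.1 ha).1 hx))
      ((hA.image hmono).mono (Finset.filter_subset _ _) fun _ _ => subset_rfl)
    have hmid := sum_card_midLetters_add_two_mul_le A X g (superblocks g u M)
    have hmid' : ∑ q ∈ superblocks g u M, ((midLetters g A X q).card : ℤ) + 2 * G.card ≤
        ∑ a ∈ G, (((X a).image g).card : ℤ) := by exact_mod_cast hmid
    have key := sum_card_le_of_superblocks hmono hX (card_cell_blockMap_le u M hB) hA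
      (fun M' h1 h2 => ihj M' h1 (hw ▸ h2))
      (fun M' h1 h2 => ih (s + 1) (by omega) j M' (by omega) hj h1 (hw ▸ h2))
      (fun M' h1 h2 => ih s (by omega) j M' (by omega) hj h1 (hw ▸ h2))
      (by linarith) (by linarith) (by linarith)
      (show _ ≤ coeffK (s + 2 + 1) (i + 1) * ((G.card : ℤ) + levelErr E (s + 2 + 1) (c * w) *
        ((((M - 1) / w ^ c + 1 : ℕ) : ℤ) - 1)) - 2 * G.card by linarith)
    refine key.trans ?_
    have e4 : levelErr E (s + 2 + 1) (c * w) * ((((M - 1) / w ^ c + 1 : ℕ) : ℤ) - 1) ≤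
      levelErr E (s + 2 + 1) c * (M - 1) := levelErr_mul_div_le hE0 (by omega) hw1 hM
    have hQ := one_le_card_superblocks g u hM
    have hMQ : (M : ℤ) - (superblocks g u M).card ≤ M - 1 := by
      have : (1 : ℤ) ≤ (superblocks g u M).card := by exact_mod_cast hQ
      linarith
    have hM' : (0 : ℤ) ≤ M - 1 := by omega
    have e0 := levelErr_nonneg hE0 (s + 2 + 1) (c * j)
    have e1 := levelErr_nonneg hE0 (s + 1 + 1) (c * j)
    have e2 := levelErr_nonneg hE0 (s + 1) (c * j)
    have e5 := levelErr_nonneg hE0 (s + 2 + 1) c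
    have e3 : levelErr E (s + 2 + 1) (c * j) + levelErr E (s + 2 + 1) c ≤
      levelErr E (s + 2 + 1) (c * (j + 1)) := levelErr_mul_add_le hE0 s c j
    have e6 : 4 * levelErr E (s + 1 + 1) (c * j) + levelErr E (s + 1) (c * j) ≤
        2 * (levelErr E (s + 2 + 1) (c * (j + 1)) - levelErr E (s + 2 + 1) (c * j)) :=
      four_mul_levelErr_add_le hE0 s (by omega) hj
    have hrec : coeffK (s + 2 + 1) (i + 1 + 1) = 2 * coeffK (s + 1 + 1) (i + 1 + 1) +
      coeffK (s + 1) (i + 1 + 1) * (coeffK (s + 2 + 1) (i + 1) - 2) := coeffK_rec s i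
    clear key hcon hmid hmid' ihi ih ihj
    generalize levelErr E (s + 2 + 1) (c * w) * ((((M - 1) / w ^ c + 1 : ℕ) : ℤ) - 1) = err at *
    generalize ((superblocks g u M).card : ℤ) = Q at *
    generalize (A.card : ℤ) = N at *
    generalize (G.card : ℤ) = N' at *
    change 2 * coeffK (s + 1) (i + 1 + 1) ≤ coeffK (s + 1 + 1) (i + 1 + 1) at hK2
    generalize coeffK (s + 2 + 1) (i + 1 + 1) = K0 at *
    generalize coeffK (s + 1 + 1) (i + 1 + 1) = K1 at *
    generalize coeffK (s + 1) (i + 1 + 1) = K2 at *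
    generalize coeffK (s + 2 + 1) (i + 1) = Kp at *
    generalize levelErr E (s + 2 + 1) (c * j) = L0 at *
    generalize levelErr E (s + 1 + 1) (c * j) = L1 at *
    generalize levelErr E (s + 1) (c * j) = L2 at *
    generalize levelErr E (s + 2 + 1) (c * (j + 1)) = L3 at *
    generalize levelErr E (s + 2 + 1) c = T at *
    -- the number of global letters drops out by the recursion for the coefficients; the terms
    -- proportional to `M - 1` are compared through the increase of the error term
    have a1 : (K0 * L0 + 2 * K1 * L1 + K2 * L2) * ((M : ℤ) - Q) ≤
        (K0 * L0 + 2 * K1 * L1 + K2 * L2) * (M - 1) :=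
      mul_le_mul_of_nonneg_left hMQ (by positivity)
    have a2 := mul_le_mul_of_nonneg_left e4 (show 0 ≤ K2 * Kp by positivity)
    have a3 : K0 * L0 + 2 * K1 * L1 + K2 * L2 + K2 * Kp * T ≤ K0 * L3 := by
      have b1 := mul_le_mul_of_nonneg_left e3 (show 0 ≤ K2 * Kp by positivity)
      have b2 := mul_le_mul_of_nonneg_left e6 (show 0 ≤ K1 - K2 by linarith)
      have b3 := mul_le_mul_of_nonneg_right hK2 e1
      have b4 := mul_le_mul_of_nonneg_right hK2 e2
      rw [hrec]
      linarith
    have a4 := mul_le_mul_of_nonneg_right a3 hM'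
    have a5 : K0 * N' = (2 * K1 + K2 * (Kp - 2)) * N' := by rw [hrec]
    linarith

/-- The bound for the doubled patterns in all rows.  The order is `s + 1` and the row `i + 1`. -/
theorem boundOn_dbl {E : ℤ} (hr : 1 ≤ r) (hE : (r : ℤ) - 1 ≤ E)
    (h3 : ∀ M, 1 ≤ M → BoundOn ι r 3 (dblMult 3) (2 * 6 ^ (r - 1) - 1) E M) (i s c j M : ℕ)
    (hc : s ≤ c + 1) (hj : 1 ≤ j) (hM : 1 ≤ M) (hMj : M ≤ ackA (i + 1) j ^ c) :
    BoundOn ι r (s + 2) (dblMult (s + 2)) (coeffKdbl r (s + 1) (i + 1))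
      (levelErr E (s + 1) (c * j)) M := by
  have hr' : (0 : ℤ) ≤ r - 1 := by omega
  have hE0 : 0 ≤ E := hr'.trans hE
  have h6 : (1 : ℤ) ≤ 6 ^ (r - 1) := one_le_pow₀ (by norm_num)
  induction i generalizing s j M with
  | zero =>
    rw [ackA_one, ← pow_mul, mul_comm] at hMj
    exact (boundOn_dbl_first hr hE h3 s (c * j) M hM hMj).mono hM
      (by linarith [one_le_firstCoeff r s]) (firstCoeff_le r s) (levelErr_nonneg hE0 _ _) le_rfl
  | succ i ihi =>
  induction s using Nat.strong_induction_on generalizing j M with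
  | _ s ih =>
  rcases s with _ | _ | s
  · rw [coeffKdbl_one, levelErr_of_le E (by omega)]
    exact (boundOn_dbl_two ι hr hM).mono hM (by norm_num) le_rfl hr' hE
  · rw [coeffKdbl_two, levelErr_of_le E (by omega)]
    exact (h3 M hM).mono hM (by linarith) (by linarith) hE0 le_rfl
  induction j, hj using Nat.le_induction generalizing M with
  | base =>
    rw [ackA_at_one] at hMj
    rw [mul_one]
    exact (boundOn_dbl_first hr hE h3 (s + 2) c M hM hMj).mono hM
      (by linarith [one_le_firstCoeff r (s + 2)])
      ((firstCoeff_le r (s + 2)).trans (coeffKdbl_first_le r s (i + 1)))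
      (levelErr_nonneg hE0 _ _) le_rfl
  | succ j hj ihj =>
    intro A X u hX hA
    obtain ⟨w, hw⟩ : ∃ w, w = ackA (i + 2) j := ⟨_, rfl⟩
    have hw1 : 1 ≤ w := hw ▸ one_le_ackA (i + 1) j hj
    have hMw : M ≤ (w * ackA (i + 1) w) ^ c := by
      obtain ⟨j, rfl⟩ : ∃ k, j = k + 1 := ⟨j - 1, by omega⟩
      rw [hw, ← ackA_rec]
      exact hMj
    have hB : 1 ≤ w ^ c := Nat.pow_pos hw1
    have hmono := blockMap_mono u hB
    have hK := one_le_coeffKdbl r s (i + 1)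
    have hK1 := one_le_coeffKdbl r (s + 1) (i + 1)
    have hK0 := one_le_coeffKdbl r (s + 2) (i + 1)
    have hKp := one_le_coeffKdbl r (s + 2) i
    have hKq := one_le_coeffK (s + 2) i
    have hK2 : coeffKdbl r (s + 1) (i + 2) ≤ coeffKdbl r (s + 2) (i + 2) := by
      rcases s with _ | s
      · rw [coeffKdbl_one, coeffKdbl_two]; linarith
      · exact coeffKdbl_le_succ_left r s (i + 1)
    set g := blockMap u (w ^ c) with hg
    set G := globalLetters g A X with hGdef
    have hIco : ∀ a ∈ G, (X a).image g ⊆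
        Finset.Ico (0 : ℤ) (0 + (((M - 1) / w ^ c + 1 : ℕ) : ℤ)) := fun a ha q hq => by
      obtain ⟨x, hx, rfl⟩ := Finset.mem_image.1 hq
      exact blockMap_mem_Ico hB hM (hX a (Finset.mem_filter.1 ha).1 hx)
    -- the contraction of the letters occurring in several superblocks, one row earlier
    have hcon := ihi (s + 2) w _ hc hw1 (Nat.succ_pos _) (card_superblocks_le hM hw1 hMw) G
      (fun a => (X a).image g) 0 hIco
      ((hA.image hmono).mono (Finset.filter_subset _ _) fun _ _ => subset_rfl)
    -- the superblocks in which a letter occurs twice avoid the undoubled pattern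
    have hcon₂ := boundOn_perm hr hE i (s + 2) c w _ hc hw1 (Nat.succ_pos _)
      (card_superblocks_le hM hw1 hMw) G (fun a => doublePoints g (X a)) 0
      (fun a ha => (Finset.filter_subset _ _).trans (hIco a ha))
      ((hA.doublePoints (dblMult_le_two _) hmono).mono (Finset.filter_subset _ _)
        fun _ _ => subset_rfl)
    have hmid := sum_card_doubled_midLetters_le A X g (superblocks g u M)
    have hmid' : ∑ q ∈ superblocks g u M, (((midLetters g A X q).filter
        (fun a => 2 ≤ (part g (X a) q).card)).card : ℤ) ≤
        ∑ a ∈ G, ((doublePoints g (X a)).card : ℤ) := by exact_mod_cast hmid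
    have key := sum_card_le_of_superblocks_dbl hmono hX (card_cell_blockMap_le u M hB) hA
      (fun M' h1 h2 => ihj M' h1 (hw ▸ h2))
      (fun M' h1 h2 => ih (s + 1) (by omega) j M' (by omega) hj h1 (hw ▸ h2))
      (fun M' h1 h2 => ih s (by omega) j M' (by omega) hj h1 (hw ▸ h2))
      (by linarith) (by linarith) (by linarith) hcon (hmid'.trans hcon₂)
    refine key.trans ?_
    have e4 : levelErr E (s + 2 + 1) (c * w) * ((((M - 1) / w ^ c + 1 : ℕ) : ℤ) - 1) ≤
      levelErr E (s + 2 + 1) c * (M - 1) := levelErr_mul_div_le hE0 (by omega) hw1 hM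
    have hQ := one_le_card_superblocks g u hM
    have hMQ : (M : ℤ) - (superblocks g u M).card ≤ M - 1 := by
      have : (1 : ℤ) ≤ (superblocks g u M).card := by exact_mod_cast hQ
      linarith
    have hM' : (0 : ℤ) ≤ M - 1 := by omega
    have e0 := levelErr_nonneg hE0 (s + 2 + 1) (c * j)
    have e1 := levelErr_nonneg hE0 (s + 1 + 1) (c * j)
    have e2 := levelErr_nonneg hE0 (s + 1) (c * j)
    have e5 := levelErr_nonneg hE0 (s + 2 + 1) c
    have e3 : levelErr E (s + 2 + 1) (c * j) + levelErr E (s + 2 + 1) c ≤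
      levelErr E (s + 2 + 1) (c * (j + 1)) := levelErr_mul_add_le hE0 s c j
    have e6 : 4 * levelErr E (s + 1 + 1) (c * j) + levelErr E (s + 1) (c * j) ≤
        2 * (levelErr E (s + 2 + 1) (c * (j + 1)) - levelErr E (s + 2 + 1) (c * j)) :=
      four_mul_levelErr_add_le hE0 s (by omega) hj
    have hrec : coeffKdbl r (s + 2 + 1) (i + 1 + 1) = coeffKdbl r (s + 2 + 1) (i + 1) +
      2 * coeffKdbl r (s + 1 + 1) (i + 1 + 1) +
      (coeffKdbl r (s + 1) (i + 1 + 1) + 2) * coeffK (s + 2 + 1) (i + 1) := coeffKdbl_rec r s i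
    have hN' : (0 : ℤ) ≤ G.card := by positivity
    clear key hcon hcon₂ hmid hmid' ihi ih ihj
    generalize levelErr E (s + 2 + 1) (c * w) * ((((M - 1) / w ^ c + 1 : ℕ) : ℤ) - 1) = err at *
    generalize ((superblocks g u M).card : ℤ) = Q at *
    generalize (A.card : ℤ) = N at *
    generalize (G.card : ℤ) = N' at *
    change coeffKdbl r (s + 1) (i + 1 + 1) ≤ coeffKdbl r (s + 1 + 1) (i + 1 + 1) at hK2
    generalize coeffKdbl r (s + 2 + 1) (i + 1 + 1) = K0 at *
    generalize coeffKdbl r (s + 1 + 1) (i + 1 + 1) = K1 at *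
    generalize coeffKdbl r (s + 1) (i + 1 + 1) = K2 at *
    generalize coeffKdbl r (s + 2 + 1) (i + 1) = Kp at *
    generalize coeffK (s + 2 + 1) (i + 1) = Kq at *
    generalize levelErr E (s + 2 + 1) (c * j) = L0 at *
    generalize levelErr E (s + 1 + 1) (c * j) = L1 at *
    generalize levelErr E (s + 1) (c * j) = L2 at *
    generalize levelErr E (s + 2 + 1) (c * (j + 1)) = L3 at *
    generalize levelErr E (s + 2 + 1) c = T at *
    -- the recursion for the coefficients covers the number of global letters; the terms
    -- proportional to `M - 1` are compared through the increase of the error term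
    have a1 : (K0 * L0 + 2 * K1 * L1 + K2 * L2) * ((M : ℤ) - Q) ≤
        (K0 * L0 + 2 * K1 * L1 + K2 * L2) * (M - 1) :=
      mul_le_mul_of_nonneg_left hMQ (by positivity)
    have a2 := mul_le_mul_of_nonneg_left e4 (show 0 ≤ (K2 + 1) * Kq + Kp by positivity)
    have a3 : K0 * L0 + 2 * K1 * L1 + K2 * L2 + ((K2 + 1) * Kq + Kp) * T ≤ K0 * L3 := by
      have b1 := mul_le_mul_of_nonneg_left e3 (show 0 ≤ (K2 + 2) * Kq + Kp by positivity)
      have b2 := mul_le_mul_of_nonneg_left e6 (show 0 ≤ K1 by linarith)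
      have b3 := mul_le_mul_of_nonneg_right hK2 e2
      have b4 : 0 ≤ Kq * T := by positivity
      have b5 : 0 ≤ K1 * L1 := by positivity
      rw [hrec]
      linarith
    have a4 := mul_le_mul_of_nonneg_right a3 hM'
    have a5 : K0 * N' = (Kp + 2 * K1 + (K2 + 2) * Kq) * N' := by rw [hrec]
    have a6 : 0 ≤ Kq * N' := by positivity
    linarith

end LaterRows

/-! ### Sequences of blocks as set families -/

theorem List.exists_sublist_count_eq {B : Type*} [DecidableEq B] (T : List B) (ν : B → ℕ)
    (h : ∀ b, ν b ≤ T.count b) : ∃ T' : List B, T'.Sublist T ∧ ∀ b, T'.count b = ν b := by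
  induction T generalizing ν with
  | nil => exact ⟨[], List.Sublist.refl _, fun b => (Nat.le_zero.1 (h b)).symm⟩
  | cons x T ih =>
    by_cases hx : ν x = 0
    · obtain ⟨T', hT, hc⟩ := ih ν fun b => by
        by_cases hb : b = x
        · rw [hb, hx]; exact Nat.zero_le _
        · simpa [List.count_cons_of_ne (Ne.symm hb)] using h b
      exact ⟨T', hT.cons x, hc⟩
    · obtain ⟨T', hT, hc⟩ := ih (fun b => if b = x then ν x - 1 else ν b) fun b => by
        have := h b
        rw [List.count_cons] at this
        by_cases hb : b = x
        · subst hb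
          simp at this ⊢
          omega
        · have hb' : ¬ x = b := fun h => hb h.symm
          simpa [hb, hb'] using this
      refine ⟨x :: T', hT.cons_cons x, fun b => ?_⟩
      rw [List.count_cons, hc]
      by_cases hb : b = x
      · subst hb
        simp
        omega
      · have hb' : ¬ x = b := fun h => hb h.symm
        simp [hb, hb']

theorem List.filter_lt_succ_of_pairwise {B : Type*} (w : B → ℕ) (k : ℕ) {l : List B}
    (hl : l.Pairwise fun a b => w a ≤ w b) :
    l.filter (fun x => w x < k + 1) =
      l.filter (fun x => w x < k) ++ l.filter (fun x => w x = k) := by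
  induction l with
  | nil => rfl
  | cons a l ih =>
    obtain ⟨h1, h2⟩ := List.pairwise_cons.1 hl
    rw [List.filter_cons, List.filter_cons, List.filter_cons, ih h2]
    rcases lt_trichotomy (w a) k with h | h | h
    · have e1 : w a < k + 1 := by omega
      have e2 : ¬ w a = k := by omega
      simp [h, e1, e2]
    · have e1 : w a < k + 1 := by omega
      have e2 : ¬ w a < k := by omega
      have : l.filter (fun x => decide (w x < k)) = [] :=
        List.filter_eq_nil_iff.2 fun b hb => by have := h1 b hb; simp; omega
      simp [h, this]
    · have e1 : ¬ w a < k + 1 := by omega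
      have e2 : ¬ w a < k := by omega
      have e3 : ¬ w a = k := by omega
      simp [e1, e2, e3]

/-- Subsequences of consecutive windows concatenate to a subsequence. -/
theorem List.flatten_map_range_sublist {B : Type*} (w : ℕ → ℕ) (hw : Monotone w) (n k : ℕ)
    (blk : ℕ → List B) (T : ℕ → List B)
    (hT : ∀ i < k, (T i).Sublist (((List.range n).filter (fun t => w t = i)).flatMap blk)) :
    ((List.range k).map T).flatten.Sublist ((List.range n).flatMap blk) := by
  have hsorted : (List.range n).Pairwise fun a b => w a ≤ w b :=
    List.pairwise_lt_range.imp fun h => hw h.le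
  have h : ∀ k' ≤ k, ((List.range k').map T).flatten.Sublist
      (((List.range n).filter (fun t => w t < k')).flatMap blk) := by
    intro k' hk'
    induction k' with
    | zero => simp
    | succ k' ih =>
      rw [List.filter_lt_succ_of_pairwise w k' hsorted, List.flatMap_append, List.range_succ,
        List.map_append, List.flatten_append]
      refine (ih (by omega)).append ?_
      simpa using hT k' (by omega)
  refine (h k le_rfl).trans ?_
  rw [List.flatMap_def, List.flatMap_def]
  exact (List.filter_sublist.map blk).flatten

/-- The blocks of `L` that contain the letter `a`. -/
def blockSet (L : List (List ℕ)) (a : ℕ) : Finset ℤ :=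
  ((Finset.range L.length).filter (fun t => a ∈ L.getD t [])).map Nat.castEmbedding

theorem range_flatMap_getD (L : List (List ℕ)) :
    (List.range L.length).flatMap (fun t => L.getD t []) = L.flatten := by
  rw [List.flatMap_def]
  congr 1
  refine List.ext_getElem (by simp) fun i h1 h2 => ?_
  simp [h2]

theorem nodup_getD {L : List (List ℕ)} (hL : ∀ b ∈ L, b.Nodup) (t : ℕ) : (L.getD t []).Nodup := by
  by_cases h : t < L.length
  · rw [List.getD_eq_getElem _ _ h]
    exact hL _ (List.getElem_mem h)
  · rw [List.getD_eq_default _ _ (by omega)]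
    exact List.nodup_nil

theorem blockSet_subset {L : List (List ℕ)} {m : ℕ} (hm : L.length ≤ m) (a : ℕ) :
    blockSet L a ⊆ Finset.Ico (0 : ℤ) (0 + m) := by
  intro x hx
  obtain ⟨t, ht, rfl⟩ := Finset.mem_map.1 hx
  have := Finset.mem_range.1 (Finset.mem_filter.1 ht).1
  rw [Finset.mem_Ico, Nat.castEmbedding_apply]
  omega

/-- A letter occurs in the blocks with indices in `p` as often as there are such blocks containing
it. -/
theorem count_flatMap_filter {L : List (List ℕ)} (hL : ∀ b ∈ L, b.Nodup) (p : ℕ → Prop)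
    [DecidablePred p] (a : ℕ) :
    (((List.range L.length).filter (fun t => p t)).flatMap (fun t => L.getD t [])).count a =
      ((Finset.range L.length).filter (fun t => a ∈ L.getD t [] ∧ p t)).card := by
  classical
  rw [List.count_flatMap, ← List.sum_toFinset _ (List.nodup_range.filter _), List.toFinset_filter,
    List.toFinset_range, Finset.card_filter, Finset.sum_filter]
  refine Finset.sum_congr rfl fun t _ => ?_
  have := List.Nodup.count (a := a) (nodup_getD hL t)
  simp only [decide_eq_true_eq, Function.comp_apply, this]
  split_ifs <;> tauto

theorem length_flatten_eq_sum {L : List (List ℕ)} (hL : ∀ b ∈ L, b.Nodup) :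
    L.flatten.length = ∑ a ∈ L.flatten.toFinset, (blockSet L a).card := by
  rw [← Multiset.coe_card, ← Multiset.toFinset_sum_count_eq]
  refine Finset.sum_congr rfl fun a _ => ?_
  have := count_flatMap_filter hL (fun _ => True) a
  simp only [decide_true, List.filter_true, and_true] at this
  rw [blockSet, Finset.card_map, ← this, range_flatMap_getD, Multiset.coe_count]

/-- A sequence of blocks avoiding the patterns with multiplicities `μ` gives a family of sets
avoiding them. -/
theorem avoids_blockSet {r k : ℕ} {μ : ℕ → ℕ} {P : Set (List (Fin r))}
    (hP : ∀ p : Fin k → List (Fin r), (∀ q x, (p q).count x = μ q) → (List.ofFn p).flatten ∈ P)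
    {L : List (List ℕ)} (hL : ∀ b ∈ L, b.Nodup) (h : AvoidsAll P L.flatten) :
    Avoids r k μ L.flatten.toFinset (blockSet L) := by
  classical
  rintro D hD hc ⟨w, hw, hh⟩
  have hT : ∀ i, ∃ T : List ℕ, i < k → T.Sublist (((List.range L.length).filter
      (fun t : ℕ => w (t : ℤ) = i)).flatMap (fun t => L.getD t [])) ∧
      ∀ b, T.count b = if b ∈ D then μ i else 0 := by
    intro i
    by_cases hi : i < k
    · obtain ⟨T, h1, h2⟩ := List.exists_sublist_count_eq (((List.range L.length).filter
        (fun t : ℕ => w (t : ℤ) = i)).flatMap (fun t => L.getD t []))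
        (fun b => if b ∈ D then μ i else 0) fun b => by
          split_ifs with hb
          · refine (hh b hb i hi).trans (le_of_eq ?_)
            rw [count_flatMap_filter hL (fun t : ℕ => w (t : ℤ) = i), blockSet, Finset.filter_map,
              Finset.card_map, Finset.filter_filter]
            rfl
          · exact Nat.zero_le _
      exact ⟨T, fun _ => ⟨h1, h2⟩⟩
    · exact ⟨[], fun hi' => absurd hi' hi⟩
  choose T hT using hT
  set f : Fin r → ℕ := fun x => (D.orderEmbOfFin hc x : ℕ) with hf
  have hfinj : Function.Injective f := (D.orderEmbOfFin hc).injective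
  have hfD : ∀ x, f x ∈ D := fun x => D.orderEmbOfFin_mem hc x
  have hfr : Set.range f = D := D.range_orderEmbOfFin hc
  have hp : ∀ q : Fin k, ∃ p : List (Fin r), p.map f = T q := by
    intro q
    have : T q ∈ Set.range (List.map f) := by
      rw [Set.range_list_map]
      intro x hx
      rw [hfr]
      by_contra hxD
      have h0 := (hT q q.2).2 x
      rw [if_neg (by exact_mod_cast hxD)] at h0
      exact List.count_eq_zero.1 h0 hx
    exact this
  choose p hp using hp
  refine h _ (hP p fun q x => ?_) ⟨f, hfinj.injOn, ?_⟩
  · rw [← List.count_map_of_injective _ f hfinj, hp, (hT q q.2).2, if_pos (hfD x)]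
  · have hmap : (List.ofFn p).flatten.map f = ((List.range k).map T).flatten := by
      rw [List.map_flatten, List.map_ofFn]
      congr 1
      refine List.ext_getElem (by simp) fun i h1 h2 => ?_
      simp [hp]
    rw [hmap, ← range_flatMap_getD L]
    exact List.flatten_map_range_sublist (fun t => w (t : ℤ))
      (fun a b hab => hw (by exact_mod_cast hab)) _ _ _ _ fun i hi => (hT i hi).1

theorem exBlocked_le {A : Type*} {P : Set (List A)} {n m : ℕ} {b : ℤ} (hb : 0 ≤ b)
    (h : ∀ l ∈ blockedLengths P n m, (l : ℤ) ≤ b) : (exBlocked P n m : ℤ) ≤ b := by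
  rcases (blockedLengths P n m).eq_empty_or_nonempty with he | hne
  · rw [exBlocked, he, csSup_empty]
    simpa using hb
  · exact h _ (Nat.sSup_mem hne (blockedLengths_bddAbove P n m))

/-- A bound for set families transfers to the extremal function. -/
theorem exBlocked_le_of_boundOn {r k : ℕ} {μ : ℕ → ℕ} {P : Set (List (Fin r))}
    (hP : ∀ p : Fin k → List (Fin r), (∀ q x, (p q).count x = μ q) → (List.ofFn p).flatten ∈ P)
    {K E : ℤ} (hK : 0 ≤ K) (hE : 0 ≤ E) {n m : ℕ} (hb : 1 ≤ m → BoundOn ℕ r k μ K E m) :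
    (exBlocked P n m : ℤ) ≤ K * (n + E * m) := by
  refine exBlocked_le (by positivity) ?_
  rintro l ⟨S, rfl, hS, hn, L, hLm, hL, rfl⟩
  rcases Nat.eq_zero_or_pos m with rfl | hm
  · obtain rfl : L = [] := List.length_eq_zero_iff.1 (by omega)
    simp only [List.flatten_nil, List.length_nil]
    push_cast
    positivity
  · have h := hb hm L.flatten.toFinset (blockSet L) 0 (fun a _ => blockSet_subset hLm a)
      (avoids_blockSet hP hL hS)
    rw [length_flatten_eq_sum hL, ← hn]
    push_cast
    refine h.trans (mul_le_mul_of_nonneg_left ?_ hK)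
    have : E * ((m : ℤ) - 1) ≤ E * m := mul_le_mul_of_nonneg_left (by linarith) hE
    linarith

/-- The constant is three times the sum of the error constants of the base cases. -/
theorem upper_bounds (r : ℕ) (hr : 2 ≤ r) : ∃ C : ℕ, ∀ i s c n m j : ℕ, 1 ≤ i → 3 ≤ s →
    s - 2 ≤ c → IsLeast {j' : ℕ | 1 ≤ j' ∧ m ≤ ackA i j' ^ c} j →
      (PERM r s n m : ℤ) ≤ coeffK s i * ((n + C * (c * j) ^ (s - 2) * m : ℕ) : ℤ) ∧
      (dblPERM r s n m : ℤ) ≤ coeffKdbl r s i * ((n + C * (c * j) ^ (s - 2) * m : ℕ) : ℤ) := by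
  obtain ⟨E, hE⟩ := boundOn_dbl_three ℕ hr
  refine ⟨3 * (E + r), fun i s c n m j hi hs hc hj => ?_⟩
  obtain ⟨i, rfl⟩ : ∃ k, i = k + 1 := ⟨i - 1, by omega⟩
  obtain ⟨s, rfl⟩ : ∃ k, s = k + 3 := ⟨s - 3, by omega⟩
  obtain ⟨⟨hj1, hmj⟩, -⟩ := hj
  set E' : ℤ := E + r with hE'
  have hE0 : 0 ≤ E' := by positivity
  have hEr : (r : ℤ) - 1 ≤ E' := by
    have : (0 : ℤ) ≤ E := by positivity
    linarith
  have h3 : ∀ M, 1 ≤ M → BoundOn ℕ r 3 (dblMult 3) (2 * 6 ^ (r - 1) - 1) E' M := fun M hM =>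
    (hE M hM).mono hM (by have : (1 : ℤ) ≤ 6 ^ (r - 1) := one_le_pow₀ (by norm_num)
                          linarith) le_rfl (by positivity) (by
      have : (0 : ℤ) ≤ r := by positivity
      linarith)
  have hcast : ((n + 3 * (E + r) * (c * j) ^ (s + 3 - 2) * m : ℕ) : ℤ) =
      n + levelErr E' (s + 3) (c * j) * m := by
    rw [levelErr_add_three, hE']
    push_cast
    rfl
  rw [hcast]
  have hs' : s + 2 ≤ c + 1 := by omega
  constructor
  · exact exBlocked_le_of_boundOn (μ := permMult) (P := permSet r (s + 4))
      (fun p hp => ⟨p, hp, rfl⟩)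
      (by linarith [one_le_coeffK (s + 2) i]) (levelErr_nonneg hE0 _ _)
      fun hm => boundOn_perm (by omega) hEr i (s + 2) c j m hs' hj1 hm hmj
  · exact exBlocked_le_of_boundOn (μ := dblMult (s + 4)) (P := dblPermSet r (s + 4))
      (fun p hp => ⟨p, hp, rfl⟩)
      (by linarith [one_le_coeffKdbl r (s + 2) i]) (levelErr_nonneg hE0 _ _)
      fun hm => boundOn_dbl (by omega) hEr h3 i (s + 2) c j m hs' hj1 hm hmj

/-! ### Closed forms of order at most five -/

theorem coeffKdbl_three (r i : ℕ) : coeffKdbl r 3 (i + 1) =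
    3 * (i + 1) ^ 2 + 3 * (i + 1) + 4 * 6 ^ (r - 1) * (i + 1) - 5 := by
  induction i with
  | zero =>
    rw [coeffKdbl_first, coeffKdbl_two]
    push_cast
    ring
  | succ i ih =>
    rw [coeffKdbl_rec r 0 i, ih, coeffKdbl_two, coeffKdbl_one, coeffK_three]
    push_cast
    ring

theorem coeffK_four (i : ℕ) : coeffK 4 (i + 1) = 10 * 2 ^ (i + 1) - 4 * (i + 1) - 8 := by
  induction i with
  | zero => rw [coeffK_first, coeffK_first, coeffK_two]; norm_num
  | succ i ih =>
    rw [coeffK_rec 1 i, ih, coeffK_two, coeffK_three]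
    push_cast
    ring

theorem two_pow_le_coeffK_four (i : ℕ) : 2 ^ (i + 1) ≤ coeffK 4 (i + 1) := by
  have : ((i + 1 : ℕ) : ℤ) < ((2 ^ (i + 1) : ℕ) : ℤ) := by exact_mod_cast Nat.lt_two_pow_self
  push_cast at this
  rw [coeffK_four]
  linarith

theorem coeffK_four_le (i : ℕ) : coeffK 4 (i + 1) ≤ 10 * 2 ^ (i + 1) := by
  rw [coeffK_four]
  have : (0 : ℤ) ≤ i := by positivity
  linarith

theorem sq_le_four_mul_two_pow (i : ℕ) : ((i : ℤ) + 2) ^ 2 ≤ 4 * 2 ^ (i + 1) := by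
  induction i with
  | zero => norm_num
  | succ i ih =>
    have hi : (0 : ℤ) ≤ i := by positivity
    rcases i with _ | i
    · norm_num
    · rw [pow_succ 2 (i + 1 + 1)]
      push_cast at ih hi ⊢
      nlinarith

/-- The step from `i` to `i + 1` adds at most `(50 + 28 * 6 ^ (r - 1)) * 2 ^ i`: a quadratic term
`2 * K^dbl_{3,i+1}` bounded through `(i + 1) ^ 2 ≤ 4 * 2 ^ i`, and
`(2 * 6 ^ (r - 1) + 2) * K_{4,i}`. -/
theorem coeffKdbl_four_le (r i : ℕ) :
    coeffKdbl r 4 (i + 1) ≤ (50 + 28 * 6 ^ (r - 1)) * 2 ^ (i + 1) := by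
  have h6 : (1 : ℤ) ≤ 6 ^ (r - 1) := one_le_pow₀ (by norm_num)
  induction i with
  | zero =>
    rw [coeffKdbl_first, coeffKdbl_three]
    push_cast
    linarith
  | succ i ih =>
    have h1 := sq_le_four_mul_two_pow i
    have h2 : (i : ℤ) + 2 ≤ 2 ^ (i + 1) := by
      have : ((i + 1 : ℕ) : ℤ) < ((2 ^ (i + 1) : ℕ) : ℤ) := by exact_mod_cast Nat.lt_two_pow_self
      push_cast at this
      linarith
    have h3 := mul_le_mul_of_nonneg_left h2 (show (0 : ℤ) ≤ 6 ^ (r - 1) by positivity)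
    have h4 := mul_le_mul_of_nonneg_left (coeffK_four_le i)
      (show (0 : ℤ) ≤ 2 * 6 ^ (r - 1) + 2 by positivity)
    have h5 : (0 : ℤ) < 2 ^ (i + 1) := by positivity
    have h7 := mul_le_mul_of_nonneg_right h6 h5.le
    rw [coeffKdbl_rec r 1 i, coeffKdbl_three, coeffKdbl_two, pow_succ 2 (i + 1)]
    push_cast
    linarith

theorem coeffK_five_le (i : ℕ) : coeffK 5 (i + 1) ≤ 2 ^ (i + 1) * ((i + 1 + 3)! : ℤ) := by
  induction i with
  | zero =>
    rw [coeffK_first, coeffK_first, coeffK_first, coeffK_two]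
    norm_num [Nat.factorial]
  | succ i ih =>
    have h1 := coeffK_four_le (i + 1)
    have h2 := mul_le_mul_of_nonneg_left ih (show (0 : ℤ) ≤ 2 * (i + 2) by positivity)
    have h3 : (24 : ℤ) ≤ ((i + 1 + 3)! : ℤ) := by
      have := Nat.factorial_le (show 4 ≤ i + 1 + 3 by omega)
      exact_mod_cast this
    have h4 := mul_le_mul_of_nonneg_right h3 (show (0 : ℤ) ≤ 2 ^ (i + 1) by positivity)
    rw [coeffK_rec 2 i, coeffK_three, show i + 1 + 1 + 3 = (i + 1 + 3) + 1 by ring,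
      Nat.factorial_succ]
    have h5 := two_le_coeffK 3 i
    have h6 : (0 : ℤ) ≤ i := by positivity
    rw [pow_succ] at h1 ⊢
    push_cast at h1 h2 ⊢
    linarith

/-- Here the undoubled coefficient in the recursion matters: the quadratic factor `K^dbl_{3,i}`
multiplies `K_{5,i}`, which involves `(i + 3)!` only, and is absorbed by a larger shift `C`. -/
theorem coeffKdbl_five_le (r : ℕ) : ∃ C : ℕ, ∀ i : ℕ,
    coeffKdbl r 5 (i + 1) ≤ 2 ^ (i + 1) * ((i + 1 + C)! : ℤ) := by
  obtain ⟨G, hG⟩ : ∃ G : ℕ, G = 6 ^ (r - 1) := ⟨_, rfl⟩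
  have hG' : (6 : ℤ) ^ (r - 1) = G := by rw [hG]; push_cast; rfl
  have h6 : (1 : ℤ) ≤ G := by rw [← hG']; exact one_le_pow₀ (by norm_num)
  refine ⟨4 * (50 + 28 * G) + 6 + 4 * G, fun i => ?_⟩
  obtain ⟨C, hC⟩ : ∃ C, C = 4 * (50 + 28 * G) + 6 + 4 * G := ⟨_, rfl⟩
  rw [← hC]
  have hC' : (C : ℤ) = 4 * (50 + 28 * G) + 6 + 4 * G := by rw [hC]; push_cast; rfl
  induction i with
  | zero =>
    rw [coeffKdbl_first, coeffKdbl_first, coeffKdbl_first, coeffKdbl_two, hG']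
    have : ((0 + 1 + C : ℕ) : ℤ) ≤ ((0 + 1 + C)! : ℤ) := by exact_mod_cast Nat.self_le_factorial _
    simp only [zero_add, pow_one] at this ⊢
    push_cast at this
    linarith
  | succ i ih =>
    have hi : (0 : ℤ) ≤ i := by positivity
    have hfac : ((i + 1 + 3)! : ℤ) * ((i + 4 + 1) * (i + 1 + C)) ≤ ((i + 1 + C)! : ℤ) := by
      obtain ⟨D, hD⟩ : ∃ D, C = D + 5 := ⟨C - 5, by omega⟩
      have e1 : (i + 1 + C)! = (i + 1 + C) * ((i + 5 + D) * (i + 4 + D)!) := by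
        rw [show i + 1 + C = (i + 4 + D + 1) + 1 by omega, Nat.factorial_succ (i + 4 + D + 1),
          Nat.factorial_succ (i + 4 + D), show i + 5 + D = i + 4 + D + 1 by omega]
      have e2 := Nat.factorial_le (show i + 1 + 3 ≤ i + 4 + D by omega)
      rw [e1]
      have : (i + 1 + 3)! * ((i + 4 + 1) * (i + 1 + C)) ≤
          (i + 1 + C) * ((i + 5 + D) * (i + 4 + D)!) := by
        rw [show (i + 1 + C) * ((i + 5 + D) * (i + 4 + D)!) =
          (i + 4 + D)! * ((i + 5 + D) * (i + 1 + C)) by ring]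
        gcongr <;> omega
      exact_mod_cast this
    have hf1 : (1 : ℤ) ≤ ((i + 1 + 3)! : ℤ) := by exact_mod_cast Nat.factorial_pos _
    have h1 := coeffKdbl_four_le r (i + 1)
    have h2 := coeffK_five_le i
    have hD3 : coeffKdbl r 3 (i + 2) + 2 ≤ (6 + 4 * G) * (i + 2) ^ 2 := by
      rw [coeffKdbl_three, hG']
      push_cast
      nlinarith [mul_nonneg (show (0 : ℤ) ≤ G by linarith) (mul_nonneg hi hi),
        mul_nonneg (show (0 : ℤ) ≤ G by linarith) hi]
    have hD3' := one_le_coeffKdbl r 2 (i + 1)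
    have h3 := mul_le_mul hD3 h2 (by linarith [two_le_coeffK 3 i]) (by positivity)
    -- the quadratic factor from the third order is absorbed by two factors of the larger factorial
    have hpoly : (6 + 4 * (G : ℤ)) * (i + 2) ^ 2 + 4 * (50 + 28 * G) ≤
        ((i + 4 + 1) * (i + 1 + C)) * (2 * (i + 1 + C) + 1) := by
      have p1 : (i : ℤ) + 2 ≤ 2 * (i + 1 + C) + 1 := by linarith
      have p2 : (6 + 4 * (G : ℤ)) ≤ i + 1 + C := by linarith
      have p3 : 4 * (50 + 28 * (G : ℤ)) ≤ C := by linarith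
      have q1 : (6 + 4 * (G : ℤ)) * (i + 2) ≤ (i + 1 + C) * (2 * (i + 1 + C) + 1) :=
        mul_le_mul p2 p1 (by positivity) (by positivity)
      have q2 : (6 + 4 * (G : ℤ)) * (i + 2) * (i + 2) ≤
          (i + 1 + C) * (2 * (i + 1 + C) + 1) * (i + 2) :=
        mul_le_mul_of_nonneg_right q1 (by positivity)
      have q3 : (C : ℤ) * 1 ≤ (i + 1 + C) * (2 * (i + 1 + C) + 1) :=
        mul_le_mul (by linarith) (by linarith) (by norm_num) (by positivity)
      have q4 : (0 : ℤ) ≤ (i + 1 + C) * (2 * (i + 1 + C) + 1) := by positivity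
      nlinarith
    have h4 := mul_le_mul_of_nonneg_left hpoly (show (0 : ℤ) ≤ ((i + 1 + 3)! : ℤ) by positivity)
    have h5 := mul_le_mul_of_nonneg_right hfac (show (0 : ℤ) ≤ 2 * (i + 1 + C) + 1 by positivity)
    have h6 := mul_le_mul_of_nonneg_right hf1 (show (0 : ℤ) ≤ 4 * (50 + 28 * G) by positivity)
    have h7 : (6 + 4 * (G : ℤ)) * (i + 2) ^ 2 * ((i + 1 + 3)! : ℤ) + 4 * (50 + 28 * G) ≤
        ((i + 1 + C)! : ℤ) * (2 * (i + 1 + C) + 1) := by linarith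
    have h8 := mul_le_mul_of_nonneg_left h7 (show (0 : ℤ) ≤ 2 ^ (i + 1) by positivity)
    rw [coeffKdbl_rec r 2 i, show i + 1 + 1 + C = (i + 1 + C) + 1 by ring, Nat.factorial_succ]
    rw [pow_succ, hG'] at h1
    rw [pow_succ]
    push_cast at h1 h3 h8 ⊢
    linarith

/-! ### Closed forms of higher order -/

theorem exp_one_le_one_add_inv_pow {n : ℕ} (hn : 1 ≤ n) :
    Real.exp 1 ≤ (1 + 1 / (n : ℝ)) ^ (n + 1) := by
  have hn' : (0 : ℝ) < n := by exact_mod_cast hn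
  have hpos : (0 : ℝ) < 1 + 1 / (n : ℝ) := by positivity
  have h := Real.one_sub_inv_le_log_of_pos hpos
  have h1 : 1 - (1 + 1 / (n : ℝ))⁻¹ = 1 / ((n : ℝ) + 1) := by
    field_simp
    ring
  rw [h1] at h
  rw [← Real.exp_log (pow_pos hpos (n + 1)), Real.log_pow]
  refine Real.exp_le_exp.2 ?_
  have h2 := mul_le_mul_of_nonneg_left h (show (0 : ℝ) ≤ n + 1 by positivity)
  rw [mul_one_div_cancel (by positivity)] at h2
  push_cast
  exact h2

/-- The base of the bounds at odd orders. -/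
noncomputable def oddBase (i : ℕ) : ℝ := 2 * ((i : ℝ) + 1) / Real.exp 1

theorem one_lt_oddBase_one : 1 < oddBase 1 := by
  have := Real.exp_one_lt_d9
  rw [oddBase, one_lt_div (Real.exp_pos 1)]
  push_cast
  linarith

theorem oddBase_mono : Monotone oddBase := fun i j h => by
  have : (i : ℝ) ≤ j := by exact_mod_cast h
  unfold oddBase
  gcongr

theorem two_le_oddBase (i : ℕ) : 2 ≤ oddBase (i + 2) := by
  refine le_trans ?_ (oddBase_mono (show 2 ≤ i + 2 by omega))
  have := Real.exp_one_lt_d9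
  rw [oddBase, le_div_iff₀ (Real.exp_pos 1)]
  push_cast
  linarith

theorem oddBase_le (i : ℕ) : oddBase i ≤ i + 1 := by
  have := Real.exp_one_gt_d9
  have hi : (0 : ℝ) ≤ i := by positivity
  rw [oddBase, div_le_iff₀ (Real.exp_pos 1)]
  nlinarith

/-- An upper bound of Stirling type.  In the step from `i` to `i + 1` the left side gains the factor
`2 * (i + 2 + D)`, and `(1 + 1 / n) ^ (n + 1) ≥ e` shows that the right side gains at least as
much. -/
theorem two_pow_mul_factorial_le (D : ℕ) : ∃ C : ℕ, ∀ i : ℕ,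
    (2 : ℝ) ^ (i + 1) * ((i + 1 + D)! : ℝ) ≤ oddBase (i + 1) ^ (i + 1 + C) := by
  obtain ⟨k, hk⟩ := pow_unbounded_of_one_lt (2 * ((1 + D)! : ℝ)) one_lt_oddBase_one
  refine ⟨D + k + 2, fun i => ?_⟩
  induction i with
  | zero =>
    refine le_trans ?_ (pow_le_pow_right₀ one_lt_oddBase_one.le
      (show k ≤ 0 + 1 + (D + k + 2) by omega))
    simpa using hk.le
  | succ i ih =>
    have hn : (0 : ℝ) < (i : ℝ) + 2 := by positivity
    have he := Real.exp_pos 1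
    have hx : oddBase (i + 1 + 1) = oddBase (i + 1) * (1 + 1 / ((i + 2 : ℕ) : ℝ)) := by
      unfold oddBase
      push_cast
      field_simp
      ring
    have hb := exp_one_le_one_add_inv_pow (show 1 ≤ i + 2 by omega)
    have hbern := one_add_mul_le_pow (a := 1 / ((i + 2 : ℕ) : ℝ))
      (by have : (0 : ℝ) ≤ 1 / ((i + 2 : ℕ) : ℝ) := by positivity
          linarith) (D + k)
    -- the new factor `2 * (i + 2 + D)` of the factorial against the growth of the power
    have hgrow : 2 * ((i : ℝ) + 2 + D) ≤
        oddBase (i + 1 + 1) * (1 + 1 / ((i + 2 : ℕ) : ℝ)) ^ (i + 1 + (D + k + 2)) := by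
      rw [show i + 1 + (D + k + 2) = (i + 2 + 1) + (D + k) by ring, pow_add]
      have h1 : Real.exp 1 * (1 + ((D + k : ℕ) : ℝ) * (1 / ((i + 2 : ℕ) : ℝ))) ≤
          (1 + 1 / ((i + 2 : ℕ) : ℝ)) ^ (i + 2 + 1) * (1 + 1 / ((i + 2 : ℕ) : ℝ)) ^ (D + k) :=
        mul_le_mul hb hbern (by positivity) (by positivity)
      refine le_trans ?_ (mul_le_mul_of_nonneg_left h1 (by unfold oddBase; positivity))
      have h2 : oddBase (i + 1 + 1) *
          (Real.exp 1 * (1 + ((D + k : ℕ) : ℝ) * (1 / ((i + 2 : ℕ) : ℝ)))) =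
          2 * ((i : ℝ) + 3) * (1 + ((D : ℝ) + k) / ((i : ℝ) + 2)) := by
        unfold oddBase
        push_cast
        field_simp
        ring
      rw [h2]
      have h3 : (D : ℝ) + k ≤ ((i : ℝ) + 3) * (((D : ℝ) + k) / ((i : ℝ) + 2)) := by
        rw [mul_div_assoc', le_div_iff₀ hn]
        have : (0 : ℝ) ≤ (D : ℝ) + k := by positivity
        nlinarith
      have h4 : (0 : ℝ) ≤ k := by positivity
      linarith
    have hpow : oddBase (i + 1 + 1) ^ (i + 1 + 1 + (D + k + 2)) =
        oddBase (i + 1) ^ (i + 1 + (D + k + 2)) *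
          (oddBase (i + 1 + 1) * (1 + 1 / ((i + 2 : ℕ) : ℝ)) ^ (i + 1 + (D + k + 2))) := by
      rw [show i + 1 + 1 + (D + k + 2) = (i + 1 + (D + k + 2)) + 1 by ring, pow_succ]
      nth_rewrite 1 [hx]
      rw [mul_pow]
      ring
    rw [hpow]
    refine le_trans (le_of_eq ?_) (mul_le_mul ih hgrow (by positivity)
      (by unfold oddBase; positivity))
    rw [show i + 1 + 1 + D = (i + 1 + D) + 1 by ring, Nat.factorial_succ]
    push_cast
    ring

theorem choose_add_le_choose {N u : ℕ} (h : u ≤ N) (m : ℕ) :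
    N.choose (u + 1) + m ≤ (N + m).choose (u + 1) := by
  induction m with
  | zero => exact le_rfl
  | succ m ih =>
    rw [← add_assoc N, Nat.choose_succ_succ]
    have := Nat.choose_pos (show u ≤ N + m by omega)
    simp only [Nat.succ_eq_add_one] at *
    omega

/-- A recursion that multiplies by a power with a binomial exponent has a solution bounded by a
power whose exponent is the next binomial coefficient. -/
theorem exists_le_pow_choose {D F H x : ℕ → ℝ} (hD : ∀ i, 0 ≤ D (i + 1))
    (hrec : ∀ i, D (i + 2) ≤ D (i + 1) * (F (i + 2) + 3) + 2 * H (i + 2)) (hx1 : 1 < x 1)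
    (hx2 : ∀ i, 2 ≤ x (i + 2)) (hxm : ∀ i, x (i + 1) ≤ x (i + 2)) {u C₁ C₂ : ℕ}
    (hF : ∀ i, F (i + 2) ≤ x (i + 2) ^ ((i + 2 + C₁).choose (u + 1)))
    (hH : ∀ i, H (i + 2) ≤ x (i + 2) ^ ((i + 2 + C₂).choose (u + 2))) :
    ∃ C : ℕ, ∀ i, D (i + 1) ≤ x (i + 1) ^ ((i + 1 + C).choose (u + 2)) := by
  obtain ⟨k, hk⟩ := pow_unbounded_of_one_lt (D 1) hx1
  refine ⟨C₁ + C₂ + u + k + 5, fun i => ?_⟩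
  obtain ⟨C, hC⟩ : ∃ C, C = C₁ + C₂ + u + k + 5 := ⟨_, rfl⟩
  rw [← hC]
  induction i with
  | zero =>
    refine hk.le.trans (pow_le_pow_right₀ hx1.le ?_)
    have h1 := choose_add_le_choose (le_refl (u + 1)) (C - u)
    rw [show u + 1 + (C - u) = 0 + 1 + C by omega] at h1
    change (u + 1).choose (u + 2) + (C - u) ≤ (0 + 1 + C).choose (u + 2) at h1
    omega
  | succ i ih =>
    have hx := hx2 i
    have hx1' : 1 ≤ x (i + 2) := by linarith
    have hx0 : 0 ≤ x (i + 1) := by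
      rcases i with _ | i
      · exact (zero_lt_one.trans hx1).le
      · linarith [hx2 i]
    have ih' : D (i + 1) ≤ x (i + 2) ^ ((i + 1 + C).choose (u + 2)) :=
      ih.trans (pow_le_pow_left₀ hx0 (hxm i) _)
    set b₁ := (i + 2 + C₁).choose (u + 1) with hb₁
    set b₂ := (i + 2 + C₂).choose (u + 2) with hb₂
    set Φ := (i + 1 + C).choose (u + 2) with hΦ
    have hexp : (i + 1 + 1 + C).choose (u + 2) = (i + 1 + C).choose (u + 1) + Φ := by
      rw [show i + 1 + 1 + C = (i + 1 + C) + 1 by ring, Nat.choose_succ_succ]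
    have hb₁' : b₁ + 3 ≤ (i + 1 + C).choose (u + 1) := by
      refine le_trans (Nat.add_le_add_right (Nat.choose_le_choose _ (Nat.le_add_right _ u)) 3)
        ((choose_add_le_choose (by omega) 3).trans (Nat.choose_le_choose _ (by omega)))
    have hb₂' : b₂ + 2 ≤ (i + 1 + 1 + C).choose (u + 2) := by
      refine le_trans (Nat.add_le_add_right (Nat.choose_le_choose _ (Nat.le_add_right _ (u + 1))) 2)
        ((choose_add_le_choose (by omega) 2).trans (Nat.choose_le_choose _ (by omega)))
    obtain ⟨e, he⟩ : ∃ e, (i + 1 + 1 + C).choose (u + 2) = e + 1 :=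
      ⟨(i + 1 + 1 + C).choose (u + 2) - 1, by omega⟩
    have h1 : F (i + 2) + 3 ≤ x (i + 2) ^ (b₁ + 2) := by
      have h2 : (1 : ℝ) ≤ x (i + 2) ^ b₁ := one_le_pow₀ hx1'
      -- `y + 3 ≤ 4 * x ^ b₁` for `y ≤ x ^ b₁`, and two more factors of `x` pay for the four
      have h3 : (4 : ℝ) ≤ x (i + 2) ^ 2 := by nlinarith
      rw [pow_add]
      nlinarith [hF i]
    have h2 : D (i + 1) * (F (i + 2) + 3) ≤ x (i + 2) ^ e := by
      calc D (i + 1) * (F (i + 2) + 3) ≤ x (i + 2) ^ Φ * x (i + 2) ^ (b₁ + 2) := by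
            refine (mul_le_mul_of_nonneg_left h1 (hD i)).trans
              (mul_le_mul_of_nonneg_right ih' (by positivity))
        _ = x (i + 2) ^ (Φ + (b₁ + 2)) := (pow_add _ _ _).symm
        _ ≤ _ := pow_le_pow_right₀ hx1' (by omega)
    have h3 : 2 * H (i + 2) ≤ x (i + 2) ^ e := by
      calc 2 * H (i + 2) ≤ x (i + 2) * x (i + 2) ^ b₂ := by
            refine (mul_le_mul_of_nonneg_left (hH i) (by norm_num)).trans
              (mul_le_mul_of_nonneg_right hx (by positivity))
        _ = x (i + 2) ^ (b₂ + 1) := (pow_succ' _ _).symm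
        _ ≤ _ := pow_le_pow_right₀ hx1' (by omega)
    rw [he, show i + 1 + 1 = i + 2 from rfl, pow_succ]
    have h4 : (0 : ℝ) ≤ x (i + 2) ^ e := by positivity
    nlinarith [hrec i]

theorem exists_pow_le_two_pow (t : ℕ) : ∃ C : ℕ, ∀ n : ℕ, ((n : ℝ) + 2) ^ t ≤ 2 ^ (n + C) := by
  obtain ⟨B, hB⟩ := (tendsto_pow_const_div_const_pow_of_one_lt t
    (show (1 : ℝ) < 2 by norm_num)).bddAbove_range
  obtain ⟨k, hk⟩ := pow_unbounded_of_one_lt B (show (1 : ℝ) < 2 by norm_num)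
  refine ⟨k + 2, fun n => ?_⟩
  have h := hB ⟨n + 2, rfl⟩
  simp only at h
  rw [div_le_iff₀ (by positivity)] at h
  push_cast at h
  refine h.trans ?_
  rw [show n + (k + 2) = k + (n + 2) by ring, pow_add 2 k]
  exact mul_le_mul_of_nonneg_right hk.le (by positivity)

/-- The bound at an odd order is absorbed by the bound at the next even order, because
`(u + 2) * binom(n + 1, u + 2) = (n + 1) * binom(n, u + 1)` and the `u + 2`-nd power of `i + 2` is
at most exponential in `i`. -/
theorem oddBase_pow_choose_le (u C₂ : ℕ) : ∃ C : ℕ, ∀ i : ℕ,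
    oddBase (i + 1) ^ ((i + 1 + C₂).choose (u + 1)) ≤
      (2 : ℝ) ^ ((i + 1 + C).choose (u + 2)) := by
  obtain ⟨C', hC'⟩ := exists_pow_le_two_pow (u + 2)
  refine ⟨C' + C₂ + 1, fun i => ?_⟩
  set b := (i + 1 + C₂).choose (u + 1) with hb
  have hx0 : 0 ≤ oddBase (i + 1) := by unfold oddBase; positivity
  -- comparison of the `u + 2`-nd powers
  refine (pow_le_pow_iff_left₀ (by positivity) (by positivity) (show u + 2 ≠ 0 by omega)).1 ?_
  have h1 : oddBase (i + 1) ≤ (i : ℝ) + 2 := by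
    have := oddBase_le (i + 1)
    push_cast at this
    linarith
  have hcomb : (i + C') * b ≤ (i + 1 + (C' + C₂ + 1)).choose (u + 2) * (u + 2) := by
    have h := Nat.add_one_mul_choose_eq (i + (C' + C₂ + 1)) (u + 1)
    rw [show i + 1 + (C' + C₂ + 1) = i + (C' + C₂ + 1) + 1 by ring, ← h]
    exact Nat.mul_le_mul (by omega) (Nat.choose_le_choose _ (by omega))
  calc (oddBase (i + 1) ^ b) ^ (u + 2) = (oddBase (i + 1) ^ (u + 2)) ^ b := by
        rw [← pow_mul, ← pow_mul, mul_comm]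
    _ ≤ (2 ^ (i + C')) ^ b :=
        pow_le_pow_left₀ (by positivity)
          ((pow_le_pow_left₀ hx0 h1 _).trans (hC' i)) _
    _ = 2 ^ ((i + C') * b) := (pow_mul _ _ _).symm
    _ ≤ 2 ^ ((i + 1 + (C' + C₂ + 1)).choose (u + 2) * (u + 2)) :=
        pow_le_pow_right₀ (by norm_num) hcomb
    _ = _ := pow_mul _ _ _

/-- The recursion of the doubled coefficients alone. -/
theorem coeffKdbl_rec_le (r s i : ℕ) : (coeffKdbl r (s + 3) (i + 2) : ℝ) ≤
    coeffKdbl r (s + 3) (i + 1) * (coeffKdbl r (s + 1) (i + 2) + 3) +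
      2 * coeffKdbl r (s + 2) (i + 2) := by
  have h : coeffKdbl r (s + 3) (i + 2) ≤
      coeffKdbl r (s + 3) (i + 1) * (coeffKdbl r (s + 1) (i + 2) + 3) +
        2 * coeffKdbl r (s + 2) (i + 2) := by
    rw [coeffKdbl_rec]
    have h1 := mul_le_mul_of_nonneg_left (coeffK_le_coeffKdbl r (s + 2) i)
      (show 0 ≤ coeffKdbl r (s + 1) (i + 2) + 2 by linarith [one_le_coeffKdbl r s (i + 1)])
    linarith
  exact_mod_cast h

theorem coeffKdbl_nonneg (r s i : ℕ) : (0 : ℝ) ≤ coeffKdbl r (s + 1) (i + 1) := by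
  have := one_le_coeffKdbl r s i
  exact_mod_cast (show 0 ≤ coeffKdbl r (s + 1) (i + 1) by linarith)

/-- Joint induction on the order: each pair of an even and the following odd order is bounded from
the previous pair. -/
theorem coeffKdbl_even_odd_le (r u : ℕ) :
    (∃ C : ℕ, ∀ i : ℕ, (coeffKdbl r (2 * u + 4) (i + 1) : ℝ) ≤
      2 ^ ((i + 1 + C).choose (u + 1))) ∧
    ∃ C : ℕ, ∀ i : ℕ, (coeffKdbl r (2 * u + 5) (i + 1) : ℝ) ≤
      oddBase (i + 1) ^ ((i + 1 + C).choose (u + 1)) := by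
  induction u with
  | zero =>
    constructor
    · refine ⟨50 + 28 * 6 ^ (r - 1), fun i => ?_⟩
      have h1 := coeffKdbl_four_le r i
      have h2 : (50 + 28 * 6 ^ (r - 1) : ℤ) ≤ 2 ^ (50 + 28 * 6 ^ (r - 1)) := by
        exact_mod_cast (Nat.lt_two_pow_self (n := 50 + 28 * 6 ^ (r - 1))).le
      have h3 := mul_le_mul_of_nonneg_right h2 (show (0 : ℤ) ≤ 2 ^ (i + 1) by positivity)
      have h4 : coeffKdbl r 4 (i + 1) ≤ 2 ^ (i + 1 + (50 + 28 * 6 ^ (r - 1))) := by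
        rw [pow_add]
        linarith
      rw [Nat.choose_one_right]
      exact_mod_cast h4
    · obtain ⟨D, hD⟩ := coeffKdbl_five_le r
      obtain ⟨C, hC⟩ := two_pow_mul_factorial_le D
      refine ⟨C, fun i => ?_⟩
      rw [Nat.choose_one_right]
      exact le_trans (by exact_mod_cast hD i) (hC i)
  | succ u ih =>
    obtain ⟨⟨C₁, h1⟩, C₂, h2⟩ := ih
    have heven : ∃ C : ℕ, ∀ i : ℕ, (coeffKdbl r (2 * u + 6) (i + 1) : ℝ) ≤
        2 ^ ((i + 1 + C).choose (u + 2)) := by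
      obtain ⟨C₃, h3⟩ := oddBase_pow_choose_le u C₂
      exact exists_le_pow_choose (D := fun i => coeffKdbl r (2 * u + 6) i)
        (F := fun i => coeffKdbl r (2 * u + 4) i) (H := fun i => coeffKdbl r (2 * u + 5) i)
        (x := fun _ => 2) (fun i => coeffKdbl_nonneg r _ i)
        (fun i => coeffKdbl_rec_le r (2 * u + 3) i) (by norm_num) (fun _ => le_rfl)
        (fun _ => le_rfl) (fun i => h1 (i + 1)) (fun i => (h2 (i + 1)).trans (h3 (i + 1)))
    refine ⟨heven, ?_⟩
    obtain ⟨C₄, h4⟩ := heven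
    exact exists_le_pow_choose (D := fun i => coeffKdbl r (2 * u + 7) i)
      (F := fun i => coeffKdbl r (2 * u + 5) i) (H := fun i => coeffKdbl r (2 * u + 6) i)
      (x := oddBase) (fun i => coeffKdbl_nonneg r _ i)
      (fun i => coeffKdbl_rec_le r (2 * u + 4) i) one_lt_oddBase_one two_le_oddBase
      (fun i => oddBase_mono (Nat.le_succ _)) (fun i => h2 (i + 1))
      (fun i => (h4 (i + 1)).trans (pow_le_pow_left₀ (by norm_num) (two_le_oddBase i) _))

/-- The powers of `oddBase` in the logarithmic notation. -/
theorem oddBase_pow_eq_rpow (i b : ℕ) : oddBase i ^ b =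
    (2 : ℝ) ^ ((b : ℝ) * Real.logb 2 (2 * ((i : ℝ) + 1) / Real.exp 1)) := by
  have hpos : 0 < 2 * ((i : ℝ) + 1) / Real.exp 1 := by positivity
  rw [mul_comm, Real.rpow_mul (by norm_num), Real.rpow_logb (by norm_num) (by norm_num) hpos,
    Real.rpow_natCast, oddBase]

theorem coeffKdbl_even_le (r : ℕ) {s : ℕ} (hs : Even s) (h4 : 4 < s) : ∃ C : ℕ, ∀ i : ℕ, 1 ≤ i →
    coeffKdbl r s i ≤ 2 ^ ((i + C).choose ((s - 2) / 2)) := by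
  obtain ⟨k, hk⟩ := hs
  obtain ⟨C, hC⟩ := (coeffKdbl_even_odd_le r (k - 2)).1
  refine ⟨C, fun i hi => ?_⟩
  have h := hC (i - 1)
  rw [show 2 * (k - 2) + 4 = s by omega, show i - 1 + 1 = i by omega,
    show k - 2 + 1 = (s - 2) / 2 by omega] at h
  exact_mod_cast h

theorem coeffKdbl_odd_le (r : ℕ) {s : ℕ} (hs : Odd s) (h5 : 5 < s) : ∃ C : ℕ, ∀ i : ℕ, 1 ≤ i →
    (coeffKdbl r s i : ℝ) ≤ (2 : ℝ) ^ (((i + C).choose ((s - 2) / 2) : ℝ) *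
      Real.logb 2 (2 * ((i : ℝ) + 1) / Real.exp 1)) := by
  obtain ⟨k, hk⟩ := hs
  obtain ⟨C, hC⟩ := (coeffKdbl_even_odd_le r (k - 2)).2
  refine ⟨C, fun i hi => ?_⟩
  have h := hC (i - 1)
  rw [show 2 * (k - 2) + 5 = s by omega, show i - 1 + 1 = i by omega,
    show k - 2 + 1 = (s - 2) / 2 by omega, oddBase_pow_eq_rpow] at h
  exact h

theorem coeffK_le_coeffKdbl_of_pos (r : ℕ) {s i : ℕ} (hs : 1 ≤ s) (hi : 1 ≤ i) :
    coeffK s i ≤ coeffKdbl r s i := by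
  obtain ⟨s, rfl⟩ : ∃ k, s = k + 1 := ⟨s - 1, by omega⟩
  obtain ⟨i, rfl⟩ : ∃ k, i = k + 1 := ⟨i - 1, by omega⟩
  exact coeffK_le_coeffKdbl r s i

theorem mainTheorem9 :
    -- the upper bounds, with a constant depending only on `r`
    (∀ r : ℕ, 2 ≤ r → ∃ C : ℕ, ∀ i s c n m j : ℕ, 1 ≤ i → 3 ≤ s → s - 2 ≤ c →
      IsLeast {j' : ℕ | 1 ≤ j' ∧ m ≤ ackA i j' ^ c} j →
        (PERM r s n m : ℤ) ≤ coeffK s i * ((n + C * (c * j) ^ (s - 2) * m : ℕ) : ℤ) ∧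
        (dblPERM r s n m : ℤ) ≤ coeffKdbl r s i * ((n + C * (c * j) ^ (s - 2) * m : ℕ) : ℤ)) ∧
    -- the coefficients for `i = 1`
    (∀ s : ℕ, 3 ≤ s → coeffK s 1 = 2 ^ (s - 1)) ∧
    (∀ r s : ℕ, 2 ≤ r → 3 ≤ s → coeffKdbl r s 1 < (6 ^ (r - 1) + 1) * 2 ^ s) ∧
    -- `s = 3`
    (∀ i : ℕ, 1 ≤ i → coeffK 3 i = 2 * i + 2) ∧
    (∀ r : ℕ, 2 ≤ r → ∃ A B : ℝ, 0 < A ∧ 0 < B ∧ ∀ i : ℕ, 1 ≤ i →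
      A * (i : ℝ) ^ 2 ≤ (coeffKdbl r 3 i : ℝ) ∧ (coeffKdbl r 3 i : ℝ) ≤ B * (i : ℝ) ^ 2) ∧
    -- `s = 4`
    (∃ A B : ℝ, 0 < A ∧ 0 < B ∧ ∀ i : ℕ, 1 ≤ i →
      A * 2 ^ i ≤ (coeffK 4 i : ℝ) ∧ (coeffK 4 i : ℝ) ≤ B * 2 ^ i) ∧
    (∀ r : ℕ, 2 ≤ r → ∃ A B : ℝ, 0 < A ∧ 0 < B ∧ ∀ i : ℕ, 1 ≤ i →
      A * 2 ^ i ≤ (coeffKdbl r 4 i : ℝ) ∧ (coeffKdbl r 4 i : ℝ) ≤ B * 2 ^ i) ∧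
    -- `s = 5`
    (∃ C : ℕ, ∀ i : ℕ, 1 ≤ i → coeffK 5 i ≤ 2 ^ i * ((i + C)! : ℤ)) ∧
    (∀ r : ℕ, 2 ≤ r → ∃ C : ℕ, ∀ i : ℕ, 1 ≤ i → coeffKdbl r 5 i ≤ 2 ^ i * ((i + C)! : ℤ)) ∧
    -- even `s > 4`
    (∀ s : ℕ, Even s → 4 < s → ∃ C : ℕ, ∀ i : ℕ, 1 ≤ i →
      coeffK s i ≤ 2 ^ ((i + C).choose ((s - 2) / 2))) ∧
    (∀ r s : ℕ, 2 ≤ r → Even s → 4 < s → ∃ C : ℕ, ∀ i : ℕ, 1 ≤ i →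
      coeffKdbl r s i ≤ 2 ^ ((i + C).choose ((s - 2) / 2))) ∧
    -- odd `s > 5`
    (∀ s : ℕ, Odd s → 5 < s → ∃ C : ℕ, ∀ i : ℕ, 1 ≤ i →
      (coeffK s i : ℝ) ≤ (2 : ℝ) ^ (((i + C).choose ((s - 2) / 2) : ℝ) *
        Real.logb 2 (2 * ((i : ℝ) + 1) / Real.exp 1))) ∧
    (∀ r s : ℕ, 2 ≤ r → Odd s → 5 < s → ∃ C : ℕ, ∀ i : ℕ, 1 ≤ i →
      (coeffKdbl r s i : ℝ) ≤ (2 : ℝ) ^ (((i + C).choose ((s - 2) / 2) : ℝ) *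
        Real.logb 2 (2 * ((i : ℝ) + 1) / Real.exp 1))) := by
  refine ⟨upper_bounds, fun s hs => ?_, fun r s hr hs => ?_, fun i hi => ?_, fun r hr => ?_, ?_,
    fun r hr => ?_, ?_, fun r hr => ?_, fun s hs h4 => ?_, fun r s _ hs h4 => ?_,
    fun s hs h5 => ?_, fun r s _ hs h5 => ?_⟩
  · obtain ⟨s, rfl⟩ : ∃ k, s = k + 2 := ⟨s - 2, by omega⟩
    exact coeffK_first_eq s
  · obtain ⟨s, rfl⟩ : ∃ k, s = k + 2 := ⟨s - 2, by omega⟩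
    have h : (0 : ℤ) < 2 ^ s := by positivity
    have h6 : (0 : ℤ) < 6 ^ (r - 1) := by positivity
    have := mul_pos h h6
    rw [coeffKdbl_first_eq, pow_add]
    linarith
  · obtain ⟨i, rfl⟩ : ∃ k, i = k + 1 := ⟨i - 1, by omega⟩
    rw [coeffK_three]
    push_cast
    ring
  · have h6 : (1 : ℝ) ≤ 6 ^ (r - 1) := one_le_pow₀ (by norm_num)
    refine ⟨1, 6 + 4 * 6 ^ (r - 1), one_pos, by positivity, fun i hi => ?_⟩
    obtain ⟨i, rfl⟩ : ∃ k, i = k + 1 := ⟨i - 1, by omega⟩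
    have hi' : (0 : ℝ) ≤ i := by positivity
    have h := mul_le_mul_of_nonneg_right h6 hi'
    have h2 := mul_le_mul_of_nonneg_right h6 (mul_nonneg hi' hi')
    rw [coeffKdbl_three]
    push_cast
    constructor <;> nlinarith
  · refine ⟨1, 10, one_pos, by norm_num, fun i hi => ?_⟩
    obtain ⟨i, rfl⟩ : ∃ k, i = k + 1 := ⟨i - 1, by omega⟩
    rw [one_mul]
    exact ⟨by exact_mod_cast two_pow_le_coeffK_four i, by exact_mod_cast coeffK_four_le i⟩
  · refine ⟨1, 50 + 28 * 6 ^ (r - 1), one_pos, by positivity, fun i hi => ?_⟩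
    obtain ⟨i, rfl⟩ : ∃ k, i = k + 1 := ⟨i - 1, by omega⟩
    rw [one_mul]
    exact ⟨by exact_mod_cast (two_pow_le_coeffK_four i).trans (coeffK_le_coeffKdbl r 3 i),
      by exact_mod_cast coeffKdbl_four_le r i⟩
  · refine ⟨3, fun i hi => ?_⟩
    obtain ⟨i, rfl⟩ : ∃ k, i = k + 1 := ⟨i - 1, by omega⟩
    exact coeffK_five_le i
  · obtain ⟨C, hC⟩ := coeffKdbl_five_le r
    refine ⟨C, fun i hi => ?_⟩
    obtain ⟨i, rfl⟩ : ∃ k, i = k + 1 := ⟨i - 1, by omega⟩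
    exact hC i
  · obtain ⟨C, hC⟩ := coeffKdbl_even_le 2 hs h4
    exact ⟨C, fun i hi => (coeffK_le_coeffKdbl_of_pos 2 (by omega) hi).trans (hC i hi)⟩
  · exact coeffKdbl_even_le r hs h4
  · obtain ⟨C, hC⟩ := coeffKdbl_odd_le 2 hs h5
    exact ⟨C, fun i hi => le_trans
      (by exact_mod_cast coeffK_le_coeffKdbl_of_pos 2 (by omega) hi) (hC i hi)⟩
  · exact coeffKdbl_odd_le r hs h5
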